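/- Let $M$ be a connected smooth real 4-manifold (Hausdorff, second countable) with a smooth Lorentzian metric $g$ (signature $(+,-,-,-)$) and a smooth affine connection $\Gamma$, $\nabla_\mu v^\lambda=\partial_\mu v^\lambda+\Gamma^\lambda{}_{\mu\nu}v^\nu$, with curvature $$R^\kappa{}_{\lambda\mu\nu}=\partial_\mu\Gamma^\kappa{}_{\nu\lambda}-\partial_\nu\Gamma^\kappa{}_{\mu\lambda}+\Gamma^\kappa{}_{\mu\eta}\Gamma^\eta{}_{\nu\lambda}-\Gamma^\kappa{}_{\nu\eta}\Gamma^\eta{}_{\mu\lambda}.$$ Let $\mathbf R$ be the 96-dimensional space of real tensors $R^\kappa{}_{\lambda\mu\nu}=-R^\kappa{}_{\lambda\nu\mu}$, let $(R^*)_{\kappa\lambda\mu\nu}=\frac12\sqrt{|\det g|}\,R_{\kappa\lambda\mu'\nu'}\varepsilon^{\mu'\nu'}{}_{\mu\nu}$, and decompose $\mathbf R$ into the direct sum of the following 11 subspaces, irreducible under $\mathrm O(1,3)$. With $$\Phi_{a,b,c}(A)_{\kappa\lambda\mu\nu}=a(g_{\kappa\mu}A_{\lambda\nu}-g_{\kappa\nu}A_{\lambda\mu})+b(g_{\lambda\mu}A_{\kappa\nu}-g_{\lambda\nu}A_{\kappa\mu})+c\,g_{\kappa\lambda}A_{\mu\nu}:$$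 - $\mathbf R^{(1)}$ (scalar): $R_{\kappa\lambda\mu\nu}=\frac s{12}(g_{\kappa\mu}g_{\lambda\nu}-g_{\kappa\nu}g_{\lambda\mu})$, $s\in\mathbb R$; $\mathbf R^{(1)}_*$ (pseudoscalar): $R^*$ is of this form; - $\mathbf R^{(6,l)}$, $l=1,2,3$: $R=\Phi_{a,b,c}(A)$, $A$ antisymmetric, with $(a,b,c)=(\frac5{12},-\frac1{12},-\frac16)$, $(-\frac1{12},\frac5{12},-\frac16)$, $(-\frac1{12},-\frac1{12},\frac13)$ for $l=1,2,3$; - $\mathbf R^{(9,l)}$, $l=1,2$: $R=\Phi_{a,b,0}(A)$, $A$ symmetric and trace-free, with $(a,b)=(\frac38,-\frac18)$, $(-\frac18,\frac38)$ for $l=1,2$; $\mathbf R_*^{(9,l)}$, $l=1,2$: $R^*$ is of this form; - $\mathbf R^{(10)}$ (Weyl), respectively $\mathbf R^{(30)}$: all traces of $R$ and of $R^*$ vanish and $R_{\kappa\lambda\mu\nu}=-R_{\lambda\kappa\mu\nu}$, respectively $R_{\kappa\lambda\mu\nu}=R_{\lambda\kappa\mu\nu}$. A piece is *simple* if its subspace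 is not isomorphic, by a linear bijection commuting with $\mathrm O(1,3)$, to any of the other ten subspaces. The spacetime $\{M,g,\Gamma\}$ is a *pseudoinstanton* if $\nabla g\equiv0$ and all irreducible pieces of its curvature but one are identically zero, that one being simple. It is a *scalar*, *pseudoscalar* or *Weyl pseudoinstanton* if $\nabla g\equiv0$ and all pieces of curvature apart from the one in $\mathbf R^{(1)}$, $\mathbf R^{(1)}_*$ or $\mathbf R^{(10)}$, respectively, are identically zero. Let $q:\mathbf R\to\mathbb R$ be any $\mathrm O(1,3)$-invariant quadratic form, evaluated at a point of $M$ by means of an arbitrary orthonormal frame, and let $S=\int q(R)\sqrt{|\det g|}\,dx^0dx^1dx^2dx^3$. The field equation $\partial S/\partial g=0$ (respectively $\partial S/\partial\Gamma=0$) means that in every coordinate chart and for every compact set $K$ in the coordinate domain the action over $K$ is stationary under all smooth variations $g+t\,h$ with $h$ symmetric (respectively $\Gamma+t\,\gamma$ with $\gamma^\lambda{}_{\mu\nu}$ arbitrary) supported in $K$, with $\Gamma$ (respectively $g$) fixed. **Theorem.** Every pseudoinstanton is a solution of both field equations $\partial S/\partial g=0$ and $\partial S/\partial\Gamma=0$,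 for every $\mathrm O(1,3)$-invariant quadratic form $q$. In particular this holds for scalar, pseudoscalar and Weyl pseudoinstantons. -/

import Mathlib

open scoped Manifold ContDiff Matrix
open MeasureTheory

/-! ## Algebra of curvature tensors on a four-dimensional space -/

/-- The Minkowski metric `diag(+1, -1, -1, -1)`. -/
def minkowski : Matrix (Fin 4) (Fin 4) ℝ := Matrix.diagonal ![1, -1, -1, -1]

/-- The 96-dimensional space of real rank 4 tensors `R κ lam μ ν` (first index upper, the others
lower) which are antisymmetric in the last two indices. -/
def CurvatureTensor : Submodule ℝ (Fin 4 → Fin 4 → Fin 4 → Fin 4 → ℝ) where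
  carrier := {R | ∀ κ lam μ ν, R κ lam μ ν = -R κ lam ν μ}
  add_mem' := by
    intro a b ha hb κ lam μ ν
    simp only [Pi.add_apply]
    rw [ha, hb]
    ring
  zero_mem' := by
    intro κ lam μ ν
    simp
  smul_mem' := by
    intro c a ha κ lam μ ν
    simp only [Pi.smul_apply, smul_eq_mul]
    rw [ha]
    ring

/-- Components of a curvature tensor with respect to the new frame `e_a = ∑ μ, P μ a ∂_μ`. -/
noncomputable def frameChange (P : Matrix (Fin 4) (Fin 4) ℝ) :
    CurvatureTensor →ₗ[ℝ] CurvatureTensor where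
  toFun R := ⟨fun a b c d => ∑ κ, P⁻¹ a κ * ∑ lam, P lam b * ∑ μ, P μ c * ∑ ν, P ν d *
      R.1 κ lam μ ν, by
    intro a b c d
    rw [← Finset.sum_neg_distrib]
    refine Finset.sum_congr rfl fun κ _ => ?_
    rw [← mul_neg, ← Finset.sum_neg_distrib]
    congr 1
    refine Finset.sum_congr rfl fun lam _ => ?_
    rw [← mul_neg, ← Finset.sum_neg_distrib]
    congr 1
    simp only [Finset.mul_sum]
    rw [Finset.sum_comm]
    refine Finset.sum_congr rfl fun ν _ => ?_
    rw [← Finset.sum_neg_distrib]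
    refine Finset.sum_congr rfl fun μ _ => ?_
    rw [R.2 κ lam μ ν]
    ring⟩
  map_add' R Q := by
    ext a b c d
    simp [mul_add, Finset.sum_add_distrib]
  map_smul' s R := by
    ext a b c d
    simp only [Submodule.coe_smul, Pi.smul_apply, smul_eq_mul, RingHom.id_apply, Finset.mul_sum]
    refine Finset.sum_congr rfl fun κ _ => Finset.sum_congr rfl fun lam _ =>
      Finset.sum_congr rfl fun μ _ => Finset.sum_congr rfl fun ν _ => ?_
    ring

/-- The full Lorentz group `O(1,3)`, as a set of matrices. -/
def IsLorentz (L : Matrix (Fin 4) (Fin 4) ℝ) : Prop := Lᵀ * minkowski * L = minkowski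

/-- `O(1,3)`-invariance of a quadratic form on curvature. -/
def IsLorentzInvariant (q : QuadraticForm ℝ CurvatureTensor) : Prop :=
  ∀ L, IsLorentz L → ∀ R, q (frameChange L R) = q R

/-- `P` is an orthonormal frame for the metric with components `g`. -/
def IsOrthonormalFrame (g P : Matrix (Fin 4) (Fin 4) ℝ) : Prop := Pᵀ * g * P = minkowski

open Classical in
/-- The value of the quadratic form `q` on the curvature tensor `R` when the metric is `g`: express
`R` in an orthonormal frame and apply `q`. (Junk value `0` if `g` is not Lorentzian.) -/
noncomputable def quadAt (q : QuadraticForm ℝ CurvatureTensor) (g : Matrix (Fin 4) (Fin 4) ℝ)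
    (R : CurvatureTensor) : ℝ :=
  if h : ∃ P, IsOrthonormalFrame g P then q (frameChange h.choose R) else 0

theorem isUnit_det_of_isOrthonormalFrame {g P : Matrix (Fin 4) (Fin 4) ℝ}
    (h : IsOrthonormalFrame g P) : IsUnit P.det := by
  have h1 := congrArg Matrix.det h
  rw [Matrix.det_mul, minkowski, Matrix.det_diagonal] at h1
  rw [isUnit_iff_ne_zero]
  intro h0
  rw [h0] at h1
  simp [Fin.prod_univ_four] at h1

theorem frameChange_mul (P Q : Matrix (Fin 4) (Fin 4) ℝ) (R : CurvatureTensor) :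
    frameChange (P * Q) R = frameChange Q (frameChange P R) := by
  have key : ∀ (T : Fin 4 → Fin 4 → ℝ) (u : Fin 4 → ℝ) (v : Fin 4 → ℝ) (c : Fin 4 → ℝ),
      (∑ i, u i * ∑ j, c j * T i j) = ∑ j, c j * ∑ i, u i * T i j := by
    intro T u v c
    simp only [Finset.mul_sum]
    rw [Finset.sum_comm]
    refine Finset.sum_congr rfl fun _ _ => Finset.sum_congr rfl fun _ _ => ?_
    ring
  have assoc : ∀ (A B : Matrix (Fin 4) (Fin 4) ℝ) (f : Fin 4 → ℝ) (i : Fin 4),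
      (∑ k, (A * B) k i * f k) = ∑ j, B j i * ∑ k, A k j * f k := by
    intro A B f i
    simp only [Matrix.mul_apply, Finset.sum_mul, Finset.mul_sum]
    rw [Finset.sum_comm]
    refine Finset.sum_congr rfl fun _ _ => Finset.sum_congr rfl fun _ _ => ?_
    ring
  have assoc' : ∀ (A B : Matrix (Fin 4) (Fin 4) ℝ) (f : Fin 4 → ℝ) (i : Fin 4),
      (∑ k, (A * B) i k * f k) = ∑ j, A i j * ∑ k, B j k * f k := by
    intro A B f i
    simp only [Matrix.mul_apply, Finset.sum_mul, Finset.mul_sum]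
    rw [Finset.sum_comm]
    refine Finset.sum_congr rfl fun _ _ => Finset.sum_congr rfl fun _ _ => ?_
    ring
  ext a b c d
  simp only [frameChange, LinearMap.coe_mk, AddHom.coe_mk, Matrix.mul_inv_rev]
  simp only [assoc, assoc']
  refine Finset.sum_congr rfl fun a' _ => ?_
  congr 1
  rw [key _ _ 0]
  refine Finset.sum_congr rfl fun b' _ => ?_
  congr 1
  simp only [key _ (fun i => P i b') 0 (fun j => Q j c)]
  rw [key _ _ 0]
  refine Finset.sum_congr rfl fun c' _ => ?_
  congr 1
  simp only [key _ (fun i => P i c') 0 (fun j => Q j d)]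
  simp only [key _ (fun i => P i b') 0 (fun j => Q j d)]
  rw [key _ _ 0]

/-- For an invariant form, `quadAt` does not depend on the orthonormal frame. -/
theorem quadAt_eq {q : QuadraticForm ℝ CurvatureTensor} (hq : IsLorentzInvariant q)
    {g P : Matrix (Fin 4) (Fin 4) ℝ} (hP : IsOrthonormalFrame g P) (R : CurvatureTensor) :
    quadAt q g R = q (frameChange P R) := by
  have h : ∃ P, IsOrthonormalFrame g P := ⟨P, hP⟩
  have hQ := h.choose_spec
  unfold quadAt
  rw [dif_pos h]
  set Q := h.choose
  have hPu := isUnit_det_of_isOrthonormalFrame hP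
  have hmul : P * (P⁻¹ * Q) = Q := by
    rw [← Matrix.mul_assoc, Matrix.mul_nonsing_inv _ hPu, Matrix.one_mul]
  have hL : IsLorentz (P⁻¹ * Q) := by
    unfold IsLorentz
    rw [← hP]
    have : (P⁻¹ * Q)ᵀ * (Pᵀ * g * P) * (P⁻¹ * Q)
        = (P * (P⁻¹ * Q))ᵀ * g * (P * (P⁻¹ * Q)) := by
      simp only [Matrix.transpose_mul, Matrix.mul_assoc]
    rw [this, hmul, hQ, hP]
  rw [← hmul, frameChange_mul, hq _ hL]

/-! ## The irreducible decomposition of curvature -/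

/-- The totally antisymmetric symbol `ε_{κ lam μ ν}` with `ε_{0123} = 1`. -/
noncomputable def leviCivitaSymbol (κ lam μ ν : Fin 4) : ℝ :=
  Matrix.det (Matrix.of fun i j : Fin 4 => if ![κ, lam, μ, ν] i = j then (1 : ℝ) else 0)

/-- Lower the first index: `R_{κ lam μ ν} = g_{κα} R^α_{lam μ ν}`. -/
noncomputable def lowered (g : Matrix (Fin 4) (Fin 4) ℝ) (R : CurvatureTensor) :
    Fin 4 → Fin 4 → Fin 4 → Fin 4 → ℝ :=
  fun κ lam μ ν => ∑ α, g κ α * R.1 α lam μ ν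

/-- The right Hodge star (all indices lower):
`(R^*)_{κ lam μ ν} = ½ √|det g| R_{κ lam μ' ν'} ε^{μ' ν'}_{μ ν}`. -/
noncomputable def loweredStar (g : Matrix (Fin 4) (Fin 4) ℝ) (R : CurvatureTensor) :
    Fin 4 → Fin 4 → Fin 4 → Fin 4 → ℝ :=
  fun κ lam μ ν => (1 / 2) * √|g.det| * ∑ μ', ∑ ν', lowered g R κ lam μ' ν' *
    ∑ α, ∑ β, g⁻¹ μ' α * g⁻¹ ν' β * leviCivitaSymbol α β μ ν

theorem lowered_add (g : Matrix (Fin 4) (Fin 4) ℝ) (R Q : CurvatureTensor) :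
    lowered g (R + Q) = lowered g R + lowered g Q := by
  ext κ lam μ ν
  simp [lowered, mul_add, Finset.sum_add_distrib]

theorem lowered_smul (g : Matrix (Fin 4) (Fin 4) ℝ) (s : ℝ) (R : CurvatureTensor) :
    lowered g (s • R) = s • lowered g R := by
  ext κ lam μ ν
  simp [lowered, Finset.mul_sum, mul_left_comm]

theorem loweredStar_add (g : Matrix (Fin 4) (Fin 4) ℝ) (R Q : CurvatureTensor) :
    loweredStar g (R + Q) = loweredStar g R + loweredStar g Q := by
  ext κ lam μ ν
  simp only [loweredStar, lowered_add, Pi.add_apply, add_mul, Finset.sum_add_distrib]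
  ring

theorem loweredStar_smul (g : Matrix (Fin 4) (Fin 4) ℝ) (s : ℝ) (R : CurvatureTensor) :
    loweredStar g (s • R) = s • loweredStar g R := by
  ext κ lam μ ν
  simp only [loweredStar, lowered_smul, Pi.smul_apply, smul_eq_mul, mul_assoc]
  simp only [← Finset.mul_sum]
  ring

/-- The map `s ↦ (1/12) (g_{κμ} g_{lam ν} - g_{κν} g_{lam μ}) s`. -/
noncomputable def scalarTensor (g : Matrix (Fin 4) (Fin 4) ℝ) (s : ℝ) :
    Fin 4 → Fin 4 → Fin 4 → Fin 4 → ℝ :=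
  fun κ lam μ ν => 1 / 12 * (g κ μ * g lam ν - g κ ν * g lam μ) * s

/-- The expression `a (g_{κμ} A_{lam ν} - g_{κν} A_{lam μ}) + b (g_{lam μ} A_{κν} - g_{lam ν} A_{κμ})
+ c g_{κ lam} A_{μν}`. -/
noncomputable def rankTwoTensor (g : Matrix (Fin 4) (Fin 4) ℝ) (a b c : ℝ)
    (A : Matrix (Fin 4) (Fin 4) ℝ) : Fin 4 → Fin 4 → Fin 4 → Fin 4 → ℝ :=
  fun κ lam μ ν => a * (g κ μ * A lam ν - g κ ν * A lam μ)
    + b * (g lam μ * A κ ν - g lam ν * A κ μ) + c * (g κ lam * A μ ν)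

/-- The coefficients `a_{6lm}`. -/
noncomputable def coeffSix : Matrix (Fin 3) (Fin 3) ℝ :=
  !![5/12, -1/12, -1/6; -1/12, 5/12, -1/6; -1/12, -1/12, 1/3]

/-- The coefficients `a_{9lm} = a^*_{9lm}`. -/
noncomputable def coeffNine : Matrix (Fin 2) (Fin 2) ℝ := !![3/8, -1/8; -1/8, 3/8]

/-- Symmetric rank 2 tensors which are trace-free with respect to `g`. -/
def IsSymmTraceFree (g S : Matrix (Fin 4) (Fin 4) ℝ) : Prop :=
  Sᵀ = S ∧ ∑ μ, ∑ ν, g⁻¹ μ ν * S μ ν = 0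

/-- All traces of a (lowered) curvature tensor vanish. -/
def IsTraceFree (g : Matrix (Fin 4) (Fin 4) ℝ) (T : Fin 4 → Fin 4 → Fin 4 → Fin 4 → ℝ) : Prop :=
  (∀ lam ν, ∑ κ, ∑ μ, g⁻¹ κ μ * T κ lam μ ν = 0) ∧
  (∀ κ ν, ∑ lam, ∑ μ, g⁻¹ lam μ * T κ lam μ ν = 0)

/-- The common conditions defining the 10- and 30-dimensional pieces: all traces of `R` and of its
right dual are zero. -/
def AllTracesZero (g : Matrix (Fin 4) (Fin 4) ℝ) (R : CurvatureTensor) : Prop :=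
  IsTraceFree g (lowered g R) ∧ IsTraceFree g (loweredStar g R) ∧
    ∀ μ ν, ∑ κ, R.1 κ κ μ ν = 0

theorem scalarTensor_add (g : Matrix (Fin 4) (Fin 4) ℝ) (s t : ℝ) :
    scalarTensor g s + scalarTensor g t = scalarTensor g (s + t) := by
  ext κ lam μ ν
  simp only [scalarTensor, Pi.add_apply]
  ring

theorem scalarTensor_smul (g : Matrix (Fin 4) (Fin 4) ℝ) (s t : ℝ) :
    s • scalarTensor g t = scalarTensor g (s * t) := by
  ext κ lam μ ν
  simp only [scalarTensor, Pi.smul_apply, smul_eq_mul]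
  ring

theorem rankTwoTensor_add (g : Matrix (Fin 4) (Fin 4) ℝ) (a b c : ℝ)
    (A B : Matrix (Fin 4) (Fin 4) ℝ) :
    rankTwoTensor g a b c A + rankTwoTensor g a b c B = rankTwoTensor g a b c (A + B) := by
  ext κ lam μ ν
  simp only [rankTwoTensor, Pi.add_apply, Matrix.add_apply]
  ring

theorem rankTwoTensor_smul (g : Matrix (Fin 4) (Fin 4) ℝ) (a b c s : ℝ)
    (A : Matrix (Fin 4) (Fin 4) ℝ) :
    s • rankTwoTensor g a b c A = rankTwoTensor g a b c (s • A) := by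
  ext κ lam μ ν
  simp only [rankTwoTensor, Pi.smul_apply, Matrix.smul_apply, smul_eq_mul]
  ring

theorem IsSymmTraceFree.add {g S T : Matrix (Fin 4) (Fin 4) ℝ} (hS : IsSymmTraceFree g S)
    (hT : IsSymmTraceFree g T) : IsSymmTraceFree g (S + T) := by
  refine ⟨by rw [Matrix.transpose_add, hS.1, hT.1], ?_⟩
  simp only [Matrix.add_apply, mul_add, Finset.sum_add_distrib, hS.2, hT.2, add_zero]

theorem IsSymmTraceFree.smul {g S : Matrix (Fin 4) (Fin 4) ℝ} (hS : IsSymmTraceFree g S)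
    (s : ℝ) : IsSymmTraceFree g (s • S) := by
  refine ⟨by rw [Matrix.transpose_smul, hS.1], ?_⟩
  simp only [Matrix.smul_apply, smul_eq_mul, mul_left_comm _ s, ← Finset.mul_sum, hS.2, mul_zero]

theorem IsTraceFree.add {g : Matrix (Fin 4) (Fin 4) ℝ} {T U : Fin 4 → Fin 4 → Fin 4 → Fin 4 → ℝ}
    (hT : IsTraceFree g T) (hU : IsTraceFree g U) : IsTraceFree g (T + U) := by
  constructor <;> intro i j
  · simp only [Pi.add_apply, mul_add, Finset.sum_add_distrib, hT.1, hU.1, add_zero]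
  · simp only [Pi.add_apply, mul_add, Finset.sum_add_distrib, hT.2, hU.2, add_zero]

theorem IsTraceFree.smul {g : Matrix (Fin 4) (Fin 4) ℝ} {T : Fin 4 → Fin 4 → Fin 4 → Fin 4 → ℝ}
    (hT : IsTraceFree g T) (s : ℝ) : IsTraceFree g (s • T) := by
  constructor <;> intro i j
  · simp only [Pi.smul_apply, smul_eq_mul, mul_left_comm _ s, ← Finset.mul_sum, hT.1, mul_zero]
  · simp only [Pi.smul_apply, smul_eq_mul, mul_left_comm _ s, ← Finset.mul_sum, hT.2, mul_zero]

theorem AllTracesZero.add {g : Matrix (Fin 4) (Fin 4) ℝ} {R Q : CurvatureTensor}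
    (hR : AllTracesZero g R) (hQ : AllTracesZero g Q) : AllTracesZero g (R + Q) := by
  refine ⟨?_, ?_, fun μ ν => ?_⟩
  · rw [lowered_add]
    exact hR.1.add hQ.1
  · rw [loweredStar_add]
    exact hR.2.1.add hQ.2.1
  · simp only [Submodule.coe_add, Pi.add_apply, Finset.sum_add_distrib, hR.2.2, hQ.2.2, add_zero]

theorem AllTracesZero.smul {g : Matrix (Fin 4) (Fin 4) ℝ} {R : CurvatureTensor}
    (hR : AllTracesZero g R) (s : ℝ) : AllTracesZero g (s • R) := by
  refine ⟨?_, ?_, fun μ ν => ?_⟩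
  · rw [lowered_smul]
    exact hR.1.smul s
  · rw [loweredStar_smul]
    exact hR.2.1.smul s
  · simp only [Submodule.coe_smul, Pi.smul_apply, smul_eq_mul, ← Finset.mul_sum, hR.2.2, mul_zero]

/-- Labels of the 11 irreducible pieces of curvature: `R^{(1)}`, `R_*^{(1)}`, `R^{(6,l)}`,
`R^{(9,l)}`, `R_*^{(9,l)}`, `R^{(10)}`, `R^{(30)}`. -/
inductive PieceLabel where
  | scalar
  | pseudoscalar
  | six (l : Fin 3)
  | nine (l : Fin 2)
  | nineStar (l : Fin 2)
  | weyl
  | thirty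
  deriving DecidableEq, Fintype

/-- Membership of a curvature tensor in the irreducible subspace with a given label. -/
def InPiece (g : Matrix (Fin 4) (Fin 4) ℝ) : PieceLabel → CurvatureTensor → Prop
  | .scalar, R => ∃ s, lowered g R = scalarTensor g s
  | .pseudoscalar, R => ∃ s, loweredStar g R = scalarTensor g s
  | .six l, R => ∃ A : Matrix (Fin 4) (Fin 4) ℝ, Aᵀ = -A ∧
      lowered g R = rankTwoTensor g (coeffSix l 0) (coeffSix l 1) (coeffSix l 2) A
  | .nine l, R => ∃ S : Matrix (Fin 4) (Fin 4) ℝ, IsSymmTraceFree g S ∧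
      lowered g R = rankTwoTensor g (coeffNine l 0) (coeffNine l 1) 0 S
  | .nineStar l, R => ∃ S : Matrix (Fin 4) (Fin 4) ℝ, IsSymmTraceFree g S ∧
      loweredStar g R = rankTwoTensor g (coeffNine l 0) (coeffNine l 1) 0 S
  | .weyl, R => AllTracesZero g R ∧ ∀ κ lam μ ν, lowered g R κ lam μ ν = -lowered g R lam κ μ ν
  | .thirty, R => AllTracesZero g R ∧ ∀ κ lam μ ν, lowered g R κ lam μ ν = lowered g R lam κ μ ν

theorem InPiece.add {g : Matrix (Fin 4) (Fin 4) ℝ} {i : PieceLabel} {R Q : CurvatureTensor}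
    (hR : InPiece g i R) (hQ : InPiece g i Q) : InPiece g i (R + Q) := by
  cases i with
  | scalar =>
    obtain ⟨s, hs⟩ := hR
    obtain ⟨t, ht⟩ := hQ
    exact ⟨s + t, by rw [lowered_add, hs, ht, scalarTensor_add]⟩
  | pseudoscalar =>
    obtain ⟨s, hs⟩ := hR
    obtain ⟨t, ht⟩ := hQ
    exact ⟨s + t, by rw [loweredStar_add, hs, ht, scalarTensor_add]⟩
  | six l =>
    obtain ⟨A, hA, hA'⟩ := hR
    obtain ⟨B, hB, hB'⟩ := hQ
    exact ⟨A + B, by rw [Matrix.transpose_add, hA, hB, neg_add],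
      by rw [lowered_add, hA', hB', rankTwoTensor_add]⟩
  | nine l =>
    obtain ⟨A, hA, hA'⟩ := hR
    obtain ⟨B, hB, hB'⟩ := hQ
    exact ⟨A + B, hA.add hB, by rw [lowered_add, hA', hB', rankTwoTensor_add]⟩
  | nineStar l =>
    obtain ⟨A, hA, hA'⟩ := hR
    obtain ⟨B, hB, hB'⟩ := hQ
    exact ⟨A + B, hA.add hB, by rw [loweredStar_add, hA', hB', rankTwoTensor_add]⟩
  | weyl =>
    refine ⟨hR.1.add hQ.1, fun κ lam μ ν => ?_⟩
    simp only [lowered_add, Pi.add_apply]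
    rw [hR.2, hQ.2]
    ring
  | thirty =>
    refine ⟨hR.1.add hQ.1, fun κ lam μ ν => ?_⟩
    simp only [lowered_add, Pi.add_apply]
    rw [hR.2, hQ.2]

theorem InPiece.smul {g : Matrix (Fin 4) (Fin 4) ℝ} {i : PieceLabel} {R : CurvatureTensor}
    (hR : InPiece g i R) (s : ℝ) : InPiece g i (s • R) := by
  cases i with
  | scalar =>
    obtain ⟨t, ht⟩ := hR
    exact ⟨s * t, by rw [lowered_smul, ht, scalarTensor_smul]⟩
  | pseudoscalar =>
    obtain ⟨t, ht⟩ := hR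
    exact ⟨s * t, by rw [loweredStar_smul, ht, scalarTensor_smul]⟩
  | six l =>
    obtain ⟨A, hA, hA'⟩ := hR
    exact ⟨s • A, by rw [Matrix.transpose_smul, hA, smul_neg],
      by rw [lowered_smul, hA', rankTwoTensor_smul]⟩
  | nine l =>
    obtain ⟨A, hA, hA'⟩ := hR
    exact ⟨s • A, hA.smul s, by rw [lowered_smul, hA', rankTwoTensor_smul]⟩
  | nineStar l =>
    obtain ⟨A, hA, hA'⟩ := hR
    exact ⟨s • A, hA.smul s, by rw [loweredStar_smul, hA', rankTwoTensor_smul]⟩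
  | weyl =>
    refine ⟨hR.1.smul s, fun κ lam μ ν => ?_⟩
    simp only [lowered_smul, Pi.smul_apply, smul_eq_mul]
    rw [hR.2]
    ring
  | thirty =>
    refine ⟨hR.1.smul s, fun κ lam μ ν => ?_⟩
    simp only [lowered_smul, Pi.smul_apply, smul_eq_mul]
    rw [hR.2]

theorem InPiece.zero (g : Matrix (Fin 4) (Fin 4) ℝ) (i : PieceLabel) : InPiece g i 0 := by
  have h1 : lowered g 0 = 0 := by simpa using lowered_smul g 0 0
  have h2 : loweredStar g 0 = 0 := by simpa using loweredStar_smul g 0 0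
  have h3 : scalarTensor g 0 = 0 := by simpa using (scalarTensor_smul g 0 0).symm
  have h4 : ∀ a b c, rankTwoTensor g a b c 0 = 0 := fun a b c => by
    simpa using (rankTwoTensor_smul g a b c 0 0).symm
  have h5 : IsSymmTraceFree g 0 := by simp [IsSymmTraceFree]
  have h6 : AllTracesZero g 0 := by
    refine ⟨?_, ?_, ?_⟩ <;> simp [h1, h2, IsTraceFree]
  cases i with
  | scalar => exact ⟨0, by rw [h1, h3]⟩
  | pseudoscalar => exact ⟨0, by rw [h2, h3]⟩
  | six l => exact ⟨0, by simp, by rw [h1, h4]⟩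
  | nine l => exact ⟨0, h5, by rw [h1, h4]⟩
  | nineStar l => exact ⟨0, h5, by rw [h2, h4]⟩
  | weyl => exact ⟨h6, by simp [h1]⟩
  | thirty => exact ⟨h6, by simp [h1]⟩

/-- The 11 irreducible subspaces of curvature. -/
def irreducibleSubspace (g : Matrix (Fin 4) (Fin 4) ℝ) (i : PieceLabel) :
    Submodule ℝ CurvatureTensor where
  carrier := {R | InPiece g i R}
  add_mem' hR hQ := InPiece.add hR hQ
  zero_mem' := InPiece.zero g i
  smul_mem' s _ hR := InPiece.smul hR s

/-- Two irreducible subspaces are isomorphic: there is a linear bijection between them which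
commutes with the action of `O(1,3)`. -/
def PiecesIsomorphic (i j : PieceLabel) : Prop :=
  ∃ B : irreducibleSubspace minkowski i ≃ₗ[ℝ] irreducibleSubspace minkowski j,
    ∀ L, IsLorentz L → ∀ R R' : irreducibleSubspace minkowski i,
      R'.1 = frameChange L R.1 → (B R').1 = frameChange L (B R).1

/-- A piece is simple if its subspace is not isomorphic to any of the other ones. -/
def PieceLabel.IsSimple (i : PieceLabel) : Prop := ∀ j, j ≠ i → ¬ PiecesIsomorphic i j

/-- `r` is the decomposition of `R` into irreducible pieces. -/
def IsDecomposition (g : Matrix (Fin 4) (Fin 4) ℝ) (R : CurvatureTensor)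
    (r : PieceLabel → CurvatureTensor) : Prop :=
  (∀ i, r i ∈ irreducibleSubspace g i) ∧ R = ∑ i, r i

/-- All irreducible pieces of `R` apart from the `i`-th one are zero. -/
def IsPurely (g : Matrix (Fin 4) (Fin 4) ℝ) (i : PieceLabel) (R : CurvatureTensor) : Prop :=
  ∃ r, IsDecomposition g R r ∧ ∀ j, j ≠ i → r j = 0

/-! ## Metric, connection and action in local coordinates -/

/-- The coordinate space. -/
abbrev CoordSpace : Type := EuclideanSpace ℝ (Fin 4)

/-- The partial derivative `∂_μ f`. -/
noncomputable def partialD (μ : Fin 4) (f : CoordSpace → ℝ) (y : CoordSpace) : ℝ :=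
  fderiv ℝ f y (EuclideanSpace.single μ 1)

/-- The curvature of the connection with coefficients `Γ y κ μ ν = Γ^κ_{μν}(y)`, where
`∇_μ v^κ = ∂_μ v^κ + Γ^κ_{μν} v^ν`:
`R^κ_{lam μν} = ∂_μ Γ^κ_{ν lam} - ∂_ν Γ^κ_{μ lam} + Γ^κ_{μη} Γ^η_{ν lam} - Γ^κ_{νη} Γ^η_{μ lam}`. -/
noncomputable def curvature (Γ : CoordSpace → Fin 4 → Fin 4 → Fin 4 → ℝ) (y : CoordSpace) :
    CurvatureTensor :=
  ⟨fun κ lam μ ν => partialD μ (fun z => Γ z κ ν lam) y - partialD ν (fun z => Γ z κ μ lam) y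
      + ∑ η, Γ y κ μ η * Γ y η ν lam - ∑ η, Γ y κ ν η * Γ y η μ lam, by
    intro κ lam μ ν
    ring⟩

/-- The action `∫ q(R) √|det g| dx⁰dx¹dx²dx³` over a coordinate region `K`. -/
noncomputable def action (q : QuadraticForm ℝ CurvatureTensor) (K : Set CoordSpace)
    (g : CoordSpace → Matrix (Fin 4) (Fin 4) ℝ)
    (Γ : CoordSpace → Fin 4 → Fin 4 → Fin 4 → ℝ) : ℝ :=
  ∫ y in K, quadAt q (g y) (curvature Γ y) * √|(g y).det|

/-! ## Spacetimes -/

/-- A spacetime `{M, g, Γ}`: a 4-manifold with a smooth Lorentzian metric and a smooth affine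
connection. (Smoothness, connectedness etc. of `M` are required where spacetimes are used.) -/
structure Spacetime (M : Type*) [TopologicalSpace M] [ChartedSpace CoordSpace M]
    [IsManifold 𝓘(ℝ, CoordSpace) ∞ M] where
  /-- the metric -/
  metric : ∀ x : M, TangentSpace 𝓘(ℝ, CoordSpace) x →L[ℝ]
    TangentSpace 𝓘(ℝ, CoordSpace) x →L[ℝ] ℝ
  metric_smooth : ContMDiff 𝓘(ℝ, CoordSpace)
    (𝓘(ℝ, CoordSpace).prod 𝓘(ℝ, CoordSpace →L[ℝ] CoordSpace →L[ℝ] ℝ)) ∞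
    (fun x => Bundle.TotalSpace.mk' (CoordSpace →L[ℝ] CoordSpace →L[ℝ] ℝ)
      (E := fun x : M => TangentSpace 𝓘(ℝ, CoordSpace) x →L[ℝ]
        TangentSpace 𝓘(ℝ, CoordSpace) x →L[ℝ] ℝ) x (metric x))
  metric_symm : ∀ x u v, metric x u v = metric x v u
  metric_lorentzian : ∀ x, ∃ b : Module.Basis (Fin 4) ℝ (TangentSpace 𝓘(ℝ, CoordSpace) x),
    ∀ i j, metric x (b i) (b j) = minkowski i j
  /-- the affine connection -/
  connection : CovariantDerivative 𝓘(ℝ, CoordSpace) CoordSpace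
    (fun x : M => TangentSpace 𝓘(ℝ, CoordSpace) x)
  connection_smooth : CovariantDerivative.ContMDiffCovariantDerivative connection ∞

section

variable {M : Type*} [TopologicalSpace M] [ChartedSpace CoordSpace M]

/-- The coordinate vector field `∂_μ` of the chart `e` (meaningful on `e.source`). -/
noncomputable def coordField (e : OpenPartialHomeomorph M CoordSpace) (μ : Fin 4) :
    ∀ x : M, TangentSpace 𝓘(ℝ, CoordSpace) x :=
  VectorField.mpullback 𝓘(ℝ, CoordSpace) 𝓘(ℝ, CoordSpace) e
    (fun _ => (EuclideanSpace.single μ 1 : CoordSpace))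

variable [IsManifold 𝓘(ℝ, CoordSpace) ∞ M]

/-- The components `g_{μν}` of the metric in the chart `e`, as functions on `e.target`. -/
noncomputable def Spacetime.metricComp (S : Spacetime M)
    (e : OpenPartialHomeomorph M CoordSpace) (y : CoordSpace) : Matrix (Fin 4) (Fin 4) ℝ :=
  Matrix.of fun μ ν =>
    S.metric (e.symm y) (coordField e μ (e.symm y)) (coordField e ν (e.symm y))

/-- The connection coefficients in the chart `e`: `Γ^lam_{μν} = dx^lam (∇_{∂_μ} ∂_ν)`, as functions
on `e.target`. -/
noncomputable def Spacetime.connComp (S : Spacetime M)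
    (e : OpenPartialHomeomorph M CoordSpace) (y : CoordSpace) (lam μ ν : Fin 4) : ℝ :=
  EuclideanSpace.proj (𝕜 := ℝ) lam
    (mfderiv 𝓘(ℝ, CoordSpace) 𝓘(ℝ, CoordSpace) e (e.symm y)
      (S.connection (coordField e ν) (e.symm y) (coordField e μ (e.symm y))))

/-- The connection is metric compatible, `∇g ≡ 0`; in local coordinates
`∂_lam g_{μν} - Γ^κ_{lam μ} g_{κν} - Γ^κ_{lam ν} g_{μκ} = 0`. -/
def Spacetime.IsMetricCompatible (S : Spacetime M) : Prop :=
  ∀ e ∈ IsManifold.maximalAtlas 𝓘(ℝ, CoordSpace) ∞ M, ∀ y ∈ e.target, ∀ lam μ ν : Fin 4,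
    partialD lam (fun z => S.metricComp e z μ ν) y
      - ∑ κ, S.connComp e y κ lam μ * S.metricComp e y κ ν
      - ∑ κ, S.connComp e y κ lam ν * S.metricComp e y μ κ = 0

/-- All irreducible pieces of the curvature of `S` apart from the `i`-th one are identically
zero. -/
def Spacetime.HasCurvatureOfType (S : Spacetime M) (i : PieceLabel) : Prop :=
  ∀ e ∈ IsManifold.maximalAtlas 𝓘(ℝ, CoordSpace) ∞ M, ∀ y ∈ e.target,
    IsPurely (S.metricComp e y) i (curvature (S.connComp e) y)

/-- A pseudoinstanton: the connection is metric compatible, and the curvature is irreducible and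
simple. -/
def Spacetime.IsPseudoinstanton (S : Spacetime M) : Prop :=
  S.IsMetricCompatible ∧ ∃ i : PieceLabel, i.IsSimple ∧ S.HasCurvatureOfType i

/-- A Weyl pseudoinstanton: the connection is metric compatible and the curvature is purely
Weyl. -/
def Spacetime.IsWeylPseudoinstanton (S : Spacetime M) : Prop :=
  S.IsMetricCompatible ∧ S.HasCurvatureOfType .weyl

/-- A scalar pseudoinstanton. -/
def Spacetime.IsScalarPseudoinstanton (S : Spacetime M) : Prop :=
  S.IsMetricCompatible ∧ S.HasCurvatureOfType .scalar

/-- A pseudoscalar pseudoinstanton. -/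
def Spacetime.IsPseudoscalarPseudoinstanton (S : Spacetime M) : Prop :=
  S.IsMetricCompatible ∧ S.HasCurvatureOfType .pseudoscalar

/-- The field equation `∂S/∂g = 0`: in every chart, the action is stationary with respect to
smooth compactly supported variations `h` of the metric, the connection being fixed. -/
def Spacetime.MetricFieldEquation (S : Spacetime M) (q : QuadraticForm ℝ CurvatureTensor) :
    Prop :=
  ∀ e ∈ IsManifold.maximalAtlas 𝓘(ℝ, CoordSpace) ∞ M, ∀ K : Set CoordSpace, IsCompact K →
    K ⊆ e.target → ∀ h : CoordSpace → Matrix (Fin 4) (Fin 4) ℝ,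
    (∀ μ ν, ContDiff ℝ ∞ fun y => h y μ ν) → (∀ y, (h y)ᵀ = h y) → (∀ y ∉ K, h y = 0) →
    HasDerivAt (fun t : ℝ => action q K (fun y => S.metricComp e y + t • h y) (S.connComp e)) 0 0

/-- The field equation `∂S/∂Γ = 0`: in every chart, the action is stationary with respect to
smooth compactly supported variations `γ` of the connection, the metric being fixed. -/
def Spacetime.ConnectionFieldEquation (S : Spacetime M) (q : QuadraticForm ℝ CurvatureTensor) :
    Prop :=
  ∀ e ∈ IsManifold.maximalAtlas 𝓘(ℝ, CoordSpace) ∞ M, ∀ K : Set CoordSpace, IsCompact K →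
    K ⊆ e.target → ∀ γ : CoordSpace → Fin 4 → Fin 4 → Fin 4 → ℝ,
    (∀ lam μ ν, ContDiff ℝ ∞ fun y => γ y lam μ ν) → (∀ y ∉ K, γ y = 0) →
    HasDerivAt (fun t : ℝ => action q K (S.metricComp e) (fun y => S.connComp e y + t • γ y)) 0 0

end

/-! The pieces of dimension 6 and 9 come in isomorphic copies, so a simple piece is scalar,
pseudoscalar, Weyl or 30-dimensional (`PieceLabel.IsSimple.cases`). Metric compatibility makes the
curvature skew in its first pair of indices, so a curvature of the 30-dimensional type, being
symmetric there, is zero. Three types remain.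

Let `R` be of one of these types. The polar form of an invariant `q` at `R` is a functional that
inherits the Lorentz symmetries of `R`, and such a functional is unique up to a factor. Hence it
equals `c` times the Yang–Mills pairing `g^{μμ'} g^{νν'} tr (R_{μν} Q_{μ'ν'})`, with `c` depending
only on `q` and on the piece (`exists_polar_eq_of_isPurely`). The form `q - (c/2) ymForm` then
vanishes at `R` together with its differential, so every first variation of the action is `c/2`
times that of the Yang–Mills action (`density_regularity`, `hasDerivAt_setIntegral_quadAt`).

It remains to see that `R` is stationary for Yang–Mills. On the three pieces the left and right
duals of `R` agree and the stress tensor is pure trace (`IsDoubleDual`). For variations of the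
metric, a pure trace stress is cancelled in dimension four by the variation of the volume element
(`hasDerivAt_ymDensity_metric`). For variations of the connection, the duality turns the pairing of
`R` with the varied curvature into a contraction with two symbols `ε`, as in the Euler density. By
the Bianchi identity this is a divergence (`IsCompatibleOn.ymPairing_linearVariation`), and its
integral over the support vanishes. -/

set_option linter.unusedSimpArgs false

/-! ### The Levi-Civita symbol under changes of frame. -/

section FrameCovariance

/-- The selection matrix times the Vandermonde matrix with nodes 0, 1, 2, 3 is the Vandermonde
matrix with nodes `a, b, c, d`, and the former Vandermonde determinant is 12. As a polynomial, the
symbol can be evaluated by `norm_num` and its permutation symmetries can be checked by `ring`. -/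
theorem leviCivitaSymbol_eq (a b c d : Fin 4) : leviCivitaSymbol a b c d =
    ((b : ℝ) - a) * (c - a) * (d - a) * (c - b) * (d - b) * (d - c) / 12 := by
  have h := congrArg Matrix.det (show
    (Matrix.of fun i j : Fin 4 => if ![a, b, c, d] i = j then (1 : ℝ) else 0) *
      Matrix.vandermonde (fun i : Fin 4 => (i : ℝ))
      = Matrix.vandermonde (fun i => ((![a, b, c, d] i : Fin 4) : ℝ)) by
    ext i j
    simp [Matrix.mul_apply, Matrix.vandermonde])
  rw [Matrix.det_mul, Matrix.det_vandermonde, Matrix.det_vandermonde] at h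
  have e0 : ∀ f : Fin 4 → ℝ, ∏ j ∈ Finset.Ioi 0, f j = f 1 * (f 2 * f 3) := fun f => by
    rw [show Finset.Ioi (0 : Fin 4) = {1, 2, 3} by decide, Finset.prod_insert (by decide),
      Finset.prod_pair (by decide)]
  have e1 : ∀ f : Fin 4 → ℝ, ∏ j ∈ Finset.Ioi 1, f j = f 2 * f 3 := fun f => by
    rw [show Finset.Ioi (1 : Fin 4) = {2, 3} by decide, Finset.prod_pair (by decide)]
  have e2 : ∀ f : Fin 4 → ℝ, ∏ j ∈ Finset.Ioi 2, f j = f 3 := fun f => by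
    rw [show Finset.Ioi (2 : Fin 4) = {3} by decide, Finset.prod_singleton]
  have e3 : ∀ f : Fin 4 → ℝ, ∏ j ∈ Finset.Ioi 3, f j = 1 := fun f => by
    rw [show Finset.Ioi (3 : Fin 4) = ∅ by decide, Finset.prod_empty]
  rw [Fin.prod_univ_four, Fin.prod_univ_four, e0, e0, e1, e1, e2, e2, e3, e3] at h
  simp only [Matrix.cons_val] at h
  norm_num at h
  rw [leviCivitaSymbol]
  linarith

/-- The contraction `∑ U^{αβ} ε_{αβμν}`. -/
noncomputable def epsDual (U : Matrix (Fin 4) (Fin 4) ℝ) : Matrix (Fin 4) (Fin 4) ℝ :=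
  Matrix.of fun μ ν => ∑ α, ∑ β, U α β * leviCivitaSymbol α β μ ν

theorem epsDual_eq (U : Matrix (Fin 4) (Fin 4) ℝ) : epsDual U =
    !![0, U 2 3 - U 3 2, U 3 1 - U 1 3, U 1 2 - U 2 1;
      U 3 2 - U 2 3, 0, U 0 3 - U 3 0, U 2 0 - U 0 2;
      U 1 3 - U 3 1, U 3 0 - U 0 3, 0, U 0 1 - U 1 0;
      U 2 1 - U 1 2, U 0 2 - U 2 0, U 1 0 - U 0 1, 0] := by
  ext μ ν
  fin_cases μ <;> fin_cases ν <;>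
  · simp only [epsDual, Matrix.of_apply, leviCivitaSymbol_eq, Fin.sum_univ_four]
    norm_num
    try ring

theorem det_fin_four (P : Matrix (Fin 4) (Fin 4) ℝ) : P.det =
    (P 0 0 * P 1 1 - P 0 1 * P 1 0) * (P 2 2 * P 3 3 - P 2 3 * P 3 2)
    - (P 0 0 * P 1 2 - P 0 2 * P 1 0) * (P 2 1 * P 3 3 - P 2 3 * P 3 1)
    + (P 0 0 * P 1 3 - P 0 3 * P 1 0) * (P 2 1 * P 3 2 - P 2 2 * P 3 1)
    + (P 0 1 * P 1 2 - P 0 2 * P 1 1) * (P 2 0 * P 3 3 - P 2 3 * P 3 0)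
    - (P 0 1 * P 1 3 - P 0 3 * P 1 1) * (P 2 0 * P 3 2 - P 2 2 * P 3 0)
    + (P 0 2 * P 1 3 - P 0 3 * P 1 2) * (P 2 0 * P 3 1 - P 2 1 * P 3 0) := by
  simp [Matrix.det_succ_row_zero, Fin.sum_univ_succ, Fin.succAbove]
  ring

-- Contracting all four slots of `ε` with `P` produces the factor `P.det`. Absorbing two slots into
-- `U` makes this an identity between matrix products, which is the shape needed for frame changes.
set_option maxHeartbeats 4000000 in
theorem transpose_mul_epsDual_mul (P U : Matrix (Fin 4) (Fin 4) ℝ) :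
    Pᵀ * epsDual (P * U * Pᵀ) * P = P.det • epsDual U := by
  rw [epsDual_eq, epsDual_eq, det_fin_four]
  ext i j
  simp only [Matrix.mul_apply, Fin.sum_univ_four, Matrix.transpose_apply, Matrix.smul_apply, Matrix.of_apply, smul_eq_mul]
  fin_cases i <;> fin_cases j
  all_goals
    simp only [Fin.zero_eta, Fin.mk_one, Fin.reduceFinMk, Matrix.cons_val', Matrix.cons_val_zero, Matrix.cons_val_one, Matrix.cons_val, Matrix.of_apply, Matrix.cons_val_fin_one]
    ring
end FrameCovariance

/-! ### Lowered curvature, traces and the star in an orthonormal frame. -/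

section Pullback

/-- The pullback of a covariant tensor of rank 4 by a matrix. -/
noncomputable def pullTensor (P : Matrix (Fin 4) (Fin 4) ℝ)
    (T : Fin 4 → Fin 4 → Fin 4 → Fin 4 → ℝ) : Fin 4 → Fin 4 → Fin 4 → Fin 4 → ℝ :=
  fun a b c d => ∑ κ, P κ a * ∑ lam, P lam b * ∑ μ, P μ c * ∑ ν, P ν d * T κ lam μ ν

theorem sum_mul_sum_mul (P F : Matrix (Fin 4) (Fin 4) ℝ) (c d : Fin 4) :
    ∑ μ, P μ c * ∑ ν, P ν d * F μ ν = (Pᵀ * F * P) c d := by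
  rw [Matrix.mul_assoc]
  simp only [Matrix.mul_apply, Matrix.transpose_apply]
  simp only [mul_comm (P _ d)]

/-- Both sides are traces of the form `tr (Aᵀ B)`, equal by cyclicity. Since `P η Pᵀ = g⁻¹` for an
orthonormal frame, this converts contractions in the frame into contractions with `g⁻¹`. -/
theorem sum_sum_mul_sum_sum (P G F : Matrix (Fin 4) (Fin 4) ℝ) :
    ∑ a, ∑ c, G a c * ∑ κ, P κ a * ∑ μ, P μ c * F κ μ = ∑ κ, ∑ μ, (P * G * Pᵀ) κ μ * F κ μ := by
  have h : ∀ A B : Matrix (Fin 4) (Fin 4) ℝ, ∑ a, ∑ c, A a c * B a c = (Aᵀ * B).trace := by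
    intro A B
    simp only [Matrix.trace, Matrix.diag, Matrix.mul_apply, Matrix.transpose_apply]
    rw [Finset.sum_comm]
  simp only [sum_mul_sum_mul]
  rw [h, h]
  simp only [Matrix.transpose_mul, Matrix.transpose_transpose, Matrix.mul_assoc]
  rw [Matrix.trace_mul_comm P]
  simp only [Matrix.mul_assoc]

theorem pullTensor_eq (P : Matrix (Fin 4) (Fin 4) ℝ) (T : Fin 4 → Fin 4 → Fin 4 → Fin 4 → ℝ)
    (a b c d : Fin 4) : pullTensor P T a b c d =
      ∑ κ, P κ a * ∑ lam, P lam b * (Pᵀ * Matrix.of (T κ lam) * P) c d := by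
  simp only [pullTensor, ← sum_mul_sum_mul, Matrix.of_apply]

/-- The factor `P⁻¹` acting on the upper index cancels against the right factor `P` of the
transformed metric, so that all four lowered indices transform by `P`. -/
theorem lowered_frameChange {P : Matrix (Fin 4) (Fin 4) ℝ} (hP : IsUnit P.det)
    (g : Matrix (Fin 4) (Fin 4) ℝ) (R : CurvatureTensor) :
    lowered (Pᵀ * g * P) (frameChange P R) = pullTensor P (lowered g R) := by
  ext a b c d
  have key : ∀ X : Fin 4 → ℝ, ∑ α, (Pᵀ * g * P) a α * ∑ κ, P⁻¹ α κ * X κ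
      = ∑ κ, P κ a * ∑ α, g κ α * X α := by
    intro X
    have : (Pᵀ * g * P) *ᵥ (P⁻¹ *ᵥ X) = Pᵀ *ᵥ (g *ᵥ X) := by
      rw [Matrix.mulVec_mulVec, Matrix.mul_assoc _ P, Matrix.mul_nonsing_inv _ hP, Matrix.mul_one,
        ← Matrix.mulVec_mulVec]
    exact congrFun this a
  have step : ∀ (n : Fin 4) (Y : Fin 4 → Fin 4 → ℝ) (v : Fin 4 → ℝ),
      ∑ α, v α * ∑ i, P i n * Y i α = ∑ i, P i n * ∑ α, v α * Y i α := by
    intro n Y v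
    simp only [Finset.mul_sum]
    rw [Finset.sum_comm]
    refine Finset.sum_congr rfl fun _ _ => Finset.sum_congr rfl fun _ _ => ?_
    ring
  simp only [lowered, frameChange, LinearMap.coe_mk, AddHom.coe_mk, key, pullTensor]
  refine Finset.sum_congr rfl fun κ _ => ?_
  rw [step]
  congr 1
  refine Finset.sum_congr rfl fun lam _ => ?_
  rw [step]
  congr 1
  refine Finset.sum_congr rfl fun μ _ => ?_
  rw [step]

theorem pullTensor_scalarTensor (P g : Matrix (Fin 4) (Fin 4) ℝ) (s : ℝ) :
    pullTensor P (scalarTensor g s) = scalarTensor (Pᵀ * g * P) s := by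
  have h : ∀ κ lam, Matrix.of (scalarTensor g s κ lam)
      = (s / 12) • (Matrix.vecMulVec (g κ) (g lam) - Matrix.vecMulVec (g lam) (g κ)) := by
    intro κ lam
    ext μ ν
    simp only [scalarTensor, Matrix.of_apply, Matrix.smul_apply, Matrix.sub_apply,
      Matrix.vecMulVec_apply, smul_eq_mul]
    ring
  have h2 : ∀ u v : Fin 4 → ℝ, Pᵀ * Matrix.vecMulVec u v * P
      = Matrix.vecMulVec (Pᵀ *ᵥ u) (v ᵥ* P) := by
    intro u v
    rw [Matrix.mul_vecMulVec, Matrix.vecMulVec_mul]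
  have e : ∀ a c, (Pᵀ * g * P) a c = ∑ κ, P κ a * (g κ ᵥ* P) c := by
    intro a c
    rw [Matrix.mul_assoc, Matrix.mul_apply]
    rfl
  ext a b c d
  rw [pullTensor_eq]
  simp only [h, Matrix.mul_smul, Matrix.smul_mul, Matrix.mul_sub, Matrix.sub_mul, h2,
    Matrix.smul_apply, Matrix.sub_apply, Matrix.vecMulVec_apply, smul_eq_mul,
    Matrix.mulVec_transpose, scalarTensor, e]
  have e2 : ∀ x y z w : Fin 4 → ℝ, ∑ κ, P κ a * ∑ lam, P lam b *
      (s / 12 * (x κ * y lam - z lam * w κ)) = s / 12 * ((∑ κ, P κ a * x κ) * (∑ κ, P κ b * y κ)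
        - (∑ κ, P κ a * w κ) * (∑ κ, P κ b * z κ)) := by
    intro x y z w
    rw [Finset.sum_mul_sum, Finset.sum_mul_sum]
    simp only [Finset.mul_sum, ← Finset.sum_sub_distrib]
    refine Finset.sum_congr rfl fun _ _ => Finset.sum_congr rfl fun _ _ => ?_
    ring
  rw [e2 (fun κ => (g κ ᵥ* P) c) (fun lam => (g lam ᵥ* P) d) (fun lam => (g lam ᵥ* P) c)
    (fun κ => (g κ ᵥ* P) d)]
  ring

theorem IsTraceFree.pullTensor {P g G : Matrix (Fin 4) (Fin 4) ℝ} (h : P * G⁻¹ * Pᵀ = g⁻¹)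
    {T : Fin 4 → Fin 4 → Fin 4 → Fin 4 → ℝ} (hT : IsTraceFree g T) :
    IsTraceFree G (pullTensor P T) := by
  have step2 : ∀ (n : Fin 4) (Y : Fin 4 → Fin 4 → Fin 4 → ℝ),
      ∑ a, ∑ c, G⁻¹ a c * ∑ i, P i n * Y i a c = ∑ i, P i n * ∑ a, ∑ c, G⁻¹ a c * Y i a c := by
    intro n Y
    simp only [Finset.mul_sum]
    rw [Finset.sum_comm_cycle]
    refine Finset.sum_congr rfl fun _ _ => Finset.sum_congr rfl fun _ _ =>
      Finset.sum_congr rfl fun _ _ => ?_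
    ring
  constructor
  · intro b d
    -- The two contracted indices are moved innermost, so that `sum_sum_mul_sum_sum` applies to them
    -- for fixed values of the other two.
    have e : ∀ a c, _root_.pullTensor P T a b c d
        = ∑ lam, P lam b * ∑ ν, P ν d * ∑ κ, P κ a * ∑ μ, P μ c * T κ lam μ ν := by
      intro a c
      simp only [_root_.pullTensor, Finset.mul_sum]
      rw [Finset.sum_comm]
      refine Finset.sum_congr rfl fun lam _ => ?_
      rw [Finset.sum_comm_cycle]
      refine Finset.sum_congr rfl fun _ _ => Finset.sum_congr rfl fun _ _ =>
        Finset.sum_congr rfl fun _ _ => ?_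
      ring
    simp only [e, step2]
    refine Finset.sum_eq_zero fun lam _ => ?_
    rw [Finset.sum_eq_zero, mul_zero]
    intro ν _
    have := sum_sum_mul_sum_sum P G⁻¹ (fun κ μ => T κ lam μ ν)
    rw [this, h, hT.1 lam ν, mul_zero]
  · intro a d
    have e : ∀ b c, _root_.pullTensor P T a b c d
        = ∑ κ, P κ a * ∑ ν, P ν d * ∑ lam, P lam b * ∑ μ, P μ c * T κ lam μ ν := by
      intro b c
      simp only [_root_.pullTensor, Finset.mul_sum]
      refine Finset.sum_congr rfl fun lam _ => ?_
      rw [Finset.sum_comm_cycle]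
      refine Finset.sum_congr rfl fun _ _ => Finset.sum_congr rfl fun _ _ =>
        Finset.sum_congr rfl fun _ _ => ?_
      ring
    simp only [e, step2]
    refine Finset.sum_eq_zero fun κ _ => ?_
    rw [Finset.sum_eq_zero, mul_zero]
    intro ν _
    have := sum_sum_mul_sum_sum P G⁻¹ (fun lam μ => T κ lam μ ν)
    rw [this, h, hT.2 κ ν, mul_zero]

theorem of_loweredStar (g : Matrix (Fin 4) (Fin 4) ℝ) (R : CurvatureTensor) (κ lam : Fin 4) :
    Matrix.of (loweredStar g R κ lam)
      = (1 / 2 * √|g.det|) • epsDual ((g⁻¹)ᵀ * Matrix.of (lowered g R κ lam) * g⁻¹) := by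
  ext μ ν
  simp only [Matrix.of_apply, loweredStar, Matrix.smul_apply, smul_eq_mul, epsDual,
    ← sum_mul_sum_mul, Finset.mul_sum, Finset.sum_mul]
  rw [Finset.sum_comm_cycle]
  refine Finset.sum_congr rfl fun α _ => ?_
  rw [Finset.sum_comm_cycle]
  refine Finset.sum_congr rfl fun _ _ => Finset.sum_congr rfl fun _ _ =>
    Finset.sum_congr rfl fun _ _ => ?_
  ring

theorem det_minkowski : minkowski.det = -1 := by
  simp [minkowski, Matrix.det_diagonal, Fin.prod_univ_four]

theorem minkowski_mul_self : minkowski * minkowski = 1 := by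
  rw [minkowski, Matrix.diagonal_mul_diagonal, ← Matrix.diagonal_one]
  congr 1
  ext i
  fin_cases i <;> simp

theorem minkowski_inv : minkowski⁻¹ = minkowski :=
  Matrix.inv_eq_right_inv minkowski_mul_self

theorem minkowski_transpose : minkowskiᵀ = minkowski := Matrix.diagonal_transpose _

namespace IsOrthonormalFrame
variable {g P : Matrix (Fin 4) (Fin 4) ℝ}

theorem det_sq (h : IsOrthonormalFrame g P) : P.det ^ 2 * g.det = -1 := by
  have h1 := congrArg Matrix.det h
  rw [Matrix.det_mul, Matrix.det_mul, Matrix.det_transpose, det_minkowski] at h1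
  linarith

theorem isUnit_det (h : IsOrthonormalFrame g P) : IsUnit P.det :=
  isUnit_det_of_isOrthonormalFrame h

theorem isUnit_det_metric (h : IsOrthonormalFrame g P) : IsUnit g.det := by
  rw [isUnit_iff_ne_zero]
  intro h0
  have := h.det_sq
  rw [h0] at this
  norm_num at this

theorem sqrt_abs_det (h : IsOrthonormalFrame g P) : √|g.det| = |P.det|⁻¹ := by
  have h1 := h.det_sq
  have hP : P.det ≠ 0 := h.isUnit_det.ne_zero
  have : g.det = -(P.det ^ 2)⁻¹ := by
    field_simp
    linarith
  rw [this, abs_neg, abs_of_nonneg (by positivity), Real.sqrt_inv, Real.sqrt_sq_eq_abs]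

theorem mul_minkowski_mul (h : IsOrthonormalFrame g P) : P * minkowski * Pᵀ = g⁻¹ := by
  have hP := h.isUnit_det
  have hPt : IsUnit (Pᵀ).det := by rwa [Matrix.det_transpose]
  symm
  apply Matrix.inv_eq_left_inv
  have h1 : Pᵀ * g = minkowski * P⁻¹ := by
    rw [← h, Matrix.mul_assoc, Matrix.mul_nonsing_inv _ hP, Matrix.mul_one]
  rw [Matrix.mul_assoc, h1, Matrix.mul_assoc, ← Matrix.mul_assoc minkowski, minkowski_mul_self,
    Matrix.one_mul, Matrix.mul_nonsing_inv _ hP]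

theorem inv_symm (h : IsOrthonormalFrame g P) : (g⁻¹)ᵀ = g⁻¹ := by
  rw [← h.mul_minkowski_mul]
  simp only [Matrix.transpose_mul, Matrix.transpose_transpose, minkowski_transpose,
    Matrix.mul_assoc]

theorem lowered_eq (h : IsOrthonormalFrame g P) (R : CurvatureTensor) :
    lowered minkowski (frameChange P R) = pullTensor P (lowered g R) := by
  rw [← lowered_frameChange h.isUnit_det, h]

/-- The star is a pseudotensor. The symbol contributes `P.det⁻¹`, and `√|det g| = |P.det|⁻¹`
contributes `|P.det|`, so only the sign of the determinant survives. -/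
theorem loweredStar_eq (h : IsOrthonormalFrame g P) (R : CurvatureTensor) :
    loweredStar minkowski (frameChange P R)
      = (P.det⁻¹ * |P.det|) • pullTensor P (loweredStar g R) := by
  have key : ∀ F : Matrix (Fin 4) (Fin 4) ℝ,
      epsDual (minkowski * (Pᵀ * F * P) * minkowski) = P.det⁻¹ •
        (Pᵀ * epsDual ((g⁻¹)ᵀ * F * g⁻¹) * P) := by
    intro F
    rw [h.inv_symm, ← h.mul_minkowski_mul]
    have : P * minkowski * Pᵀ * F * (P * minkowski * Pᵀ)
        = P * (minkowski * (Pᵀ * F * P) * minkowski) * Pᵀ := by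
      simp only [Matrix.mul_assoc]
    rw [this, transpose_mul_epsDual_mul, smul_smul, inv_mul_cancel₀ h.isUnit_det.ne_zero, one_smul]
  ext a b c d
  have e1 := congrFun (congrFun (of_loweredStar minkowski (frameChange P R) a b) c) d
  rw [Matrix.of_apply] at e1
  rw [e1, det_minkowski, minkowski_inv, minkowski_transpose, h.lowered_eq]
  have hsum : Matrix.of (pullTensor P (lowered g R) a b)
      = ∑ κ, ∑ lam, (P κ a * P lam b) • (Pᵀ * Matrix.of (lowered g R κ lam) * P) := by
    ext c d
    simp only [Matrix.of_apply, pullTensor_eq, Matrix.sum_apply, Matrix.smul_apply, smul_eq_mul,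
      Finset.mul_sum, mul_assoc]
  have hadd : ∀ U V, epsDual (U + V) = epsDual U + epsDual V := by
    intro U V
    ext μ ν
    simp [epsDual, add_mul, Finset.sum_add_distrib]
  have hsmul : ∀ (s : ℝ) V, epsDual (s • V) = s • epsDual V := by
    intro U V
    ext μ ν
    simp [epsDual, Finset.mul_sum, mul_assoc]
  let E : Matrix (Fin 4) (Fin 4) ℝ →ₗ[ℝ] Matrix (Fin 4) (Fin 4) ℝ :=
    { toFun := epsDual, map_add' := hadd, map_smul' := hsmul }
  have hE : ∀ U, epsDual U = E U := fun _ => rfl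
  rw [hsum]
  simp only [Matrix.mul_sum, Matrix.sum_mul, Matrix.mul_smul, Matrix.smul_mul]
  rw [hE]
  simp only [map_sum, map_smul]
  simp only [← hE, key, Matrix.sum_apply, Matrix.smul_apply, Pi.smul_apply, smul_eq_mul,
    pullTensor_eq, of_loweredStar, Matrix.mul_smul, Matrix.smul_mul, h.sqrt_abs_det, Finset.mul_sum]
  have hP : |P.det| ≠ 0 := abs_ne_zero.2 h.isUnit_det.ne_zero
  refine Finset.sum_congr rfl fun _ _ => Finset.sum_congr rfl fun _ _ => ?_
  simp only [abs_neg, abs_one, Real.sqrt_one]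
  field_simp

end IsOrthonormalFrame
end Pullback

/-! ### The Yang–Mills stress tensor, pairing and quadratic form. -/

section YangMills

/-- The endomorphism-valued components `R_{μν}` of a curvature tensor. -/
def curvMat (R : CurvatureTensor) (μ ν : Fin 4) : Matrix (Fin 4) (Fin 4) ℝ :=
  Matrix.of fun κ lam => R.1 κ lam μ ν

theorem curvMat_antisymm (R : CurvatureTensor) (μ ν : Fin 4) :
    curvMat R μ ν = -curvMat R ν μ := by
  ext κ lam
  exact R.2 κ lam μ ν

theorem curvMat_ext {R Q : CurvatureTensor} (h : ∀ μ ν, curvMat R μ ν = curvMat Q μ ν) :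
    R = Q := by
  ext κ lam μ ν
  exact congrFun (congrFun (h μ ν) κ) lam

theorem curvMat_add (R Q : CurvatureTensor) (μ ν : Fin 4) :
    curvMat (R + Q) μ ν = curvMat R μ ν + curvMat Q μ ν := rfl

theorem curvMat_smul (s : ℝ) (R : CurvatureTensor) (μ ν : Fin 4) :
    curvMat (s • R) μ ν = s • curvMat R μ ν := rfl

theorem frameChange_mat (P : Matrix (Fin 4) (Fin 4) ℝ) (R : CurvatureTensor) (c d : Fin 4) :
    curvMat (frameChange P R) c d = ∑ μ, P μ c • ∑ ν, P ν d • (P⁻¹ * curvMat R μ ν * P) := by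
  ext a b
  simp only [curvMat, frameChange, LinearMap.coe_mk, AddHom.coe_mk, Matrix.of_apply,
    Matrix.sum_apply, Matrix.smul_apply, smul_eq_mul, Matrix.mul_apply, Finset.sum_mul,
    Finset.mul_sum]
  rw [Finset.sum_comm_cycle]
  refine Finset.sum_congr rfl fun μ _ => ?_
  rw [Finset.sum_comm_cycle]
  refine Finset.sum_congr rfl fun ν _ => ?_
  rw [Finset.sum_comm]
  refine Finset.sum_congr rfl fun _ _ => Finset.sum_congr rfl fun _ _ => ?_
  ring

/-- The Yang–Mills stress tensor `g^{νν'} tr (R_{μν} Q_{μ'ν'})`. -/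
noncomputable def ymStress (g : Matrix (Fin 4) (Fin 4) ℝ) (R Q : CurvatureTensor) :
    Matrix (Fin 4) (Fin 4) ℝ :=
  Matrix.of fun μ μ' => ∑ ν, ∑ ν', g⁻¹ ν ν' * (curvMat R μ ν * curvMat Q μ' ν').trace

/-- The Yang–Mills pairing `g^{μμ'} g^{νν'} tr (R_{μν} Q_{μ'ν'})`. -/
noncomputable def ymPairing (g : Matrix (Fin 4) (Fin 4) ℝ) (R Q : CurvatureTensor) : ℝ :=
  ∑ μ, ∑ μ', g⁻¹ μ μ' * ymStress g R Q μ μ'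

theorem ymStress_add_left (g : Matrix (Fin 4) (Fin 4) ℝ) (R R' Q : CurvatureTensor) :
    ymStress g (R + R') Q = ymStress g R Q + ymStress g R' Q := by
  ext μ ν
  simp [ymStress, curvMat_add, add_mul, mul_add, Finset.sum_add_distrib]

theorem ymStress_smul_left (g : Matrix (Fin 4) (Fin 4) ℝ) (s : ℝ) (R Q : CurvatureTensor) :
    ymStress g (s • R) Q = s • ymStress g R Q := by
  ext μ ν
  simp [ymStress, curvMat_smul, Finset.mul_sum, mul_left_comm]

theorem ymPairing_add_left (g : Matrix (Fin 4) (Fin 4) ℝ) (R R' Q : CurvatureTensor) :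
    ymPairing g (R + R') Q = ymPairing g R Q + ymPairing g R' Q := by
  simp [ymPairing, ymStress_add_left, mul_add, Finset.sum_add_distrib]

theorem ymPairing_smul_left (g : Matrix (Fin 4) (Fin 4) ℝ) (s : ℝ) (R Q : CurvatureTensor) :
    ymPairing g (s • R) Q = s * ymPairing g R Q := by
  simp [ymPairing, ymStress_smul_left, Finset.mul_sum, mul_left_comm]

theorem ymStress_comm {g : Matrix (Fin 4) (Fin 4) ℝ} (hg : (g⁻¹)ᵀ = g⁻¹) (R Q : CurvatureTensor) :
    ymStress g R Q = (ymStress g Q R)ᵀ := by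
  ext μ ν
  simp only [ymStress, Matrix.of_apply, Matrix.transpose_apply]
  rw [Finset.sum_comm]
  refine Finset.sum_congr rfl fun i _ => Finset.sum_congr rfl fun j _ => ?_
  rw [Matrix.trace_mul_comm]
  conv_lhs => rw [← hg]
  rfl

theorem ymPairing_comm {g : Matrix (Fin 4) (Fin 4) ℝ} (hg : (g⁻¹)ᵀ = g⁻¹) (R Q : CurvatureTensor) :
    ymPairing g R Q = ymPairing g Q R := by
  simp only [ymPairing]
  rw [Finset.sum_comm]
  refine Finset.sum_congr rfl fun i _ => Finset.sum_congr rfl fun j _ => ?_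
  rw [ymStress_comm hg]
  conv_lhs => rw [← hg]
  rfl

/-- Conjugation by `P` in the endomorphism indices drops out of the trace, and the contracted form
indices see `P η Pᵀ = g⁻¹`; only the two free form indices still transform. -/
theorem ymStress_frameChange {P g : Matrix (Fin 4) (Fin 4) ℝ} (h : IsOrthonormalFrame g P)
    (R Q : CurvatureTensor) :
    ymStress minkowski (frameChange P R) (frameChange P Q) = Pᵀ * ymStress g R Q * P := by
  have hP := h.isUnit_det
  have htr : ∀ X Y : Matrix (Fin 4) (Fin 4) ℝ,
      (P⁻¹ * X * P * (P⁻¹ * Y * P)).trace = (X * Y).trace := by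
    intro X Y
    have : P⁻¹ * X * P * (P⁻¹ * Y * P) = P⁻¹ * (X * (P * P⁻¹) * Y * P) := by
      simp only [Matrix.mul_assoc]
    rw [this, Matrix.mul_nonsing_inv _ hP, Matrix.mul_one, Matrix.trace_mul_comm, Matrix.mul_assoc,
      Matrix.mul_nonsing_inv _ hP, Matrix.mul_one]
  have step : ∀ (n : Fin 4) (Y : Fin 4 → Fin 4 → Fin 4 → ℝ),
      ∑ a, ∑ c, minkowski⁻¹ a c * ∑ i, P i n * Y i a c
        = ∑ i, P i n * ∑ a, ∑ c, minkowski⁻¹ a c * Y i a c := by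
    intro n Y
    simp only [Finset.mul_sum]
    rw [Finset.sum_comm_cycle]
    refine Finset.sum_congr rfl fun _ _ => Finset.sum_congr rfl fun _ _ =>
      Finset.sum_congr rfl fun _ _ => ?_
    ring
  have hK : ∀ c d c' d', (curvMat (frameChange P R) c d * curvMat (frameChange P Q) c' d').trace
      = ∑ μ, P μ c * ∑ μ', P μ' c' * ∑ ν, P ν d * ∑ ν', P ν' d' *
        (curvMat R μ ν * curvMat Q μ' ν').trace := by
    intro c d c' d'
    simp only [frameChange_mat, Matrix.sum_mul, Matrix.mul_sum, Matrix.smul_mul, Matrix.mul_smul,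
      Matrix.trace_sum, Matrix.trace_smul, htr, Finset.smul_sum, smul_eq_mul, Finset.mul_sum]
    rw [Finset.sum_comm_cycle]
    refine Finset.sum_congr rfl fun μ _ => Finset.sum_congr rfl fun μ' _ => ?_
    rw [Finset.sum_comm]
    refine Finset.sum_congr rfl fun _ _ => Finset.sum_congr rfl fun _ _ => ?_
    ring
  ext c c'
  rw [← sum_mul_sum_mul]
  simp only [ymStress, Matrix.of_apply, hK, step]
  refine Finset.sum_congr rfl fun μ _ => ?_
  congr 1
  refine Finset.sum_congr rfl fun μ' _ => ?_
  congr 1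
  have := sum_sum_mul_sum_sum P minkowski⁻¹ (fun ν ν' => (curvMat R μ ν * curvMat Q μ' ν').trace)
  rw [this, minkowski_inv, h.mul_minkowski_mul]

theorem ymPairing_frameChange {P g : Matrix (Fin 4) (Fin 4) ℝ} (h : IsOrthonormalFrame g P)
    (R Q : CurvatureTensor) :
    ymPairing minkowski (frameChange P R) (frameChange P Q) = ymPairing g R Q := by
  simp only [ymPairing, ymStress_frameChange h]
  simp only [← sum_mul_sum_mul]
  rw [sum_sum_mul_sum_sum, minkowski_inv, h.mul_minkowski_mul]

/-- The Yang–Mills pairing with respect to the Minkowski metric, as a bilinear form. -/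
noncomputable def ymBilin : LinearMap.BilinForm ℝ CurvatureTensor :=
  LinearMap.mk₂ ℝ (ymPairing minkowski) (ymPairing_add_left _)
    (fun s R Q => by rw [ymPairing_smul_left, smul_eq_mul])
    (fun R Q Q' => by
      have h : (minkowski⁻¹)ᵀ = minkowski⁻¹ := by rw [minkowski_inv, minkowski_transpose]
      rw [ymPairing_comm h, ymPairing_add_left, ymPairing_comm h Q, ymPairing_comm h Q'])
    (fun s R Q => by
      have h : (minkowski⁻¹)ᵀ = minkowski⁻¹ := by rw [minkowski_inv, minkowski_transpose]
      rw [ymPairing_comm h, ymPairing_smul_left, ymPairing_comm h Q, smul_eq_mul])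

/-- The Yang–Mills quadratic form with respect to the Minkowski metric. -/
noncomputable def ymForm : QuadraticForm ℝ CurvatureTensor := ymBilin.toQuadraticMap

theorem polar_ymForm (R Q : CurvatureTensor) :
    QuadraticMap.polar ymForm R Q = 2 * ymPairing minkowski R Q := by
  have h : (minkowski⁻¹)ᵀ = minkowski⁻¹ := by rw [minkowski_inv, minkowski_transpose]
  rw [ymForm, LinearMap.BilinMap.polar_toQuadraticMap]
  change ymPairing _ _ _ + ymPairing _ _ _ = _
  rw [ymPairing_comm h Q R]
  ring

theorem isLorentzInvariant_ymForm : IsLorentzInvariant ymForm := by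
  intro L hL R
  exact ymPairing_frameChange hL R R

theorem IsLorentzInvariant.polar {q : QuadraticForm ℝ CurvatureTensor} (hq : IsLorentzInvariant q)
    {L : Matrix (Fin 4) (Fin 4) ℝ} (hL : IsLorentz L) (R Q : CurvatureTensor) :
    QuadraticMap.polar q (frameChange L R) (frameChange L Q) = QuadraticMap.polar q R Q := by
  simp only [QuadraticMap.polar, ← map_add, hq L hL]

end YangMills

/-! ### Normal forms of the scalar and pseudoscalar pieces at the Minkowski metric. -/

section DoubleDual

/-- The element of the Lorentz Lie algebra with electric part `a` and magnetic part `b`. -/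
def lorentzMat (a b : Fin 3 → ℝ) : Matrix (Fin 4) (Fin 4) ℝ :=
  !![0, a 0, a 1, a 2; a 0, 0, -b 2, b 1; a 1, b 2, 0, -b 0; a 2, -b 1, b 0, 0]

/-- The matrices `R_{μν}` of the tensor `doubleDualTensor`. -/
def doubleDualMat (A B : Fin 3 → Fin 3 → ℝ) (μ ν : Fin 4) : Matrix (Fin 4) (Fin 4) ℝ :=
  (!![0, lorentzMat (A 0) (B 0), lorentzMat (A 1) (B 1), lorentzMat (A 2) (B 2);
    -lorentzMat (A 0) (B 0), 0, lorentzMat (B 2) (-A 2), -lorentzMat (B 1) (-A 1);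
    -lorentzMat (A 1) (B 1), -lorentzMat (B 2) (-A 2), 0, lorentzMat (B 0) (-A 0);
    -lorentzMat (A 2) (B 2), lorentzMat (B 1) (-A 1), -lorentzMat (B 0) (-A 0), 0] :
    Matrix (Fin 4) (Fin 4) (Matrix (Fin 4) (Fin 4) ℝ)) μ ν

theorem doubleDualMat_antisymm (A B : Fin 3 → Fin 3 → ℝ) (μ ν : Fin 4) :
    doubleDualMat A B μ ν = -doubleDualMat A B ν μ := by
  fin_cases μ <;> fin_cases ν <;> simp [doubleDualMat]

/-- The curvature tensors, at the Minkowski metric, which are antisymmetric in the first pair of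
indices and whose left and right duals agree. -/
def doubleDualTensor (A B : Fin 3 → Fin 3 → ℝ) : CurvatureTensor :=
  ⟨fun κ lam μ ν => doubleDualMat A B μ ν κ lam, fun κ lam μ ν =>
    congrFun (congrFun (doubleDualMat_antisymm A B μ ν) κ) lam⟩

theorem curvMat_doubleDualTensor (A B : Fin 3 → Fin 3 → ℝ) (μ ν : Fin 4) :
    curvMat (doubleDualTensor A B) μ ν = doubleDualMat A B μ ν := rfl

theorem lowered_minkowski (R : CurvatureTensor) (κ lam μ ν : Fin 4) :
    lowered minkowski R κ lam μ ν = minkowski κ κ * R.1 κ lam μ ν := by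
  rw [lowered, Finset.sum_eq_single κ]
  · intro b _ hb
    rw [minkowski, Matrix.diagonal_apply_ne' _ hb, zero_mul]
  · simp

theorem apply_eq_minkowski_mul_lowered (R : CurvatureTensor) (κ lam μ ν : Fin 4) :
    R.1 κ lam μ ν = minkowski κ κ * lowered minkowski R κ lam μ ν := by
  rw [lowered_minkowski, minkowski, Matrix.diagonal_apply_eq, ← mul_assoc]
  fin_cases κ <;> simp

/-- Antisymmetry in the form indices leaves six matrices to compare. The map `(a, b) ↦ (b, -a)` is
the dual on the Lorentz algebra, so the hypotheses say that passing to the dual form pair has the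
effect of dualising in the first pair. -/
theorem eq_doubleDualTensor {R : CurvatureTensor} {A B : Fin 3 → Fin 3 → ℝ}
    (h01 : curvMat R 0 1 = lorentzMat (A 0) (B 0)) (h02 : curvMat R 0 2 = lorentzMat (A 1) (B 1))
    (h03 : curvMat R 0 3 = lorentzMat (A 2) (B 2)) (h23 : curvMat R 2 3 = lorentzMat (B 0) (-A 0))
    (h31 : curvMat R 3 1 = lorentzMat (B 1) (-A 1)) (h12 : curvMat R 1 2 = lorentzMat (B 2) (-A 2)) :
    R = doubleDualTensor A B := by
  have hz : ∀ μ, curvMat R μ μ = 0 := by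
    intro μ
    ext κ lam
    exact self_eq_neg.1 (R.2 κ lam μ μ)
  have h10 := curvMat_antisymm R 1 0
  have h20 := curvMat_antisymm R 2 0
  have h30 := curvMat_antisymm R 3 0
  have h32 := curvMat_antisymm R 3 2
  have h13 := curvMat_antisymm R 1 3
  have h21 := curvMat_antisymm R 2 1
  rw [h01] at h10
  rw [h02] at h20
  rw [h03] at h30
  rw [h23] at h32
  rw [h31] at h13
  rw [h12] at h21
  refine curvMat_ext fun μ ν => ?_
  rw [curvMat_doubleDualTensor]
  fin_cases μ <;> fin_cases ν <;> first | exact hz _ | assumption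

/-- The star exchanges the pairs 01 and 23, 02 and 31, 03 and 12, with a sign in one direction only
because its square is `-1` in this signature. Conditions on `R^*` are thereby read as conditions on
`R`. -/
theorem loweredStar_minkowski (R : CurvatureTensor) (κ lam : Fin 4) :
    loweredStar minkowski R κ lam 0 1 = lowered minkowski R κ lam 2 3 ∧
    loweredStar minkowski R κ lam 0 2 = lowered minkowski R κ lam 3 1 ∧
    loweredStar minkowski R κ lam 0 3 = lowered minkowski R κ lam 1 2 ∧
    loweredStar minkowski R κ lam 2 3 = -lowered minkowski R κ lam 0 1 ∧
    loweredStar minkowski R κ lam 3 1 = -lowered minkowski R κ lam 0 2 ∧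
    loweredStar minkowski R κ lam 1 2 = -lowered minkowski R κ lam 0 3 := by
  have h : ∀ μ ν, loweredStar minkowski R κ lam μ ν
      = Matrix.of (loweredStar minkowski R κ lam) μ ν := fun _ _ => rfl
  have ha : ∀ μ ν, lowered minkowski R κ lam μ ν = -lowered minkowski R κ lam ν μ := by
    intro μ ν
    rw [lowered_minkowski, lowered_minkowski, R.2 κ lam μ ν]
    ring
  have hU : ∀ μ ν, ((minkowski⁻¹)ᵀ * Matrix.of (lowered minkowski R κ lam) * minkowski⁻¹) μ ν
      = minkowski μ μ * lowered minkowski R κ lam μ ν * minkowski ν ν := by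
    intro μ ν
    rw [minkowski_inv, minkowski_transpose, minkowski, Matrix.mul_diagonal, Matrix.diagonal_mul,
      Matrix.diagonal_apply_eq, Matrix.diagonal_apply_eq]
    rfl
  simp only [h, of_loweredStar, Matrix.smul_apply, epsDual_eq, hU, det_minkowski]
  have h10 := ha 1 0
  have h20 := ha 2 0
  have h30 := ha 3 0
  have h32 := ha 3 2
  have h13 := ha 1 3
  have h21 := ha 2 1
  have m0 : minkowski 0 0 = 1 := by simp [minkowski]
  have m1 : minkowski 1 1 = -1 := by simp [minkowski]
  have m2 : minkowski 2 2 = -1 := by simp [minkowski]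
  have m3 : minkowski 3 3 = -1 := by simp [minkowski]
  refine ⟨?_, ?_, ?_, ?_, ?_, ?_⟩ <;> simp [m0, m1, m2, m3, h10, h20, h30, h32, h13, h21] <;> ring

theorem inPiece_scalar_eq {R : CurvatureTensor} (h : InPiece minkowski .scalar R) :
    ∃ s : ℝ, R = doubleDualTensor (fun i j => if i = j then s else 0) 0 := by
  obtain ⟨s, hs⟩ := h
  -- The parameter is the component `R_{0101} = (s/12) g_{00} g_{11}`, unchanged when the index 0 is
  -- raised.
  refine ⟨-s / 12, eq_doubleDualTensor ?_ ?_ ?_ ?_ ?_ ?_⟩ <;>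
  · ext κ lam
    simp only [curvMat, Matrix.of_apply]
    rw [apply_eq_minkowski_mul_lowered, hs]
    fin_cases κ <;> fin_cases lam <;>
    simp [scalarTensor, minkowski, lorentzMat] <;> ring

theorem inPiece_pseudoscalar_eq {R : CurvatureTensor} (h : InPiece minkowski .pseudoscalar R) :
    ∃ s : ℝ, R = doubleDualTensor 0 (fun i j => if i = j then s else 0) := by
  obtain ⟨s, hs⟩ := h
  have hst := loweredStar_minkowski R
  rw [hs] at hst
  refine ⟨-s / 12, eq_doubleDualTensor ?_ ?_ ?_ ?_ ?_ ?_⟩ <;>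
  · ext κ lam
    obtain ⟨h01, h02, h03, h23, h31, h12⟩ := hst κ lam
    rw [← neg_eq_iff_eq_neg] at h12 h31 h23
    simp only [curvMat, Matrix.of_apply]
    rw [apply_eq_minkowski_mul_lowered]
    simp only [← h01, ← h02, ← h03, ← h23, ← h31, ← h12]
    fin_cases κ <;> fin_cases lam <;>
    simp [scalarTensor, minkowski, lorentzMat] <;> ring

end DoubleDual

/-! ### Normal form of the Weyl piece: electric and magnetic parts. -/

section DoubleDual

theorem IsTraceFree.minkowski_fst {T : Fin 4 → Fin 4 → Fin 4 → Fin 4 → ℝ}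
    (hT : IsTraceFree minkowski T) (lam ν : Fin 4) :
    T 0 lam 0 ν - T 1 lam 1 ν - T 2 lam 2 ν - T 3 lam 3 ν = 0 := by
  have h := hT.1 lam ν
  rw [minkowski_inv] at h
  simp [Fin.sum_univ_four, minkowski] at h
  linarith

/-- The vanishing traces of `R` and `R^*` over the first and third indices are linear equations
among the components. They make the electric part `A` and the magnetic part `B` symmetric and
trace-free and express the space–space blocks through the time–space ones. The other traces add
nothing, because `R` is skew in its first pair. -/
theorem inPiece_weyl_eq {R : CurvatureTensor} (h : InPiece minkowski .weyl R) :
    ∃ A B : Fin 3 → Fin 3 → ℝ, (∀ i j, A i j = A j i) ∧ A 0 0 + A 1 1 + A 2 2 = 0 ∧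
      (∀ i j, B i j = B j i) ∧ B 0 0 + B 1 1 + B 2 2 = 0 ∧ R = doubleDualTensor A B := by
  obtain ⟨⟨hT, hS, -⟩, ha⟩ := h
  have hst := loweredStar_minkowski R
  have hb : ∀ κ lam μ ν, lowered minkowski R κ lam μ ν = -lowered minkowski R κ lam ν μ := by
    intro κ lam μ ν
    rw [lowered_minkowski, lowered_minkowski, R.2 κ lam μ ν]
    ring
  have hsa : ∀ κ lam μ ν, loweredStar minkowski R κ lam μ ν
      = -loweredStar minkowski R lam κ μ ν := by
    intro κ lam μ ν
    simp only [loweredStar, ha κ lam, neg_mul, Finset.sum_neg_distrib, mul_neg]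
  have hsb : ∀ κ lam μ ν, loweredStar minkowski R κ lam μ ν
      = -loweredStar minkowski R κ lam ν μ := by
    intro κ lam μ ν
    change Matrix.of (loweredStar minkowski R κ lam) μ ν
      = -Matrix.of (loweredStar minkowski R κ lam) ν μ
    rw [of_loweredStar, epsDual_eq]
    fin_cases μ <;> fin_cases ν <;> simp [← mul_neg]
  have hR := apply_eq_minkowski_mul_lowered R
  generalize lowered minkowski R = L at *
  generalize loweredStar minkowski R = S at *
  have z1 : ∀ κ μ ν, L κ κ μ ν = 0 := fun κ μ ν => self_eq_neg.1 (ha κ κ μ ν)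
  have z2 : ∀ κ lam μ, L κ lam μ μ = 0 := fun κ lam μ => self_eq_neg.1 (hb κ lam μ μ)
  have w1 : ∀ κ μ ν, S κ κ μ ν = 0 := fun κ μ ν => self_eq_neg.1 (hsa κ κ μ ν)
  have w2 : ∀ κ lam μ, S κ lam μ μ = 0 := fun κ lam μ => self_eq_neg.1 (hsb κ lam μ μ)
  have t := hT.minkowski_fst
  have u := hS.minkowski_fst
  have s1 := fun κ lam => (hst κ lam).1
  have s2 := fun κ lam => (hst κ lam).2.1
  have s3 := fun κ lam => (hst κ lam).2.2.1
  have s4 := fun κ lam => (hst κ lam).2.2.2.1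
  have s5 := fun κ lam => (hst κ lam).2.2.2.2.1
  have s6 := fun κ lam => (hst κ lam).2.2.2.2.2
  clear hst hT hS
  have t00 := t 0 0
  have t01 := t 0 1
  have t02 := t 0 2
  have t03 := t 0 3
  have t10 := t 1 0
  have t11 := t 1 1
  have t12 := t 1 2
  have t13 := t 1 3
  have t20 := t 2 0
  have t21 := t 2 1
  have t22 := t 2 2
  have t23 := t 2 3
  have t30 := t 3 0
  have t31 := t 3 1
  have t32 := t 3 2
  have t33 := t 3 3
  have u00 := u 0 0
  have u01 := u 0 1
  have u02 := u 0 2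
  have u03 := u 0 3
  have u10 := u 1 0
  have u11 := u 1 1
  have u12 := u 1 2
  have u13 := u 1 3
  have u20 := u 2 0
  have u21 := u 2 1
  have u22 := u 2 2
  have u23 := u 2 3
  have u30 := u 3 0
  have u31 := u 3 1
  have u32 := u 3 2
  have u33 := u 3 3
  simp only [z1, z2, w1, w2, ha 1 0, ha 2 0, ha 3 0, ha 3 2, ha 1 3, ha 2 1, hb _ _ 1 0, hb _ _ 2 0,
    hb _ _ 3 0, hb _ _ 3 2, hb _ _ 1 3, hb _ _ 2 1, hsa 1 0, hsa 2 0, hsa 3 0, hsa 3 2, hsa 1 3,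
    hsa 2 1, hsb _ _ 1 0, hsb _ _ 2 0, hsb _ _ 3 0, hsb _ _ 3 2, hsb _ _ 1 3, hsb _ _ 2 1,
    s1, s2, s3, s4, s5, s6] at t00 t01 t02 t03 t10 t11 t12 t13 t20 t21 t22 t23 t30 t31 t32 t33 u00 u01 u02 u03 u10 u11 u12 u13 u20 u21 u22 u23 u30 u31 u32 u33
  -- The row index stands for the form pair `(0, j + 1)`. The column index runs over the boosts 01,
  -- 02, 03 for `A` and over the rotations 23, 31, 12 for `B`.
  refine ⟨fun j i => L 0 i.succ 0 j.succ, fun j i => ![L 2 3 0 j.succ, L 3 1 0 j.succ, L 1 2 0 j.succ] i,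
    ?_, ?_, ?_, ?_, eq_doubleDualTensor ?_ ?_ ?_ ?_ ?_ ?_⟩
  · intro i j
    fin_cases i <;> fin_cases j <;> simp <;> linarith
  · simp only [Fin.succ_zero_eq_one, Fin.succ_one_eq_two, Fin.reduceSucc]
    linarith
  · intro i j
    fin_cases i <;> fin_cases j <;> simp <;> linarith
  · simp
    linarith
  all_goals
    ext κ lam
    simp only [curvMat, Matrix.of_apply]
    rw [hR]
    fin_cases κ <;> fin_cases lam <;>
    simp [minkowski, lorentzMat, z1, ha 1 0, ha 2 0, ha 3 0, ha 3 2, ha 1 3, ha 2 1] <;> linarith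
end DoubleDual

/-! ### The duality identity and the pure trace stress tensor. -/

section DoubleDual

/-- The pairing `ε_{κλρσ} U^{κλ} V^{ρσ}`. -/
noncomputable def epsPair (U V : Matrix (Fin 4) (Fin 4) ℝ) : ℝ := ((epsDual U)ᵀ * V).trace

/-- `epsDual` as a linear map. -/
noncomputable def epsDualLin : Matrix (Fin 4) (Fin 4) ℝ →ₗ[ℝ] Matrix (Fin 4) (Fin 4) ℝ where
  toFun := epsDual
  map_add' U V := by
    ext μ ν
    simp [epsDual, add_mul, Finset.sum_add_distrib]
  map_smul' s U := by
    ext μ ν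
    simp [epsDual, Finset.mul_sum, mul_assoc]

theorem epsDualLin_apply (U : Matrix (Fin 4) (Fin 4) ℝ) : epsDualLin U = epsDual U := rfl

theorem epsPair_mul_mul (P U V : Matrix (Fin 4) (Fin 4) ℝ) :
    epsPair (P * U * Pᵀ) (P * V * Pᵀ) = P.det * epsPair U V := by
  have h := congrArg (fun W => (Wᵀ * V).trace) (transpose_mul_epsDual_mul P U)
  simp only [Matrix.transpose_smul, Matrix.smul_mul, Matrix.trace_smul, smul_eq_mul] at h
  rw [epsPair, epsPair, ← h]
  simp only [Matrix.transpose_mul, Matrix.transpose_transpose, Matrix.mul_assoc]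
  rw [Matrix.trace_mul_comm Pᵀ]
  simp only [Matrix.mul_assoc]

theorem epsPair_sum_smul (w : Fin 4 → Fin 4 → ℝ) (U : Fin 4 → Fin 4 → Matrix (Fin 4) (Fin 4) ℝ)
    (V : Matrix (Fin 4) (Fin 4) ℝ) :
    epsPair (∑ μ, ∑ ν, w μ ν • U μ ν) V = ∑ μ, ∑ ν, w μ ν * epsPair (U μ ν) V := by
  simp only [epsPair, ← epsDualLin_apply, map_sum, map_smul, Matrix.transpose_sum,
    Matrix.transpose_smul, Matrix.sum_mul, Matrix.smul_mul, Matrix.trace_sum, Matrix.trace_smul,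
    smul_eq_mul]

/-- The left and right duals of `R` agree (in a form which makes no use of orientation), and the
Yang–Mills stress tensor of `R` is pure trace. -/
structure IsDoubleDual (g : Matrix (Fin 4) (Fin 4) ℝ) (R : CurvatureTensor) : Prop where
  dual : ∀ Z : Matrix (Fin 4) (Fin 4) ℝ,
    g⁻¹ * (Matrix.of fun μ ν => (curvMat R μ ν * Z).trace) * g⁻¹
      = (-1 / 4 : ℝ) • epsDual (Matrix.of fun α β => epsPair (curvMat R α β * g⁻¹) (Z * g⁻¹))
  stress : ymStress g R R = (1 / 4 * ymPairing g R R) • g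

theorem trace_lorentzMat_mul (a b : Fin 3 → ℝ) (Z : Matrix (Fin 4) (Fin 4) ℝ) :
    (lorentzMat a b * Z).trace = a 0 * (Z 0 1 + Z 1 0) + a 1 * (Z 0 2 + Z 2 0)
      + a 2 * (Z 0 3 + Z 3 0) + b 0 * (Z 2 3 - Z 3 2) + b 1 * (Z 3 1 - Z 1 3)
      + b 2 * (Z 1 2 - Z 2 1) := by
  simp only [lorentzMat, Matrix.trace, Matrix.diag_apply, Fin.sum_univ_four, Matrix.mul_apply]
  simp
  ring

/-- Contraction with `ε` realises the dual `(a, b) ↦ (b, -a)` of the Lorentz algebra; the factor 2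
counts the two orders of the contracted antisymmetric pair. -/
theorem epsPair_lorentzMat (a b : Fin 3 → ℝ) (Z : Matrix (Fin 4) (Fin 4) ℝ) :
    epsPair (lorentzMat a b * minkowski) (Z * minkowski)
      = -2 * (lorentzMat b (-a) * Z).trace := by
  rw [trace_lorentzMat_mul]
  simp [epsPair, epsDual_eq, lorentzMat, Matrix.trace, Fin.sum_univ_four, Matrix.mul_apply,
    minkowski, Matrix.vecMul_diagonal, Matrix.diagonal_apply]
  ring

theorem lorentzMat_neg (a b : Fin 3 → ℝ) : lorentzMat (-a) (-b) = -lorentzMat a b := by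
  ext i j
  fin_cases i <;> fin_cases j <;> simp [lorentzMat]

theorem epsPair_neg_left (U V : Matrix (Fin 4) (Fin 4) ℝ) : epsPair (-U) V = -epsPair U V := by
  simp only [epsPair, ← epsDualLin_apply, map_neg, Matrix.transpose_neg, Matrix.neg_mul,
    Matrix.trace_neg]

theorem epsPair_zero_left (V : Matrix (Fin 4) (Fin 4) ℝ) : epsPair 0 V = 0 := by
  simp only [epsPair, ← epsDualLin_apply, map_zero, Matrix.transpose_zero, Matrix.zero_mul,
    Matrix.trace_zero]

/-- Both properties follow from the block structure alone: neither symmetry nor trace conditions on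
`A` and `B` are needed. Each of `epsDual` and `epsPair` contributes a factor 2 in the duality
identity, whence the constant `1/4` there. -/
theorem isDoubleDual_doubleDualTensor (A B : Fin 3 → Fin 3 → ℝ) :
    IsDoubleDual minkowski (doubleDualTensor A B) := by
  constructor
  · intro Z
    ext μ ν
    rw [minkowski_inv, epsDual_eq, minkowski, Matrix.mul_diagonal, Matrix.diagonal_mul, ← minkowski]
    simp only [Matrix.of_apply, curvMat_doubleDualTensor]
    fin_cases μ <;> fin_cases ν <;>
    · simp [doubleDualMat, epsPair_lorentzMat, epsPair_neg_left, epsPair_zero_left, lorentzMat_neg]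
      try ring
  · have h : ymStress minkowski (doubleDualTensor A B) (doubleDualTensor A B)
      = (∑ i, ∑ j, (B i j ^ 2 - A i j ^ 2)) • ((2 : ℝ) • minkowski) := by
      ext μ μ'
      simp only [ymStress, Matrix.of_apply, curvMat_doubleDualTensor, minkowski_inv,
        Fin.sum_univ_four]
      fin_cases μ <;> fin_cases μ' <;>
      · simp [doubleDualMat, trace_lorentzMat_mul, minkowski, Fin.sum_univ_three]
        simp [lorentzMat]
        ring
    rw [ymPairing, h]
    simp only [minkowski_inv, Matrix.smul_apply, smul_eq_mul, Fin.sum_univ_four, smul_smul]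
    congr 1
    simp [minkowski]
    ring

/-- The duality identity contains two symbols `ε`. One scales by `P.det` and the other by `P⁻¹.det`,
so neither an orientation sign nor a volume factor remains. -/
theorem IsOrthonormalFrame.isDoubleDual {g P : Matrix (Fin 4) (Fin 4) ℝ}
    (h : IsOrthonormalFrame g P) {R : CurvatureTensor}
    (hR : IsDoubleDual minkowski (frameChange P R)) : IsDoubleDual g R := by
  have hP := h.isUnit_det
  have hPt : IsUnit (Pᵀ).det := by rwa [Matrix.det_transpose]
  have cancel : ∀ X Y : Matrix (Fin 4) (Fin 4) ℝ, Pᵀ * X * P = Pᵀ * Y * P → X = Y := by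
    intro X Y hXY
    have h1 := congrArg (fun W => (Pᵀ)⁻¹ * W * P⁻¹) hXY
    simpa only [Matrix.mul_assoc, Matrix.mul_nonsing_inv _ hP, Matrix.mul_one,
      Matrix.nonsing_inv_mul_cancel_left _ _ hPt] using h1
  constructor
  · intro Z
    have h1 := hR.dual (P⁻¹ * Z * P)
    have hT : (Matrix.of fun c d => (curvMat (frameChange P R) c d * (P⁻¹ * Z * P)).trace)
        = Pᵀ * (Matrix.of fun μ ν => (curvMat R μ ν * Z).trace) * P := by
      ext c d
      rw [← sum_mul_sum_mul]
      simp only [Matrix.of_apply, frameChange_mat, Matrix.sum_mul, Matrix.smul_mul,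
        Matrix.trace_sum, Matrix.trace_smul, smul_eq_mul]
      refine Finset.sum_congr rfl fun μ _ => ?_
      congr 1
      refine Finset.sum_congr rfl fun ν _ => ?_
      congr 1
      have : P⁻¹ * curvMat R μ ν * P * (P⁻¹ * Z * P)
          = P⁻¹ * (curvMat R μ ν * (P * P⁻¹) * Z * P) := by
        simp only [Matrix.mul_assoc]
      rw [this, Matrix.mul_nonsing_inv _ hP, Matrix.mul_one, Matrix.trace_mul_comm,
        Matrix.mul_assoc, Matrix.mul_nonsing_inv _ hP, Matrix.mul_one]
    have hη : ∀ X : Matrix (Fin 4) (Fin 4) ℝ,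
        P⁻¹ * X * P * minkowski = P⁻¹ * (X * g⁻¹) * (P⁻¹)ᵀ := by
      intro X
      rw [← h.mul_minkowski_mul, Matrix.transpose_nonsing_inv]
      simp only [Matrix.mul_assoc, Matrix.mul_nonsing_inv _ hPt, Matrix.mul_one]
    have hE : (Matrix.of fun c d => epsPair (curvMat (frameChange P R) c d * minkowski)
          (P⁻¹ * Z * P * minkowski))
        = P⁻¹.det • (Pᵀ * (Matrix.of fun α β => epsPair (curvMat R α β * g⁻¹) (Z * g⁻¹)) * P) := by
      ext c d
      rw [Matrix.smul_apply, ← sum_mul_sum_mul]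
      simp only [Matrix.of_apply, frameChange_mat, Matrix.sum_mul, Matrix.smul_mul, hη,
        Finset.smul_sum, smul_smul, smul_eq_mul]
      rw [epsPair_sum_smul]
      simp only [epsPair_mul_mul, Finset.mul_sum]
      refine Finset.sum_congr rfl fun _ _ => Finset.sum_congr rfl fun _ _ => ?_
      ring
    rw [minkowski_inv, hT, hE] at h1
    have h2 := congrArg (fun W => P * W * Pᵀ) h1
    have h3 := transpose_mul_epsDual_mul Pᵀ
      (Matrix.of fun α β => epsPair (curvMat R α β * g⁻¹) (Z * g⁻¹))
    rw [Matrix.transpose_transpose, Matrix.det_transpose] at h3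
    simp only [← epsDualLin_apply, map_smul, Matrix.mul_smul, Matrix.smul_mul] at h2 h3 ⊢
    rw [h3, smul_smul P⁻¹.det, ← Matrix.det_mul, Matrix.nonsing_inv_mul _ hP, Matrix.det_one,
      one_smul] at h2
    rw [← h2, ← h.mul_minkowski_mul]
    simp only [Matrix.mul_assoc]
  · refine cancel _ _ ?_
    rw [← ymStress_frameChange h, hR.stress, ymPairing_frameChange h, Matrix.mul_smul,
      Matrix.smul_mul, h]
end DoubleDual

/-! ### Decomposable curvature tensors and the null frame. -/

section Invariants

/-- The curvature tensor with lowered components `u_κ v_λ (p_μ r_ν - p_ν r_μ)`, at the Minkowski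
metric. -/
def decomposable (u v p r : Fin 4 → ℝ) : CurvatureTensor :=
  ⟨fun κ lam μ ν => minkowski κ κ * u κ * v lam * (p μ * r ν - p ν * r μ), fun κ lam μ ν => by ring⟩

theorem IsLorentz.isUnit_det {L : Matrix (Fin 4) (Fin 4) ℝ} (hL : IsLorentz L) : IsUnit L.det :=
  isUnit_det_of_isOrthonormalFrame hL

theorem IsLorentz.inv_eq {L : Matrix (Fin 4) (Fin 4) ℝ} (hL : IsLorentz L) :
    L⁻¹ = minkowski * Lᵀ * minkowski := by
  apply Matrix.inv_eq_left_inv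
  have h : Lᵀ * minkowski * L = minkowski := hL
  rw [Matrix.mul_assoc, Matrix.mul_assoc, ← Matrix.mul_assoc Lᵀ, h, minkowski_mul_self]

theorem IsLorentz.of_mul_minkowski_mul_transpose {L : Matrix (Fin 4) (Fin 4) ℝ}
    (hL : L * minkowski * Lᵀ = minkowski) : IsLorentz L := by
  have h1 : L * (minkowski * Lᵀ * minkowski) = 1 := by
    rw [← Matrix.mul_assoc, ← Matrix.mul_assoc, hL, minkowski_mul_self]
  have h2 := mul_eq_one_comm.1 h1
  have h3 := congrArg (minkowski * ·) h2
  simp only [← Matrix.mul_assoc, minkowski_mul_self, Matrix.one_mul, Matrix.mul_one] at h3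
  exact h3

/-- Covectors transform by right multiplication with `L`. The raised first index agrees with this
because `L⁻¹ = η Lᵀ η` for a Lorentz matrix. -/
theorem frameChange_decomposable {L : Matrix (Fin 4) (Fin 4) ℝ} (hL : IsLorentz L)
    (u v p r : Fin 4 → ℝ) :
    frameChange L (decomposable u v p r)
      = decomposable (u ᵥ* L) (v ᵥ* L) (p ᵥ* L) (r ᵥ* L) := by
  have h1 : ∀ a, ∑ κ, L⁻¹ a κ * (minkowski κ κ * u κ) = minkowski a a * (u ᵥ* L) a := by
    intro a
    have : L⁻¹ *ᵥ (minkowski *ᵥ u) = minkowski *ᵥ (u ᵥ* L) := by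
      rw [hL.inv_eq, Matrix.mulVec_mulVec, Matrix.mul_assoc, minkowski_mul_self, Matrix.mul_one,
        ← Matrix.mulVec_mulVec, Matrix.mulVec_transpose]
    have h := congrFun this a
    rw [minkowski, Matrix.mulVec_diagonal] at h
    rw [minkowski, Matrix.diagonal_apply_eq, ← h]
    simp only [Matrix.mulVec, dotProduct, Matrix.diagonal_apply, ite_mul, zero_mul,
      Finset.sum_ite_eq, Finset.mem_univ, if_true]
  have h2 : ∀ (w : Fin 4 → ℝ) a, ∑ i, L i a * w i = (w ᵥ* L) a := by
    intro w a
    simp only [Matrix.vecMul, dotProduct, mul_comm]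
  ext a b c d
  change ∑ κ, L⁻¹ a κ * ∑ lam, L lam b * ∑ μ, L μ c * ∑ ν, L ν d *
    (minkowski κ κ * u κ * v lam * (p μ * r ν - p ν * r μ)) = minkowski a a * (u ᵥ* L) a *
      (v ᵥ* L) b * ((p ᵥ* L) c * (r ᵥ* L) d - (p ᵥ* L) d * (r ᵥ* L) c)
  have h3 : ∀ κ lam, ∑ μ, L μ c * ∑ ν, L ν d *
      (minkowski κ κ * u κ * v lam * (p μ * r ν - p ν * r μ))
      = (minkowski κ κ * u κ) * (v lam * ((p ᵥ* L) c * (r ᵥ* L) d - (p ᵥ* L) d * (r ᵥ* L) c)) := by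
    intro κ lam
    rw [← h2 p c, ← h2 p d, ← h2 r c, ← h2 r d, Finset.sum_mul_sum, mul_comm (∑ i, L i d * p i),
      Finset.sum_mul_sum]
    simp only [← Finset.sum_sub_distrib, Finset.mul_sum]
    refine Finset.sum_congr rfl fun _ _ => Finset.sum_congr rfl fun _ _ => ?_
    ring
  simp only [h3]
  have h4 : ∀ X : ℝ, ∑ κ, L⁻¹ a κ * ∑ lam, L lam b * (minkowski κ κ * u κ * (v lam * X))
      = (∑ κ, L⁻¹ a κ * (minkowski κ κ * u κ)) * (∑ lam, L lam b * v lam) * X := by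
    intro X
    rw [Finset.sum_mul_sum, Finset.sum_mul]
    refine Finset.sum_congr rfl fun _ _ => ?_
    rw [Finset.mul_sum, Finset.sum_mul]
    refine Finset.sum_congr rfl fun _ _ => ?_
    ring
  rw [h4, h1, h2]

/-- Null frame of covectors `l, n, x, y`. -/
def nullFrame : Fin 4 → Fin 4 → ℝ := ![![1, 1, 0, 0], ![1, -1, 0, 0], ![0, 0, 1, 0], ![0, 0, 0, 1]]

theorem eq_sum_nullFrame (u : Fin 4 → ℝ) :
    u = ∑ i, (![(u 0 + u 1) / 2, (u 0 - u 1) / 2, u 2, u 3] i) • nullFrame i := by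
  ext j
  fin_cases j <;> simp [Fin.sum_univ_four, nullFrame] <;> ring

/-- `decomposable` as a multilinear map. -/
def decomposableLin : (Fin 4 → ℝ) →ₗ[ℝ] (Fin 4 → ℝ) →ₗ[ℝ] (Fin 4 → ℝ) →ₗ[ℝ] (Fin 4 → ℝ) →ₗ[ℝ]
    CurvatureTensor :=
  LinearMap.mk₂ ℝ (fun u v => LinearMap.mk₂ ℝ (fun p r => decomposable u v p r)
    (fun _ _ _ => by ext; simp [decomposable]; ring) (fun _ _ _ => by ext; simp [decomposable]; ring)
    (fun _ _ _ => by ext; simp [decomposable]; ring) (fun _ _ _ => by ext; simp [decomposable]; ring))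
    (fun _ _ _ => by ext; simp [decomposable]; ring) (fun _ _ _ => by ext; simp [decomposable]; ring)
    (fun _ _ _ => by ext; simp [decomposable]; ring) (fun _ _ _ => by ext; simp [decomposable]; ring)

theorem decomposableLin_apply (u v p r : Fin 4 → ℝ) :
    decomposableLin u v p r = decomposable u v p r := rfl

theorem decomposable_sum (c1 c2 c3 c4 : Fin 4 → ℝ) (f : Fin 4 → Fin 4 → ℝ) :
    decomposable (∑ i, c1 i • f i) (∑ i, c2 i • f i) (∑ i, c3 i • f i) (∑ i, c4 i • f i)
      = ∑ i, c1 i • ∑ j, c2 j • ∑ k, c3 k • ∑ l, c4 l •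
        decomposable (f i) (f j) (f k) (f l) := by
  simp only [← decomposableLin_apply]
  rw [map_sum decomposableLin]
  simp only [map_smul, LinearMap.sum_apply, LinearMap.smul_apply]
  refine Finset.sum_congr rfl fun i _ => ?_
  congr 1
  rw [map_sum (decomposableLin (f i))]
  simp only [map_smul, LinearMap.sum_apply, LinearMap.smul_apply]
  refine Finset.sum_congr rfl fun j _ => ?_
  congr 1
  rw [map_sum (decomposableLin (f i) (f j))]
  simp only [map_smul, LinearMap.sum_apply, LinearMap.smul_apply]
  refine Finset.sum_congr rfl fun k _ => ?_
  congr 1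
  rw [map_sum]
  simp only [map_smul]

/-- The factor `1/2` compensates the antisymmetrisation inside `decomposable`, and `minkowski κ κ`
compensates its raised index. -/
theorem eq_sum_decomposable (R : CurvatureTensor) :
    R = ∑ κ, ∑ lam, ∑ μ, ∑ ν, (minkowski κ κ * R.1 κ lam μ ν / 2) •
      decomposable (Pi.single κ 1) (Pi.single lam 1) (Pi.single μ 1) (Pi.single ν 1) := by
  have hm : ∀ κ, minkowski κ κ * minkowski κ κ = 1 := by
    intro κ
    rw [minkowski, Matrix.diagonal_apply_eq]
    fin_cases κ <;> simp
  ext a b c d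
  simp only [decomposable, AddSubmonoidClass.coe_finsetSum, Submodule.coe_smul, Finset.sum_apply,
    Pi.smul_apply, smul_eq_mul, Pi.single_apply]
  simp only [mul_sub, Finset.sum_sub_distrib, mul_ite, ite_mul, mul_one, mul_zero, zero_mul, one_mul,
    Finset.sum_ite_eq, Finset.sum_ite_eq', Finset.mem_univ, if_true, Finset.sum_const_zero,
    Finset.sum_ite_irrel]
  have h1 := hm a
  have h2 := R.2 a b d c
  rw [h2]
  linear_combination (-R.1 a b c d) * h1

theorem linearMap_eq_zero_of_nullFrame {f : CurvatureTensor →ₗ[ℝ] ℝ}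
    (h : ∀ i j k l, f (decomposable (nullFrame i) (nullFrame j) (nullFrame k) (nullFrame l)) = 0) :
    f = 0 := by
  refine LinearMap.ext fun R => ?_
  rw [eq_sum_decomposable R, LinearMap.zero_apply]
  simp only [map_sum, map_smul]
  refine Finset.sum_eq_zero fun κ _ => ?_
  refine Finset.sum_eq_zero fun lam _ => ?_
  refine Finset.sum_eq_zero fun μ _ => ?_
  refine Finset.sum_eq_zero fun ν _ => ?_
  rw [eq_sum_nullFrame (Pi.single κ 1), eq_sum_nullFrame (Pi.single lam 1),
    eq_sum_nullFrame (Pi.single μ 1), eq_sum_nullFrame (Pi.single ν 1), decomposable_sum]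
  simp only [map_sum, map_smul, h, smul_zero, Finset.sum_const_zero]

end Invariants

/-! ### Components of a functional under boosts, reflections and a null rotation. -/

section Invariants

/-- Boost weights of the null frame, shifted by one. -/
def boostWeight : Fin 4 → ℕ := ![2, 0, 1, 1]
/-- Occurrences of the third vector of the null frame. -/
def countX : Fin 4 → ℕ := ![0, 0, 1, 0]
/-- Occurrences of the fourth vector of the null frame. -/
def countY : Fin 4 → ℕ := ![0, 0, 0, 1]

/-- The component selection rule for the boosts and for the two reflections. -/
def Selected (m px py : ℕ) (i j k l : Fin 4) : Prop :=
  boostWeight i + boostWeight j + boostWeight k + boostWeight l = m ∧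
    (countX i + countX j + countX k + countX l) % 2 = px ∧
    (countY i + countY j + countY k + countY l) % 2 = py ∧ k ≠ l

instance (m px py : ℕ) (i j k l : Fin 4) : Decidable (Selected m px py i j k l) := by
  unfold Selected
  infer_instance

/-- The components of a functional in the null frame. -/
noncomputable def nullComp (f : CurvatureTensor →ₗ[ℝ] ℝ) (i j k l : Fin 4) : ℝ :=
  f (decomposable (nullFrame i) (nullFrame j) (nullFrame k) (nullFrame l))

theorem nullComp_antisymm (f : CurvatureTensor →ₗ[ℝ] ℝ) (i j k l : Fin 4) :
    nullComp f i j k l = -nullComp f i j l k := by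
  rw [nullComp, nullComp, ← map_neg]
  congr 1
  ext
  simp [decomposable]
  ring

/-- `f` is multiplied by `χ` under the Lorentz transformation `L`. -/
def IsSemiInvariant (f : CurvatureTensor →ₗ[ℝ] ℝ) (L : Matrix (Fin 4) (Fin 4) ℝ) (χ : ℝ) : Prop :=
  IsLorentz L ∧ ∀ R, f R = χ * f (frameChange L R)

theorem IsSemiInvariant.nullComp_eq_monomial {f : CurvatureTensor →ₗ[ℝ] ℝ}
    {L : Matrix (Fin 4) (Fin 4) ℝ} {χ : ℝ} (h : IsSemiInvariant f L χ) (w : Fin 4 → ℝ)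
    (σ : Fin 4 → Fin 4) (hw : ∀ i, nullFrame i ᵥ* L = w i • nullFrame (σ i)) (i j k l : Fin 4) :
    nullComp f i j k l = χ * (w i * w j * w k * w l) * nullComp f (σ i) (σ j) (σ k) (σ l) := by
  rw [nullComp, h.2, frameChange_decomposable h.1, hw, hw, hw, hw, ← decomposableLin_apply]
  simp only [map_smul, LinearMap.smul_apply, decomposableLin_apply, smul_eq_mul, nullComp]
  ring

theorem IsSemiInvariant.nullComp_eq_sum {f : CurvatureTensor →ₗ[ℝ] ℝ}
    {L : Matrix (Fin 4) (Fin 4) ℝ} {χ : ℝ} (h : IsSemiInvariant f L χ) (N : Fin 4 → Fin 4 → ℝ)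
    (hw : ∀ i, nullFrame i ᵥ* L = ∑ a, N i a • nullFrame a) (i j k l : Fin 4) :
    nullComp f i j k l = χ * ∑ a, N i a * ∑ b, N j b * ∑ c, N k c * ∑ d, N l d *
      nullComp f a b c d := by
  rw [nullComp, h.2, frameChange_decomposable h.1, hw, hw, hw, hw, decomposable_sum]
  simp only [map_sum, map_smul, smul_eq_mul, nullComp]

/-- The entries are the hyperbolic cosine and sine of `log 2`: the boost doubles the first null
vector and halves the second, and it is rational. -/
noncomputable def boostMat : Matrix (Fin 4) (Fin 4) ℝ := !![5/4, 3/4, 0, 0; 3/4, 5/4, 0, 0; 0, 0, 1, 0; 0, 0, 0, 1]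
def reflX : Matrix (Fin 4) (Fin 4) ℝ := !![1, 0, 0, 0; 0, 1, 0, 0; 0, 0, -1, 0; 0, 0, 0, 1]
def reflY : Matrix (Fin 4) (Fin 4) ℝ := !![1, 0, 0, 0; 0, 1, 0, 0; 0, 0, 1, 0; 0, 0, 0, -1]
def reflZ : Matrix (Fin 4) (Fin 4) ℝ := !![1, 0, 0, 0; 0, -1, 0, 0; 0, 0, 1, 0; 0, 0, 0, 1]
def swapXY : Matrix (Fin 4) (Fin 4) ℝ := !![1, 0, 0, 0; 0, 1, 0, 0; 0, 0, 0, 1; 0, 0, 1, 0]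
-- On the null frame `l, n, x, y` this fixes `l` and `y` and sends `x` to `x + l` and `n` to `n + 2x
-- + l`.
noncomputable def nullRot : Matrix (Fin 4) (Fin 4) ℝ :=
  !![3/2, 1/2, 1, 0; -1/2, 1/2, -1, 0; 1, 1, 1, 0; 0, 0, 0, 1]

theorem minkowski_eq_of :
    minkowski = !![1, 0, 0, 0; 0, -1, 0, 0; 0, 0, -1, 0; 0, 0, 0, -1] := by
  ext i j
  fin_cases i <;> fin_cases j <;> simp [minkowski]

theorem isLorentz_boostMat : IsLorentz boostMat := by
  apply IsLorentz.of_mul_minkowski_mul_transpose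
  rw [minkowski_eq_of, boostMat]
  ext i j
  fin_cases i <;> fin_cases j <;>
    simp [Matrix.mul_apply, Fin.sum_univ_four, Matrix.transpose_apply] <;> norm_num

theorem isLorentz_reflX : IsLorentz reflX := by
  apply IsLorentz.of_mul_minkowski_mul_transpose
  rw [minkowski_eq_of, reflX]
  ext i j
  fin_cases i <;> fin_cases j <;>
    simp [Matrix.mul_apply, Fin.sum_univ_four, Matrix.transpose_apply]

theorem isLorentz_reflY : IsLorentz reflY := by
  apply IsLorentz.of_mul_minkowski_mul_transpose
  rw [minkowski_eq_of, reflY]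
  ext i j
  fin_cases i <;> fin_cases j <;>
    simp [Matrix.mul_apply, Fin.sum_univ_four, Matrix.transpose_apply]

theorem isLorentz_reflZ : IsLorentz reflZ := by
  apply IsLorentz.of_mul_minkowski_mul_transpose
  rw [minkowski_eq_of, reflZ]
  ext i j
  fin_cases i <;> fin_cases j <;>
    simp [Matrix.mul_apply, Fin.sum_univ_four, Matrix.transpose_apply]

theorem isLorentz_swapXY : IsLorentz swapXY := by
  apply IsLorentz.of_mul_minkowski_mul_transpose
  rw [minkowski_eq_of, swapXY]
  ext i j
  fin_cases i <;> fin_cases j <;>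
    simp [Matrix.mul_apply, Fin.sum_univ_four, Matrix.transpose_apply]

theorem isLorentz_nullRot : IsLorentz nullRot := by
  apply IsLorentz.of_mul_minkowski_mul_transpose
  rw [minkowski_eq_of, nullRot]
  ext i j
  fin_cases i <;> fin_cases j <;>
    simp [Matrix.mul_apply, Fin.sum_univ_four, Matrix.transpose_apply] <;> norm_num

/-- The boost and the reflections multiply every frame component by a scalar, so a nonzero component
needs total factor 1. The boost factors `2 ^ w / 2` of four vectors multiply to `2 ^ (sum of w) /
16`, which explains `16 / 2 ^ m`. The `if` form lets a rewrite delete the excluded terms of a sum.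
-/
theorem nullComp_eq_ite {f : CurvatureTensor →ₗ[ℝ] ℝ} {m px py : ℕ} (hpx : px < 2) (hpy : py < 2)
    (hb : IsSemiInvariant f boostMat (16 / 2 ^ m)) (hx : IsSemiInvariant f reflX ((-1) ^ px))
    (hy : IsSemiInvariant f reflY ((-1) ^ py)) (i j k l : Fin 4) :
    nullComp f i j k l = if Selected m px py i j k l then nullComp f i j k l else 0 := by
  split_ifs with h
  · rfl
  have h1 := hb.nullComp_eq_monomial (fun i => 2 ^ boostWeight i / 2) id (by
    intro i
    ext a
    fin_cases i <;> fin_cases a <;>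
      simp [boostMat, nullFrame, boostWeight, Matrix.vecMul, dotProduct, Fin.sum_univ_four] <;> norm_num)
      i j k l
  have h2 := hx.nullComp_eq_monomial (fun i => (-1) ^ countX i) id (by
    intro i
    ext a
    fin_cases i <;> fin_cases a <;>
      simp [reflX, nullFrame, countX, Matrix.vecMul, dotProduct, Fin.sum_univ_four]) i j k l
  have h3 := hy.nullComp_eq_monomial (fun i => (-1) ^ countY i) id (by
    intro i
    ext a
    fin_cases i <;> fin_cases a <;>
      simp [reflY, nullFrame, countY, Matrix.vecMul, dotProduct, Fin.sum_univ_four]) i j k l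
  have h4 := nullComp_antisymm f i j k l
  simp only [id] at h1 h2 h3
  by_contra hne
  apply h
  refine ⟨?_, ?_, ?_, ?_⟩
  · have h5 : (16 : ℝ) / 2 ^ m * (2 ^ boostWeight i / 2 * (2 ^ boostWeight j / 2) *
        (2 ^ boostWeight k / 2) * (2 ^ boostWeight l / 2)) = 1 :=
      mul_right_cancel₀ hne (by rw [one_mul]; exact h1.symm)
    have h6 : (2 : ℝ) ^ (boostWeight i + boostWeight j + boostWeight k + boostWeight l) = 2 ^ m := by
      field_simp at h5
      rw [pow_add, pow_add, pow_add]
      linarith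
    exact pow_right_injective₀ (by norm_num) (by norm_num) h6
  · have h5 : (-1 : ℝ) ^ px * ((-1) ^ countX i * (-1) ^ countX j * (-1) ^ countX k *
        (-1) ^ countX l) = 1 := mul_right_cancel₀ hne (by rw [one_mul]; exact h2.symm)
    rw [← pow_add, ← pow_add, ← pow_add, ← pow_add, neg_one_pow_eq_one_iff_even (by norm_num)] at h5
    rw [Nat.even_iff] at h5
    omega
  · have h5 : (-1 : ℝ) ^ py * ((-1) ^ countY i * (-1) ^ countY j * (-1) ^ countY k *
        (-1) ^ countY l) = 1 := mul_right_cancel₀ hne (by rw [one_mul]; exact h3.symm)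
    rw [← pow_add, ← pow_add, ← pow_add, ← pow_add, neg_one_pow_eq_one_iff_even (by norm_num)] at h5
    rw [Nat.even_iff] at h5
    omega
  · rintro rfl
    exact hne (self_eq_neg.1 h4)

theorem IsSemiInvariant.nullComp_swapXY {f : CurvatureTensor →ₗ[ℝ] ℝ} {χ : ℝ}
    (h : IsSemiInvariant f swapXY χ) (i j k l : Fin 4) : nullComp f i j k l =
      χ * nullComp f (![0, 1, 3, 2] i) (![0, 1, 3, 2] j) (![0, 1, 3, 2] k) (![0, 1, 3, 2] l) := by
  have := h.nullComp_eq_monomial (fun _ => 1) ![0, 1, 3, 2] (by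
    intro i
    ext a
    fin_cases i <;> fin_cases a <;>
      simp [swapXY, nullFrame, Matrix.vecMul, dotProduct, Fin.sum_univ_four]) i j k l
  simpa using this

theorem IsSemiInvariant.nullComp_reflZ {f : CurvatureTensor →ₗ[ℝ] ℝ} {χ : ℝ}
    (h : IsSemiInvariant f reflZ χ) (i j k l : Fin 4) : nullComp f i j k l =
      χ * nullComp f (![1, 0, 2, 3] i) (![1, 0, 2, 3] j) (![1, 0, 2, 3] k) (![1, 0, 2, 3] l) := by
  have := h.nullComp_eq_monomial (fun _ => 1) ![1, 0, 2, 3] (by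
    intro i
    ext a
    fin_cases i <;> fin_cases a <;>
      simp [reflZ, nullFrame, Matrix.vecMul, dotProduct, Fin.sum_univ_four]) i j k l
  simpa using this

theorem IsSemiInvariant.nullComp_nullRot {f : CurvatureTensor →ₗ[ℝ] ℝ}
    (h : IsSemiInvariant f nullRot 1) (i j k l : Fin 4) : nullComp f i j k l =
      ∑ a, (!![1, 0, 0, 0; 1, 1, 2, 0; 1, 0, 1, 0; 0, 0, 0, 1] : Matrix (Fin 4) (Fin 4) ℝ) i a *
      ∑ b, (!![1, 0, 0, 0; 1, 1, 2, 0; 1, 0, 1, 0; 0, 0, 0, 1] : Matrix (Fin 4) (Fin 4) ℝ) j b *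
      ∑ c, (!![1, 0, 0, 0; 1, 1, 2, 0; 1, 0, 1, 0; 0, 0, 0, 1] : Matrix (Fin 4) (Fin 4) ℝ) k c *
      ∑ d, (!![1, 0, 0, 0; 1, 1, 2, 0; 1, 0, 1, 0; 0, 0, 0, 1] : Matrix (Fin 4) (Fin 4) ℝ) l d *
      nullComp f a b c d := by
  have := h.nullComp_eq_sum
    (!![1, 0, 0, 0; 1, 1, 2, 0; 1, 0, 1, 0; 0, 0, 0, 1] : Matrix (Fin 4) (Fin 4) ℝ) (by
    intro i
    ext a
    fin_cases i <;> fin_cases a <;>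
      simp [nullRot, nullFrame, Matrix.vecMul, dotProduct, Fin.sum_univ_four] <;> norm_num) i j k l
  rwa [one_mul] at this

end Invariants

/-! ### Uniqueness of functionals with prescribed symmetry. -/

section Invariants

/-- A functional vanishes if its selected components vanish; these are permuted, up to signs, by the
group generated by the transformations `σ`, `τ` of the null frame and by the antisymmetry. -/
theorem eq_zero_of_selected {f : CurvatureTensor →ₗ[ℝ] ℝ} {m px py : ℕ} {χ ψ : ℝ}
    (σ τ : Fin 4 → Fin 4)
    (hsel : ∀ i j k l, nullComp f i j k l =
      if Selected m px py i j k l then nullComp f i j k l else 0)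
    (hσ : ∀ i j k l, nullComp f i j k l = χ * nullComp f (σ i) (σ j) (σ k) (σ l))
    (hτ : ∀ i j k l, nullComp f i j k l = ψ * nullComp f (τ i) (τ j) (τ k) (τ l))
    (C : List (Fin 4 × Fin 4 × Fin 4 × Fin 4))
    (hC : ∀ c ∈ C, nullComp f c.1 c.2.1 c.2.2.1 c.2.2.2 = 0)
    (hcov : ∀ i j k l, Selected m px py i j k l → [(i, j, k, l), (i, j, l, k),
      (σ i, σ j, σ k, σ l), (σ i, σ j, σ l, σ k), (τ i, τ j, τ k, τ l), (τ i, τ j, τ l, τ k),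
      (τ (σ i), τ (σ j), τ (σ k), τ (σ l)), (τ (σ i), τ (σ j), τ (σ l), τ (σ k))].any
        C.contains = true) : f = 0 := by
  apply linearMap_eq_zero_of_nullFrame
  change ∀ i j k l, nullComp f i j k l = 0
  have ha := nullComp_antisymm f
  intro i j k l
  by_cases h : Selected m px py i j k l
  · have h' := hcov i j k l h
    simp only [List.any_cons, List.any_nil, Bool.or_false, Bool.or_eq_true,
      List.contains_iff_mem] at h'
    rcases h' with h | h | h | h | h | h | h | h
    · exact hC _ h
    · rw [ha, hC _ h, neg_zero]
    · rw [hσ, hC _ h, mul_zero]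
    · rw [hσ, ha, hC _ h, neg_zero, mul_zero]
    · rw [hτ, hC _ h, mul_zero]
    · rw [hτ, ha, hC _ h, neg_zero, mul_zero]
    · rw [hσ, hτ, hC _ h, mul_zero, mul_zero]
    · rw [hσ, hτ, ha, hC _ h, neg_zero, mul_zero, mul_zero]
  · rw [hsel, if_neg h]

/-- The symmetries are those of the plane wave `stdWave`: boost factor 4, and a sign under the
exchange of `x` and `y`. They leave at most a one-dimensional space of functionals, detected by a
single component. -/
theorem eq_zero_of_weyl_symmetry {f : CurvatureTensor →ₗ[ℝ] ℝ}
    (hb : IsSemiInvariant f boostMat 4) (hx : IsSemiInvariant f reflX 1)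
    (hy : IsSemiInvariant f reflY 1)
    (hs : IsSemiInvariant f swapXY (-1)) (hn : IsSemiInvariant f nullRot 1)
    (h0 : nullComp f 1 2 1 2 = 0) : f = 0 := by
  have hsel := nullComp_eq_ite (m := 2) (px := 0) (py := 0) (by norm_num) (by norm_num)
    (by convert hb; norm_num) (by simpa using hx) (by simpa using hy)
  have hs' := hs.nullComp_swapXY
  have hn' := hn.nullComp_nullRot
  have ha := nullComp_antisymm f
  -- This component has the wrong boost weight and vanishes, so its transformation law under the
  -- null rotation is a linear relation between selected components.
  have e1 := hn' 1 1 1 2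
  -- `K` is an opaque copy of `nullComp f`: the selection rule rewritten with it on the right can be
  -- used by `simp` without looping.
  obtain ⟨K, hKf, hK⟩ : ∃ K : Fin 4 → Fin 4 → Fin 4 → Fin 4 → ℝ, K = nullComp f ∧
    ∀ i j k l, nullComp f i j k l = if Selected 2 0 0 i j k l then K i j k l else 0 :=
    ⟨_, rfl, hsel⟩
  simp only [Fin.sum_univ_four] at e1
  simp +decide only [hK, Matrix.of_apply, Matrix.cons_val, if_true, if_false, zero_mul, mul_zero,
    add_zero, zero_add, one_mul] at e1
  subst hKf
  -- The exchange of `x` and `y` fixes this component and must also change its sign.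
  have h1110 : nullComp f 1 1 1 0 = 0 := by
    have s1 := hs' 1 1 1 0
    simp only [Matrix.cons_val] at s1
    linarith
  have h2112 : nullComp f 2 1 1 2 = 0 := by linarith
  refine eq_zero_of_selected ![0, 1, 3, 2] id hsel hs' (fun i j k l => (one_mul _).symm) [(1, 2, 1, 2), (2, 1, 1, 2), (1, 1, 1, 0)] ?_ (by decide)
  simp only [List.mem_cons, List.not_mem_nil, or_false]
  rintro c (rfl | rfl | rfl)
  exacts [h0, h2112, h1110]

/-- Up to the exchange of `x, y`, the exchange of the two null vectors and the antisymmetry, five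
components survive the selection rules. Three components of the wrong boost weight give relations
under the null rotation which, with the discrete symmetries, express four of the five through the
remaining one. -/
theorem eq_zero_of_lorentz_symmetry {f : CurvatureTensor →ₗ[ℝ] ℝ}
    (hb : IsSemiInvariant f boostMat 1) (hx : IsSemiInvariant f reflX 1)
    (hy : IsSemiInvariant f reflY 1) (hz : IsSemiInvariant f reflZ 1)
    (hs : IsSemiInvariant f swapXY 1) (hn : IsSemiInvariant f nullRot 1)
    (h0 : nullComp f 0 1 0 1 = 0) : f = 0 := by
  have hsel := nullComp_eq_ite (m := 4) (px := 0) (py := 0) (by norm_num) (by norm_num)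
    (by convert hb; norm_num) (by simpa using hx) (by simpa using hy)
  have hs' := hs.nullComp_swapXY
  have hn' := hn.nullComp_nullRot
  have ha := nullComp_antisymm f
  have hz' := hz.nullComp_reflZ
  have e1 := hn' 1 0 1 2
  have e2 := hn' 0 1 1 2
  have e3 := hn' 1 3 2 3
  obtain ⟨K, hKf, hK⟩ : ∃ K : Fin 4 → Fin 4 → Fin 4 → Fin 4 → ℝ, K = nullComp f ∧
    ∀ i j k l, nullComp f i j k l = if Selected 4 0 0 i j k l then K i j k l else 0 :=
    ⟨_, rfl, hsel⟩
  simp only [Fin.sum_univ_four] at e1 e2 e3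
  simp +decide only [hK, Matrix.of_apply, Matrix.cons_val, if_true, if_false, zero_mul, mul_zero,
    add_zero, zero_add, one_mul] at e1 e2 e3
  subst hKf
  have z1 := hz' 0 1 0 1
  have z2 := hz' 2 2 0 1
  have z3 := hz' 0 2 1 2
  have s3 := hs' 1 2 0 2
  have a1 := ha 0 1 1 0
  have a2 := ha 2 2 0 1
  simp only [Matrix.cons_val] at z1 z2 z3 s3
  have h2012 : nullComp f 2 0 1 2 = 0 := by linarith
  have h0212 : nullComp f 0 2 1 2 = 0 := by linarith
  have h2323 : nullComp f 2 3 2 3 = 0 := by linarith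
  have h2201 : nullComp f 2 2 0 1 = 0 := by linarith
  refine eq_zero_of_selected ![0, 1, 3, 2] ![1, 0, 2, 3] hsel hs' hz' [(0, 1, 0, 1), (2, 0, 1, 2), (0, 2, 1, 2), (2, 3, 2, 3), (2, 2, 0, 1)] ?_ (by decide)
  simp only [List.mem_cons, List.not_mem_nil, or_false]
  rintro c (rfl | rfl | rfl | rfl | rfl)
  exacts [h0, h2012, h0212, h2323, h2201]

/-- The counterpart for functionals which change sign under improper transformations: the parities
are now odd, and one component with all four frame vectors distinct determines the rest. -/
theorem eq_zero_of_pseudo_lorentz_symmetry {f : CurvatureTensor →ₗ[ℝ] ℝ}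
    (hb : IsSemiInvariant f boostMat 1) (hx : IsSemiInvariant f reflX (-1))
    (hy : IsSemiInvariant f reflY (-1)) (hz : IsSemiInvariant f reflZ (-1))
    (hs : IsSemiInvariant f swapXY (-1)) (hn : IsSemiInvariant f nullRot 1)
    (h0 : nullComp f 0 1 2 3 = 0) : f = 0 := by
  have hsel := nullComp_eq_ite (m := 4) (px := 1) (py := 1) (by norm_num) (by norm_num)
    (by convert hb; norm_num) (by simpa using hx) (by simpa using hy)
  have hs' := hs.nullComp_swapXY
  have hn' := hn.nullComp_nullRot
  have ha := nullComp_antisymm f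
  have hz' := hz.nullComp_reflZ
  have e1 := hn' 1 2 2 3
  have e2 := hn' 2 1 2 3
  have e3 := hn' 2 3 1 2
  obtain ⟨K, hKf, hK⟩ : ∃ K : Fin 4 → Fin 4 → Fin 4 → Fin 4 → ℝ, K = nullComp f ∧
    ∀ i j k l, nullComp f i j k l = if Selected 4 1 1 i j k l then K i j k l else 0 :=
    ⟨_, rfl, hsel⟩
  simp only [Fin.sum_univ_four] at e1 e2 e3
  simp +decide only [hK, Matrix.of_apply, Matrix.cons_val, if_true, if_false, zero_mul, mul_zero,
    add_zero, zero_add, one_mul] at e1 e2 e3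
  subst hKf
  have z1 := hz' 0 1 2 3
  have z2 := hz' 2 2 2 3
  have z3 := hz' 1 2 0 3
  have z4 := hz' 2 1 0 3
  have s3 := hs' 0 2 1 3
  have a1 := ha 2 3 0 1
  simp only [Matrix.cons_val] at z1 z2 z3 z4 s3
  have h2223 : nullComp f 2 2 2 3 = 0 := by linarith
  have h0213 : nullComp f 0 2 1 3 = 0 := by linarith
  have h2013 : nullComp f 2 0 1 3 = 0 := by linarith
  have h2301 : nullComp f 2 3 0 1 = 0 := by linarith
  refine eq_zero_of_selected ![0, 1, 3, 2] ![1, 0, 2, 3] hsel hs' hz' [(0, 1, 2, 3), (2, 2, 2, 3), (0, 2, 1, 3), (2, 0, 1, 3), (2, 3, 0, 1)] ?_ (by decide)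
  simp only [List.mem_cons, List.not_mem_nil, or_false]
  rintro c (rfl | rfl | rfl | rfl | rfl)
  exacts [h0, h2223, h0213, h2013, h2301]

end Invariants

/-! ### Polar forms on the scalar and pseudoscalar pieces. -/

section Invariants

theorem lorentzMat_add (a b a' b' : Fin 3 → ℝ) :
    lorentzMat (a + a') (b + b') = lorentzMat a b + lorentzMat a' b' := by
  ext i j
  fin_cases i <;> fin_cases j <;> simp [lorentzMat] <;> ring

theorem lorentzMat_smul (c : ℝ) (a b : Fin 3 → ℝ) :
    lorentzMat (c • a) (c • b) = c • lorentzMat a b := by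
  ext i j
  fin_cases i <;> fin_cases j <;> simp [lorentzMat]

theorem doubleDualTensor_add (A B A' B' : Fin 3 → Fin 3 → ℝ) :
    doubleDualTensor (A + A') (B + B') = doubleDualTensor A B + doubleDualTensor A' B' := by
  symm
  apply eq_doubleDualTensor <;>
  simp [curvMat_add, curvMat_doubleDualTensor, doubleDualMat, ← lorentzMat_add, neg_add, add_comm]

theorem doubleDualTensor_smul (c : ℝ) (A B : Fin 3 → Fin 3 → ℝ) :
    doubleDualTensor (c • A) (c • B) = c • doubleDualTensor A B := by
  symm
  apply eq_doubleDualTensor <;>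
  simp [curvMat_smul, curvMat_doubleDualTensor, doubleDualMat, ← lorentzMat_smul]

theorem doubleDualTensor_zero : doubleDualTensor 0 0 = 0 := by
  simpa using doubleDualTensor_smul 0 0 0

theorem ymPairing_minkowski (R Q : CurvatureTensor) : ymPairing minkowski R Q =
    2 * (-(curvMat R 0 1 * curvMat Q 0 1).trace - (curvMat R 0 2 * curvMat Q 0 2).trace
      - (curvMat R 0 3 * curvMat Q 0 3).trace + (curvMat R 2 3 * curvMat Q 2 3).trace
      + (curvMat R 3 1 * curvMat Q 3 1).trace + (curvMat R 1 2 * curvMat Q 1 2).trace) := by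
  have h : ∀ μ ν, (curvMat R μ ν * curvMat Q μ ν).trace
      = (curvMat R ν μ * curvMat Q ν μ).trace := by
    intro μ ν
    rw [curvMat_antisymm R μ ν, curvMat_antisymm Q μ ν, neg_mul_neg]
  have hz : ∀ μ, curvMat R μ μ = 0 := by
    intro μ
    ext κ lam
    exact self_eq_neg.1 (R.2 κ lam μ μ)
  have h1 : ymPairing minkowski R Q = ∑ μ, minkowski μ μ * ∑ ν, minkowski ν ν *
      (curvMat R μ ν * curvMat Q μ ν).trace := by
    simp only [ymPairing, ymStress, minkowski_inv, Matrix.of_apply]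
    simp only [minkowski, Matrix.diagonal_apply, ite_mul, zero_mul, Finset.sum_ite_eq, Finset.mem_univ, if_true]
  rw [h1]
  simp only [Fin.sum_univ_four, hz, zero_mul, Matrix.trace_zero, h 1 0, h 2 0, h 3 0, h 3 2, h 1 3,
    h 2 1]
  simp [minkowski]
  ring

theorem ymPairing_doubleDualTensor (A B : Fin 3 → Fin 3 → ℝ) (Q : CurvatureTensor) :
    ymPairing minkowski (doubleDualTensor A B) Q =
    2 * (-(lorentzMat (A 0) (B 0) * curvMat Q 0 1).trace
      - (lorentzMat (A 1) (B 1) * curvMat Q 0 2).trace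
      - (lorentzMat (A 2) (B 2) * curvMat Q 0 3).trace
      + (lorentzMat (B 0) (-A 0) * curvMat Q 2 3).trace
      + (lorentzMat (B 1) (-A 1) * curvMat Q 3 1).trace
      + (lorentzMat (B 2) (-A 2) * curvMat Q 1 2).trace) := by
  rw [ymPairing_minkowski]
  have h : curvMat (doubleDualTensor A B) 3 1 = lorentzMat (B 1) (-A 1) := by
    simp [curvMat_doubleDualTensor, doubleDualMat]
  rw [h]
  rfl

theorem curvMat_decomposable (u v p r : Fin 4 → ℝ) (μ ν κ lam : Fin 4) :
    curvMat (decomposable u v p r) μ ν κ lam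
      = minkowski κ κ * u κ * v lam * (p μ * r ν - p ν * r μ) := rfl

theorem ymPairing_doubleDualTensor_scalar (s : ℝ) : ymPairing minkowski
    (doubleDualTensor (fun i j => if i = j then s else 0) 0)
    (decomposable (nullFrame 0) (nullFrame 1) (nullFrame 0) (nullFrame 1)) = -(8 * s) := by
  rw [ymPairing_doubleDualTensor]
  simp only [trace_lorentzMat_mul, curvMat_decomposable]
  simp [nullFrame, minkowski]
  ring

theorem ymPairing_doubleDualTensor_pseudoscalar (s : ℝ) : ymPairing minkowski
    (doubleDualTensor 0 (fun i j => if i = j then s else 0))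
    (decomposable (nullFrame 0) (nullFrame 1) (nullFrame 2) (nullFrame 3)) = -(4 * s) := by
  rw [ymPairing_doubleDualTensor]
  simp only [trace_lorentzMat_mul, curvMat_decomposable]
  simp [nullFrame, minkowski]
  ring

/-- Joint invariance of the polar form in its two arguments moves the eigenvalue of `R` onto the
functional. -/
theorem isSemiInvariant_polar {q : QuadraticForm ℝ CurvatureTensor} (hq : IsLorentzInvariant q)
    {L : Matrix (Fin 4) (Fin 4) ℝ} (hL : IsLorentz L) {χ : ℝ} {R : CurvatureTensor}
    (hR : frameChange L R = χ • R) :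
    IsSemiInvariant (QuadraticMap.polarBilin q R) L χ := by
  refine ⟨hL, fun Q => ?_⟩
  have := hq.polar hL R Q
  rw [hR, QuadraticMap.polar_smul_left, smul_eq_mul] at this
  exact this.symm

/-- If the polar form of every invariant quadratic form at `R` is determined by its value on `D`, then
it is a multiple of the Yang–Mills pairing. -/
theorem exists_polar_eq_of_determined {q : QuadraticForm ℝ CurvatureTensor}
    (hq : IsLorentzInvariant q) {R D : CurvatureTensor} (hD : ymPairing minkowski R D ≠ 0)
    (h : ∀ q' : QuadraticForm ℝ CurvatureTensor, IsLorentzInvariant q' →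
      QuadraticMap.polarBilin q' R D = 0 → QuadraticMap.polarBilin q' R = 0) :
    ∃ c : ℝ, ∀ Q, QuadraticMap.polar q R Q = c * ymPairing minkowski R Q := by
  -- The constant is chosen so that subtracting the Yang–Mills part annihilates the functional on
  -- `D`; it is halved below because the polar form of `ymForm` is twice the pairing.
  set c := QuadraticMap.polar q R D / ymPairing minkowski R D
  refine ⟨c, fun Q => ?_⟩
  set q' : QuadraticForm ℝ CurvatureTensor := q + (-(c / 2)) • ymForm
  have hp : ∀ Q, QuadraticMap.polarBilin q' R Q
      = QuadraticMap.polar q R Q - c * ymPairing minkowski R Q := by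
    intro Q
    have : QuadraticMap.polarBilin q' R Q = QuadraticMap.polar q R Q
        + (-(c / 2)) * QuadraticMap.polar ymForm R Q := by
      simp only [QuadraticMap.polarBilin_apply_apply, QuadraticMap.polar, q', add_apply,
        smul_apply, smul_eq_mul]
      ring
    rw [this, polar_ymForm]
    ring
  have hq' : IsLorentzInvariant q' := by
    intro L hL R
    simp only [q', add_apply, smul_apply, hq L hL,
      isLorentzInvariant_ymForm L hL]
  have h0 := h q' hq' (by
    rw [hp, div_mul_cancel₀ _ hD, sub_self])
  have := hp Q
  rw [h0, LinearMap.zero_apply] at this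
  linarith

theorem lowered_minkowski_injective {R Q : CurvatureTensor}
    (h : lowered minkowski R = lowered minkowski Q) : R = Q := by
  ext κ lam μ ν
  rw [apply_eq_minkowski_mul_lowered R, apply_eq_minkowski_mul_lowered Q, h]

/-- A vanishing star has pseudoscalar form with parameter zero, so the normal form applies with some
`s`. The component 0123 of the tensor is `s`, and it is also a component of the star, hence zero. -/
theorem loweredStar_minkowski_eq_zero {R : CurvatureTensor} (h : loweredStar minkowski R = 0) :
    R = 0 := by
  obtain ⟨s, hs⟩ := inPiece_pseudoscalar_eq
    ⟨0, by rw [h]; ext; simp [scalarTensor]⟩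
  have h2 := (loweredStar_minkowski R 0 1).1
  rw [h, hs] at h2
  have h3 : (doubleDualTensor 0 fun i j => if i = j then s else 0).1 0 1 2 3 = s := by
    change lorentzMat (fun j => if (0 : Fin 3) = j then s else 0) (-0) 0 1 = s
    simp [lorentzMat]
  rw [lowered_minkowski, h3] at h2
  have h4 : s = 0 := by simpa [minkowski] using h2.symm
  rw [hs, h4]
  simp only [ite_self]
  exact doubleDualTensor_zero

theorem IsLorentz.frameChange_scalar {L : Matrix (Fin 4) (Fin 4) ℝ} (hL : IsLorentz L)
    {R : CurvatureTensor} (hR : InPiece minkowski .scalar R) : frameChange L R = R := by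
  obtain ⟨s, hs⟩ := hR
  apply lowered_minkowski_injective
  rw [IsOrthonormalFrame.lowered_eq hL, hs, pullTensor_scalarTensor, hL]

theorem IsLorentz.frameChange_pseudoscalar {L : Matrix (Fin 4) (Fin 4) ℝ} (hL : IsLorentz L)
    {R : CurvatureTensor} (hR : InPiece minkowski .pseudoscalar R) :
    frameChange L R = (L.det⁻¹ * |L.det|) • R := by
  obtain ⟨s, hs⟩ := hR
  rw [← sub_eq_zero]
  apply loweredStar_minkowski_eq_zero
  rw [sub_eq_add_neg, ← neg_one_smul ℝ, loweredStar_add, loweredStar_smul, loweredStar_smul,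
    IsOrthonormalFrame.loweredStar_eq hL, hs, pullTensor_scalarTensor, hL]
  simp

theorem exists_polar_eq_of_scalar {q : QuadraticForm ℝ CurvatureTensor}
    (hq : IsLorentzInvariant q) : ∃ c : ℝ, ∀ R, InPiece minkowski .scalar R →
      ∀ Q, QuadraticMap.polar q R Q = c * ymPairing minkowski R Q := by
  -- On a nonzero element the constant is determined, and the normal form makes every other element
  -- a multiple of it. The case distinction spares exhibiting such an element.
  by_cases hex : ∃ R, InPiece minkowski .scalar R ∧ R ≠ 0
  · obtain ⟨R, hR, hR0⟩ := hex
    have hinv : ∀ L, IsLorentz L → frameChange L R = (1 : ℝ) • R := fun L hL => by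
      rw [hL.frameChange_scalar hR, one_smul]
    obtain ⟨s, hs⟩ := inPiece_scalar_eq hR
    have hs0 : s ≠ 0 := by
      rintro rfl
      apply hR0
      rw [hs]
      simp only [ite_self]
      exact doubleDualTensor_zero
    obtain ⟨c, hc⟩ := exists_polar_eq_of_determined hq (R := R)
      (D := decomposable (nullFrame 0) (nullFrame 1) (nullFrame 0) (nullFrame 1))
      (by rw [hs, ymPairing_doubleDualTensor_scalar]; simpa using hs0)
      (fun q' hq' h0 => eq_zero_of_lorentz_symmetry
        (isSemiInvariant_polar hq' isLorentz_boostMat (hinv _ isLorentz_boostMat))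
        (isSemiInvariant_polar hq' isLorentz_reflX (hinv _ isLorentz_reflX))
        (isSemiInvariant_polar hq' isLorentz_reflY (hinv _ isLorentz_reflY))
        (isSemiInvariant_polar hq' isLorentz_reflZ (hinv _ isLorentz_reflZ))
        (isSemiInvariant_polar hq' isLorentz_swapXY (hinv _ isLorentz_swapXY))
        (isSemiInvariant_polar hq' isLorentz_nullRot (hinv _ isLorentz_nullRot)) h0)
    refine ⟨c, fun R' hR' Q => ?_⟩
    obtain ⟨s', hs'⟩ := inPiece_scalar_eq hR'
    have : R' = (s' / s) • R := by
      rw [hs', hs, ← doubleDualTensor_smul]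
      congr 1
      · ext i j
        simp [div_mul_cancel₀ _ hs0]
      · simp
    rw [this, QuadraticMap.polar_smul_left, ymPairing_smul_left, hc, smul_eq_mul]
    ring
  · push Not at hex
    refine ⟨0, fun R hR Q => ?_⟩
    rw [hex R hR]
    simp

theorem exists_polar_eq_of_pseudoscalar {q : QuadraticForm ℝ CurvatureTensor}
    (hq : IsLorentzInvariant q) : ∃ c : ℝ, ∀ R, InPiece minkowski .pseudoscalar R →
      ∀ Q, QuadraticMap.polar q R Q = c * ymPairing minkowski R Q := by
  by_cases hex : ∃ R, InPiece minkowski .pseudoscalar R ∧ R ≠ 0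
  · obtain ⟨R, hR, hR0⟩ := hex
    -- The element is fixed by matrices of determinant 1 and negated by those of determinant `-1`.
    -- The boost and the null rotation are of the first kind, the reflections and the exchange of
    -- the second.
    have hpos : ∀ L, IsLorentz L → L.det = 1 → frameChange L R = (1 : ℝ) • R := fun L hL h => by
      rw [hL.frameChange_pseudoscalar hR, h]
      simp
    have hneg : ∀ L, IsLorentz L → L.det = -1 → frameChange L R = (-1 : ℝ) • R := fun L hL h => by
      rw [hL.frameChange_pseudoscalar hR, h]
      norm_num
    obtain ⟨s, hs⟩ := inPiece_pseudoscalar_eq hR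
    have hs0 : s ≠ 0 := by
      rintro rfl
      apply hR0
      rw [hs]
      simp only [ite_self]
      exact doubleDualTensor_zero
    obtain ⟨c, hc⟩ := exists_polar_eq_of_determined hq (R := R)
      (D := decomposable (nullFrame 0) (nullFrame 1) (nullFrame 2) (nullFrame 3))
      (by rw [hs, ymPairing_doubleDualTensor_pseudoscalar]; simpa using hs0)
      (fun q' hq' h0 => eq_zero_of_pseudo_lorentz_symmetry
        (isSemiInvariant_polar hq' isLorentz_boostMat (hpos _ isLorentz_boostMat
          (by rw [det_fin_four]; simp [boostMat]; norm_num)))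
        (isSemiInvariant_polar hq' isLorentz_reflX (hneg _ isLorentz_reflX
          (by rw [det_fin_four]; simp [reflX])))
        (isSemiInvariant_polar hq' isLorentz_reflY (hneg _ isLorentz_reflY
          (by rw [det_fin_four]; simp [reflY])))
        (isSemiInvariant_polar hq' isLorentz_reflZ (hneg _ isLorentz_reflZ
          (by rw [det_fin_four]; simp [reflZ])))
        (isSemiInvariant_polar hq' isLorentz_swapXY (hneg _ isLorentz_swapXY
          (by rw [det_fin_four]; simp [swapXY])))
        (isSemiInvariant_polar hq' isLorentz_nullRot (hpos _ isLorentz_nullRot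
          (by rw [det_fin_four]; simp [nullRot]; norm_num))) h0)
    refine ⟨c, fun R' hR' Q => ?_⟩
    obtain ⟨s', hs'⟩ := inPiece_pseudoscalar_eq hR'
    have : R' = (s' / s) • R := by
      rw [hs', hs, ← doubleDualTensor_smul]
      congr 1
      · simp
      · ext i j
        simp [div_mul_cancel₀ _ hs0]
    rw [this, QuadraticMap.polar_smul_left, ymPairing_smul_left, hc, smul_eq_mul]
    ring
  · push Not at hex
    refine ⟨0, fun R hR Q => ?_⟩
    rw [hex R hR]
    simp

end Invariants

/-! ### Plane waves and their symmetries. -/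

section Invariants

/-- The curvature tensor with lowered components `(u ∧ v) ⊗ (u ∧ v)`. -/
def wedgeSq (u v : Fin 4 → ℝ) : CurvatureTensor := decomposable u v u v - decomposable v u u v

/-- For a null covector `l` and an orthonormal pair `x, y` orthogonal to it, this is the Weyl tensor
of a plane wave. -/
def weylWave (l x y : Fin 4 → ℝ) : CurvatureTensor := wedgeSq l x - wedgeSq l y

theorem curvMat_weylWave (l x y : Fin 4 → ℝ) (μ ν κ lam : Fin 4) :
    curvMat (weylWave l x y) μ ν κ lam = minkowski κ κ *
      ((l κ * x lam - x κ * l lam) * (l μ * x ν - l ν * x μ)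
      - (l κ * y lam - y κ * l lam) * (l μ * y ν - l ν * y μ)) := by
  change minkowski κ κ * l κ * x lam * (l μ * x ν - l ν * x μ)
    - minkowski κ κ * x κ * l lam * (l μ * x ν - l ν * x μ)
    - (minkowski κ κ * l κ * y lam * (l μ * y ν - l ν * y μ)
    - minkowski κ κ * y κ * l lam * (l μ * y ν - l ν * y μ)) = _
  ring

theorem weylWave_ext {l x y l' x' y' : Fin 4 → ℝ} {c : ℝ}
    (h : ∀ μ ν κ lam, (l κ * x lam - x κ * l lam) * (l μ * x ν - l ν * x μ)
      - (l κ * y lam - y κ * l lam) * (l μ * y ν - l ν * y μ) =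
      c * ((l' κ * x' lam - x' κ * l' lam) * (l' μ * x' ν - l' ν * x' μ)
      - (l' κ * y' lam - y' κ * l' lam) * (l' μ * y' ν - l' ν * y' μ))) :
    weylWave l x y = c • weylWave l' x' y' := by
  apply curvMat_ext
  intro μ ν
  ext κ lam
  rw [curvMat_smul, Matrix.smul_apply, curvMat_weylWave, curvMat_weylWave, h, smul_eq_mul]
  ring

theorem frameChange_weylWave {L : Matrix (Fin 4) (Fin 4) ℝ} (hL : IsLorentz L)
    (l x y : Fin 4 → ℝ) :
    frameChange L (weylWave l x y) = weylWave (l ᵥ* L) (x ᵥ* L) (y ᵥ* L) := by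
  simp only [weylWave, wedgeSq, map_sub, frameChange_decomposable hL]

/-- The standard plane wave. -/
def stdWave : CurvatureTensor := weylWave (nullFrame 0) (nullFrame 2) (nullFrame 3)

/-- Adding multiples of `l` to `x` or `y` changes neither `l ∧ x` nor `l ∧ y`, and the signs of `x`
and `y` enter squared. Only the scale of `l` remains, also squared. -/
theorem stdWave_symmetry {L : Matrix (Fin 4) (Fin 4) ℝ} (hL : IsLorentz L) {a b c d e : ℝ}
    (h0 : nullFrame 0 ᵥ* L = a • nullFrame 0)
    (h2 : nullFrame 2 ᵥ* L = b • nullFrame 2 + d • nullFrame 0)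
    (h3 : nullFrame 3 ᵥ* L = c • nullFrame 3 + e • nullFrame 0) (hb : b ^ 2 = 1) (hc : c ^ 2 = 1) :
    frameChange L stdWave = a ^ 2 • stdWave := by
  rw [stdWave, frameChange_weylWave hL, h0, h2, h3]
  apply weylWave_ext
  intro μ ν κ lam
  simp only [Pi.add_apply, Pi.smul_apply, smul_eq_mul]
  linear_combination (a ^ 2 * ((nullFrame 0 κ * nullFrame 2 lam - nullFrame 2 κ * nullFrame 0 lam)
    * (nullFrame 0 μ * nullFrame 2 ν - nullFrame 0 ν * nullFrame 2 μ))) * hb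
    - (a ^ 2 * ((nullFrame 0 κ * nullFrame 3 lam - nullFrame 3 κ * nullFrame 0 lam)
    * (nullFrame 0 μ * nullFrame 3 ν - nullFrame 0 ν * nullFrame 3 μ))) * hc

theorem stdWave_swapXY : frameChange swapXY stdWave = (-1 : ℝ) • stdWave := by
  have h0 : nullFrame 0 ᵥ* swapXY = nullFrame 0 := by
    ext a
    fin_cases a <;> simp [swapXY, nullFrame, Matrix.vecMul, dotProduct, Fin.sum_univ_four]
  have h2 : nullFrame 2 ᵥ* swapXY = nullFrame 3 := by
    ext a
    fin_cases a <;> simp [swapXY, nullFrame, Matrix.vecMul, dotProduct, Fin.sum_univ_four]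
  have h3 : nullFrame 3 ᵥ* swapXY = nullFrame 2 := by
    ext a
    fin_cases a <;> simp [swapXY, nullFrame, Matrix.vecMul, dotProduct, Fin.sum_univ_four]
  rw [stdWave, frameChange_weylWave isLorentz_swapXY, h0, h2, h3]
  apply weylWave_ext
  intro μ ν κ lam
  ring

theorem ymPairing_stdWave : ymPairing minkowski stdWave
    (decomposable (nullFrame 1) (nullFrame 2) (nullFrame 1) (nullFrame 2)) ≠ 0 := by
  rw [ymPairing_minkowski]
  simp only [Matrix.trace, Matrix.diag_apply, Matrix.mul_apply, Fin.sum_univ_four, stdWave,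
    curvMat_weylWave, curvMat_decomposable]
  simp [nullFrame, minkowski]

/-- The wave is an eigenvector of the boost, the reflections, the exchange and the null rotation,
and its pairing with one decomposable tensor is nonzero. By `eq_zero_of_weyl_symmetry` this
determines the polar form up to a factor. -/
theorem exists_polar_stdWave_eq {q : QuadraticForm ℝ CurvatureTensor}
    (hq : IsLorentzInvariant q) :
    ∃ c : ℝ, ∀ Q, QuadraticMap.polar q stdWave Q = c * ymPairing minkowski stdWave Q := by
  refine exists_polar_eq_of_determined hq ymPairing_stdWave fun q' hq' h0 =>
    eq_zero_of_weyl_symmetry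
      (isSemiInvariant_polar hq' isLorentz_boostMat ?_)
      (isSemiInvariant_polar hq' isLorentz_reflX ?_)
      (isSemiInvariant_polar hq' isLorentz_reflY ?_)
      (isSemiInvariant_polar hq' isLorentz_swapXY stdWave_swapXY)
      (isSemiInvariant_polar hq' isLorentz_nullRot ?_) h0
  · rw [show (4 : ℝ) = 2 ^ 2 by norm_num]
    refine stdWave_symmetry (b := 1) (c := 1) (d := 0) (e := 0) isLorentz_boostMat ?_ ?_ ?_
      (by norm_num) (by norm_num) <;>
    · ext a
      fin_cases a <;>
        simp [boostMat, nullFrame, Matrix.vecMul, dotProduct, Fin.sum_univ_four] <;> norm_num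
  · rw [show (1 : ℝ) = 1 ^ 2 by norm_num]
    refine stdWave_symmetry (b := (-1)) (c := 1) (d := 0) (e := 0) isLorentz_reflX ?_ ?_ ?_
      (by norm_num) (by norm_num) <;>
    · ext a
      fin_cases a <;>
        simp [reflX, nullFrame, Matrix.vecMul, dotProduct, Fin.sum_univ_four]
  · rw [show (1 : ℝ) = 1 ^ 2 by norm_num]
    refine stdWave_symmetry (b := 1) (c := (-1)) (d := 0) (e := 0) isLorentz_reflY ?_ ?_ ?_
      (by norm_num) (by norm_num) <;>
    · ext a
      fin_cases a <;>
        simp [reflY, nullFrame, Matrix.vecMul, dotProduct, Fin.sum_univ_four]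
  · rw [show (1 : ℝ) = 1 ^ 2 by norm_num]
    refine stdWave_symmetry (b := 1) (c := 1) (d := 1) (e := 0) isLorentz_nullRot ?_ ?_ ?_
      (by norm_num) (by norm_num) <;>
    · ext a
      fin_cases a <;>
        simp [nullRot, nullFrame, Matrix.vecMul, dotProduct, Fin.sum_univ_four] <;> norm_num

theorem frameChange_stdWave {z x y : Fin 3 → ℝ}
    (hL : IsLorentz !![1, 0, 0, 0; 0, z 0, z 1, z 2; 0, x 0, x 1, x 2; 0, y 0, y 1, y 2]) :
    frameChange !![1, 0, 0, 0; 0, z 0, z 1, z 2; 0, x 0, x 1, x 2; 0, y 0, y 1, y 2] stdWave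
      = weylWave ![1, z 0, z 1, z 2] ![0, x 0, x 1, x 2] ![0, y 0, y 1, y 2] := by
  rw [stdWave, frameChange_weylWave hL]
  congr 1 <;>
  · ext a
    fin_cases a <;> simp [nullFrame, Matrix.vecMul, dotProduct, Fin.sum_univ_four]

theorem isLorentz_of_orthonormal {z x y : Fin 3 → ℝ}
    (hzz : z 0 ^ 2 + z 1 ^ 2 + z 2 ^ 2 = 1) (hxx : x 0 ^ 2 + x 1 ^ 2 + x 2 ^ 2 = 1)
    (hyy : y 0 ^ 2 + y 1 ^ 2 + y 2 ^ 2 = 1) (hzx : z 0 * x 0 + z 1 * x 1 + z 2 * x 2 = 0)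
    (hzy : z 0 * y 0 + z 1 * y 1 + z 2 * y 2 = 0) (hxy : x 0 * y 0 + x 1 * y 1 + x 2 * y 2 = 0) :
    IsLorentz !![1, 0, 0, 0; 0, z 0, z 1, z 2; 0, x 0, x 1, x 2; 0, y 0, y 1, y 2] := by
  apply IsLorentz.of_mul_minkowski_mul_transpose
  rw [minkowski_eq_of]
  ext i j
  fin_cases i <;> fin_cases j <;>
    simp [Matrix.mul_apply, Fin.sum_univ_four, Matrix.transpose_apply] <;> linarith

/-- A plane wave with spatial direction `z = ±(x × y)`. -/
theorem weylWave_eq_doubleDualTensor {z x y : Fin 3 → ℝ} {ε : ℝ} (hε : ε ^ 2 = 1)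
    (hzx0 : z 1 * x 2 - z 2 * x 1 = ε * y 0) (hzx1 : z 2 * x 0 - z 0 * x 2 = ε * y 1)
    (hzx2 : z 0 * x 1 - z 1 * x 0 = ε * y 2) (hzy0 : z 1 * y 2 - z 2 * y 1 = -ε * x 0)
    (hzy1 : z 2 * y 0 - z 0 * y 2 = -ε * x 1) (hzy2 : z 0 * y 1 - z 1 * y 0 = -ε * x 2) :
    weylWave ![1, z 0, z 1, z 2] ![0, x 0, x 1, x 2] ![0, y 0, y 1, y 2]
      = doubleDualTensor (fun i j => x i * x j - y i * y j)
        (fun i j => ε * (x i * y j + y i * x j)) := by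
  have hx : ∀ a b, ![1, z 0, z 1, z 2] a * ![0, x 0, x 1, x 2] b
      - ![0, x 0, x 1, x 2] a * ![1, z 0, z 1, z 2] b
      = (!![0, x 0, x 1, x 2; -x 0, 0, ε * y 2, -(ε * y 1); -x 1, -(ε * y 2), 0, ε * y 0;
        -x 2, ε * y 1, -(ε * y 0), 0] : Matrix (Fin 4) (Fin 4) ℝ) a b := by
    intro a b
    fin_cases a <;> fin_cases b <;> simp <;> linarith
  have hy : ∀ a b, ![1, z 0, z 1, z 2] a * ![0, y 0, y 1, y 2] b
      - ![0, y 0, y 1, y 2] a * ![1, z 0, z 1, z 2] b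
      = (!![0, y 0, y 1, y 2; -y 0, 0, -(ε * x 2), ε * x 1; -y 1, ε * x 2, 0, -(ε * x 0);
        -y 2, -(ε * x 1), ε * x 0, 0] : Matrix (Fin 4) (Fin 4) ℝ) a b := by
    intro a b
    fin_cases a <;> fin_cases b <;> simp <;> linarith
  have hx' : ∀ a b, ![1, z 0, z 1, z 2] a * ![0, x 0, x 1, x 2] b
      - ![1, z 0, z 1, z 2] b * ![0, x 0, x 1, x 2] a
      = (!![0, x 0, x 1, x 2; -x 0, 0, ε * y 2, -(ε * y 1); -x 1, -(ε * y 2), 0, ε * y 0;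
        -x 2, ε * y 1, -(ε * y 0), 0] : Matrix (Fin 4) (Fin 4) ℝ) a b := by
    intro a b
    rw [← hx]
    ring
  have hy' : ∀ a b, ![1, z 0, z 1, z 2] a * ![0, y 0, y 1, y 2] b
      - ![1, z 0, z 1, z 2] b * ![0, y 0, y 1, y 2] a
      = (!![0, y 0, y 1, y 2; -y 0, 0, -(ε * x 2), ε * x 1; -y 1, ε * x 2, 0, -(ε * x 0);
        -y 2, -(ε * x 1), ε * x 0, 0] : Matrix (Fin 4) (Fin 4) ℝ) a b := by
    intro a b
    rw [← hy]
    ring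
  apply eq_doubleDualTensor <;>
  · ext κ lam
    rw [curvMat_weylWave, hx, hx', hy, hy']
    fin_cases κ <;> fin_cases lam <;> simp [lorentzMat, minkowski] <;> ring_nf <;>
      simp only [hε] <;> ring

end Invariants

/-! ### Plane waves span the Weyl piece. -/

section Invariants

/-- The diagonal trace-free matrix with zero at `i`, one at `i + 1`. -/
def diagDiff (i : Fin 3) : Fin 3 → Fin 3 → ℝ := fun j k =>
  if j = k then (if j = i + 1 then 1 else if j = i + 2 then -1 else 0) else 0

/-- The symmetric matrix with ones at `(i + 1, i + 2)` and `(i + 2, i + 1)`. -/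
def offDiag (i : Fin 3) : Fin 3 → Fin 3 → ℝ := fun j k =>
  if (j = i + 1 ∧ k = i + 2) ∨ (j = i + 2 ∧ k = i + 1) then 1 else 0

/-- A spatial orthogonal map carries the standard wave to one travelling along `ε` times the `i`-th
axis, with polarisation axes turned by the angle of cosine `c` and sine `s`. Both signs of `ε` occur
because improper maps are allowed. -/
theorem doubleDualTensor_mem_of_stdWave {U : Submodule ℝ CurvatureTensor}
    (hU : ∀ L, IsLorentz L → ∀ R ∈ U, frameChange L R ∈ U) (h0 : stdWave ∈ U) {ε c s : ℝ}
    (hε : ε ^ 2 = 1) (hcs : c ^ 2 + s ^ 2 = 1) (i : Fin 3) :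
    doubleDualTensor ((c ^ 2 - s ^ 2) • diagDiff i + (2 * c * s) • offDiag i)
      (ε • ((-2 * c * s) • diagDiff i + (c ^ 2 - s ^ 2) • offDiag i)) ∈ U := by
  obtain ⟨z, hz⟩ : ∃ z : Fin 3 → ℝ, z = fun j => if j = i then ε else 0 := ⟨_, rfl⟩
  obtain ⟨x, hx⟩ : ∃ x : Fin 3 → ℝ,
    x = fun j => if j = i + 1 then c else if j = i + 2 then s else 0 := ⟨_, rfl⟩
  obtain ⟨y, hy⟩ : ∃ y : Fin 3 → ℝ,
    y = fun j => if j = i + 1 then -s else if j = i + 2 then c else 0 := ⟨_, rfl⟩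
  have hL : IsLorentz
      !![1, 0, 0, 0; 0, z 0, z 1, z 2; 0, x 0, x 1, x 2; 0, y 0, y 1, y 2] := by
    apply isLorentz_of_orthonormal <;> simp only [hz, hx, hy] <;> fin_cases i <;>
      simp <;> first | linarith | simpa using hε
  have h1 := hU _ hL _ h0
  rw [frameChange_stdWave hL, weylWave_eq_doubleDualTensor hε] at h1
  · convert h1 using 2
    · ext j k
      rw [hx, hy]
      fin_cases i <;> fin_cases j <;> fin_cases k <;> simp [diagDiff, offDiag, -mul_eq_mul_left_iff] <;> ring
    · ext j k
      rw [hx, hy]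
      fin_cases i <;> fin_cases j <;> fin_cases k <;> simp [diagDiff, offDiag, -mul_eq_mul_left_iff] <;> ring
  all_goals
    simp only [hz, hx, hy]
    fin_cases i <;> simp

/-- The Lorentz images of one wave span the Weyl piece; this is the only form of irreducibility
needed. Waves with the same polarisation axes and opposite directions have equal electric and
opposite magnetic parts, so half sums and half differences separate the two. A second polarisation
angle separates diagonal from off-diagonal entries. -/
theorem doubleDualTensor_mem {U : Submodule ℝ CurvatureTensor}
    (hU : ∀ L, IsLorentz L → ∀ R ∈ U, frameChange L R ∈ U) (h0 : stdWave ∈ U)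
    {A B : Fin 3 → Fin 3 → ℝ} (hA : ∀ i j, A i j = A j i) (hA0 : A 0 0 + A 1 1 + A 2 2 = 0)
    (hB : ∀ i j, B i j = B j i) (hB0 : B 0 0 + B 1 1 + B 2 2 = 0) :
    doubleDualTensor A B ∈ U := by
  have hcomb : ∀ {A B A' B' : Fin 3 → Fin 3 → ℝ} (a b : ℝ), doubleDualTensor A B ∈ U →
      doubleDualTensor A' B' ∈ U → doubleDualTensor (a • A + b • A') (a • B + b • B') ∈ U := by
    intro A B A' B' a b h h'
    rw [doubleDualTensor_add, doubleDualTensor_smul, doubleDualTensor_smul]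
    exact U.add_mem (U.smul_mem _ h) (U.smul_mem _ h')
  have hD : ∀ i, doubleDualTensor (diagDiff i) 0 ∈ U := by
    intro i
    have h1 := doubleDualTensor_mem_of_stdWave hU h0 (ε := 1) (c := 1) (s := 0) (by norm_num)
      (by norm_num) i
    have h2 := doubleDualTensor_mem_of_stdWave hU h0 (ε := -1) (c := 1) (s := 0) (by norm_num)
      (by norm_num) i
    convert hcomb (1 / 2) (1 / 2) h1 h2 using 2 <;> ext j k <;> simp <;> ring
  have hO : ∀ i, doubleDualTensor 0 (offDiag i) ∈ U := by
    intro i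
    have h1 := doubleDualTensor_mem_of_stdWave hU h0 (ε := 1) (c := 1) (s := 0) (by norm_num)
      (by norm_num) i
    convert hcomb 1 (-1) h1 (hD i) using 2 <;> ext j k <;> simp
  have hO' : ∀ i, doubleDualTensor (offDiag i) 0 ∈ U := by
    intro i
    -- At this rational angle `c² - s² = -7/25` and `2cs = 24/25`, whence the coefficients 25/24 and
    -- 7/24 used to eliminate the diagonal part.
    have h1 := doubleDualTensor_mem_of_stdWave hU h0 (ε := 1) (c := 3 / 5) (s := 4 / 5)
      (by norm_num) (by norm_num) i
    have h2 := doubleDualTensor_mem_of_stdWave hU h0 (ε := -1) (c := 3 / 5) (s := 4 / 5)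
      (by norm_num) (by norm_num) i
    have h3 := hcomb (1 / 2) (1 / 2) h1 h2
    convert hcomb (25 / 24) (7 / 24) h3 (hD i) using 2 <;> ext j k <;> simp <;> ring
  have hD' : ∀ i, doubleDualTensor 0 (diagDiff i) ∈ U := by
    intro i
    have h1 := doubleDualTensor_mem_of_stdWave hU h0 (ε := 1) (c := 3 / 5) (s := 4 / 5)
      (by norm_num) (by norm_num) i
    have h2 := doubleDualTensor_mem_of_stdWave hU h0 (ε := -1) (c := 3 / 5) (s := 4 / 5)
      (by norm_num) (by norm_num) i
    have h3 := hcomb (1 / 2) (-1 / 2) h1 h2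
    convert hcomb (-25 / 24) (-7 / 24) h3 (hO i) using 2 <;> ext j k <;> simp <;> ring
  have hsum : ∀ {A : Fin 3 → Fin 3 → ℝ}, (∀ i j, A i j = A j i) → A 0 0 + A 1 1 + A 2 2 = 0 →
      A = (1 : ℝ) • ((1 : ℝ) • ((1 : ℝ) • (A 0 0 • diagDiff 2 + (-A 2 2) • diagDiff 0)
        + A 1 2 • offDiag 0) + A 2 0 • offDiag 1) + A 0 1 • offDiag 2 := by
    intro A hA hA0
    have h1 := hA 2 1
    have h2 := hA 0 2
    have h3 := hA 1 0
    ext j k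
    fin_cases j <;> fin_cases k <;> simp [diagDiff, offDiag] <;> linarith
  have hA1 : doubleDualTensor A 0 ∈ U := by
    rw [hsum hA hA0]
    have := hcomb 1 (A 0 1) (hcomb 1 (A 2 0) (hcomb 1 (A 1 2) (hcomb (A 0 0) (-A 2 2) (hD 2) (hD 0))
      (hO' 0)) (hO' 1)) (hO' 2)
    simpa only [smul_zero, add_zero] using this
  have hB1 : doubleDualTensor 0 B ∈ U := by
    rw [hsum hB hB0]
    have := hcomb 1 (B 0 1) (hcomb 1 (B 2 0) (hcomb 1 (B 1 2) (hcomb (B 0 0) (-B 2 2) (hD' 2)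
      (hD' 0)) (hO 0)) (hO 1)) (hO 2)
    simpa only [smul_zero, add_zero] using this
  have := U.add_mem hA1 hB1
  rwa [← doubleDualTensor_add, add_zero, zero_add] at this

theorem exists_polar_eq_of_weyl {q : QuadraticForm ℝ CurvatureTensor}
    (hq : IsLorentzInvariant q) : ∃ c : ℝ, ∀ R, InPiece minkowski .weyl R →
      ∀ Q, QuadraticMap.polar q R Q = c * ymPairing minkowski R Q := by
  obtain ⟨c, hc⟩ := exists_polar_stdWave_eq hq
  refine ⟨c, fun R hR => ?_⟩
  -- The tensors satisfying the asserted proportionality with this `c` form a subspace. It is stable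
  -- under the Lorentz group because both forms are invariant, and it contains `stdWave`, hence the
  -- whole Weyl piece.
  let U : Submodule ℝ CurvatureTensor :=
    { carrier := {R | ∀ Q, QuadraticMap.polar q R Q = c * ymPairing minkowski R Q}
      add_mem' := fun {R R'} h h' Q => by
        rw [QuadraticMap.polar_add_left, h, h', ymPairing_add_left, mul_add]
      zero_mem' := fun Q => by
        have := ymPairing_smul_left minkowski 0 0 Q
        rw [zero_smul, zero_mul] at this
        rw [this, QuadraticMap.polar_zero_left, mul_zero]
      smul_mem' := fun s R h Q => by
        rw [QuadraticMap.polar_smul_left, h, ymPairing_smul_left, smul_eq_mul]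
        ring }
  have hU : ∀ L, IsLorentz L → ∀ R ∈ U, frameChange L R ∈ U := by
    intro L hL R hR Q
    have hQ : Q = frameChange L (frameChange L⁻¹ Q) := by
      rw [← frameChange_mul, Matrix.nonsing_inv_mul _ hL.isUnit_det]
      ext a b c d
      simp [frameChange, Matrix.one_apply]
    rw [hQ, hq.polar hL, ymPairing_frameChange hL]
    exact hR _
  obtain ⟨A, B, hA, hA0, hB, hB0, rfl⟩ := inPiece_weyl_eq hR
  exact doubleDualTensor_mem hU hc hA hA0 hB hB0

end Invariants

/-! ### Isomorphisms between pieces; which pieces can be simple. -/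

section Pieces

theorem pullTensor_add (P : Matrix (Fin 4) (Fin 4) ℝ) (T U : Fin 4 → Fin 4 → Fin 4 → Fin 4 → ℝ) :
    pullTensor P (T + U) = pullTensor P T + pullTensor P U := by
  ext a b c d
  simp only [pullTensor, Pi.add_apply, mul_add, Finset.sum_add_distrib]

theorem pullTensor_smul (P : Matrix (Fin 4) (Fin 4) ℝ) (s : ℝ)
    (T : Fin 4 → Fin 4 → Fin 4 → Fin 4 → ℝ) :
    pullTensor P (s • T) = s • pullTensor P T := by
  ext a b c d
  simp only [pullTensor, Pi.smul_apply, smul_eq_mul, mul_left_comm _ s, ← Finset.mul_sum]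

theorem pullTensor_swap (P : Matrix (Fin 4) (Fin 4) ℝ) (T : Fin 4 → Fin 4 → Fin 4 → Fin 4 → ℝ) :
    pullTensor P (fun κ lam μ ν => T lam κ μ ν) = fun a b c d => pullTensor P T b a c d := by
  have h : ∀ (a b : Fin 4) (X : Fin 4 → Fin 4 → ℝ), ∑ κ, P κ a * ∑ lam, P lam b * X lam κ
      = ∑ κ, P κ b * ∑ lam, P lam a * X κ lam := by
    intro a b X
    simp only [Finset.mul_sum]
    rw [Finset.sum_comm]
    refine Finset.sum_congr rfl fun _ _ => Finset.sum_congr rfl fun _ _ => ?_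
    ring
  ext a b c d
  exact h a b fun κ lam => ∑ μ, P μ c * ∑ ν, P ν d * T κ lam μ ν

theorem transpose_mul_mul_apply (P X : Matrix (Fin 4) (Fin 4) ℝ) (a c : Fin 4) :
    (Pᵀ * X * P) a c = ∑ κ, P κ a * (X κ ᵥ* P) c := by
  rw [Matrix.mul_assoc, Matrix.mul_apply]
  rfl

theorem pullTensor_mul (P X Y : Matrix (Fin 4) (Fin 4) ℝ) :
    pullTensor P (fun κ lam μ ν => X κ μ * Y lam ν)
      = fun a b c d => (Pᵀ * X * P) a c * (Pᵀ * Y * P) b d := by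
  ext a b c d
  have h : ∀ κ lam, Matrix.of (fun μ ν => X κ μ * Y lam ν) = Matrix.vecMulVec (X κ) (Y lam) :=
    fun _ _ => rfl
  rw [pullTensor_eq]
  simp only [h, Matrix.mul_vecMulVec, Matrix.vecMulVec_mul, Matrix.vecMulVec_apply,
    Matrix.mulVec_transpose, transpose_mul_mul_apply P X, transpose_mul_mul_apply P Y]
  rw [Finset.sum_mul_sum]
  simp only [Finset.mul_sum]
  refine Finset.sum_congr rfl fun _ _ => Finset.sum_congr rfl fun _ _ => ?_
  ring

theorem pullTensor_mul_swap (P X Y : Matrix (Fin 4) (Fin 4) ℝ) :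
    pullTensor P (fun κ lam μ ν => X κ ν * Y lam μ)
      = fun a b c d => (Pᵀ * X * P) a d * (Pᵀ * Y * P) b c := by
  ext a b c d
  have h : ∀ κ lam, Matrix.of (fun μ ν => X κ ν * Y lam μ) = Matrix.vecMulVec (Y lam) (X κ) := by
    intro κ lam
    ext μ ν
    rw [Matrix.vecMulVec_apply, Matrix.of_apply, mul_comm]
  rw [pullTensor_eq]
  simp only [h, Matrix.mul_vecMulVec, Matrix.vecMulVec_mul, Matrix.vecMulVec_apply,
    Matrix.mulVec_transpose, transpose_mul_mul_apply P X, transpose_mul_mul_apply P Y]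
  rw [Finset.sum_mul_sum]
  simp only [Finset.mul_sum]
  refine Finset.sum_congr rfl fun _ _ => Finset.sum_congr rfl fun _ _ => ?_
  ring

theorem pullTensor_mul_outer (P X Y : Matrix (Fin 4) (Fin 4) ℝ) :
    pullTensor P (fun κ lam μ ν => X κ lam * Y μ ν)
      = fun a b c d => (Pᵀ * X * P) a b * (Pᵀ * Y * P) c d := by
  ext a b c d
  have h : ∀ κ lam, Matrix.of (fun μ ν => X κ lam * Y μ ν) = X κ lam • Y := fun _ _ => rfl
  rw [pullTensor_eq]
  simp only [h, Matrix.mul_smul, Matrix.smul_mul, Matrix.smul_apply, smul_eq_mul,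
    ← sum_mul_sum_mul P X, Finset.sum_mul, Finset.mul_sum]
  refine Finset.sum_congr rfl fun _ _ => Finset.sum_congr rfl fun _ _ => ?_
  ring

theorem pullTensor_rankTwoTensor (P g : Matrix (Fin 4) (Fin 4) ℝ) (a b c : ℝ)
    (A : Matrix (Fin 4) (Fin 4) ℝ) :
    pullTensor P (rankTwoTensor g a b c A) = rankTwoTensor (Pᵀ * g * P) a b c (Pᵀ * A * P) := by
  have h : ∀ g A : Matrix (Fin 4) (Fin 4) ℝ, rankTwoTensor g a b c A =
      a • (fun κ lam μ ν => g κ μ * A lam ν) + (-a) • (fun κ lam μ ν => g κ ν * A lam μ)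
      + b • (fun κ lam μ ν => A κ ν * g lam μ) + (-b) • (fun κ lam μ ν => A κ μ * g lam ν)
      + c • (fun κ lam μ ν => g κ lam * A μ ν) := by
    intro g A
    ext κ lam μ ν
    simp only [rankTwoTensor, Pi.add_apply, Pi.smul_apply, smul_eq_mul]
    ring
  rw [h g A]
  simp only [pullTensor_add, pullTensor_smul]
  rw [pullTensor_mul, pullTensor_mul, pullTensor_mul_swap, pullTensor_mul_swap,
    pullTensor_mul_outer, h]

/-- Exchange of the first two indices, at the Minkowski metric. -/
def swapTensor : CurvatureTensor →ₗ[ℝ] CurvatureTensor where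
  toFun R := ⟨fun κ lam μ ν => minkowski κ κ * (minkowski lam lam * R.1 lam κ μ ν), by
    intro κ lam μ ν
    have := R.2 lam κ μ ν
    simp only [this]
    ring⟩
  map_add' R Q := by
    ext
    simp [mul_add]
  map_smul' s R := by
    ext
    simp only [Submodule.coe_smul, Pi.smul_apply, smul_eq_mul, RingHom.id_apply]
    ring

theorem minkowski_diag_mul_self (κ : Fin 4) : minkowski κ κ * minkowski κ κ = 1 := by
  rw [minkowski, Matrix.diagonal_apply_eq]
  fin_cases κ <;> simp

theorem lowered_swapTensor (R : CurvatureTensor) :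
    lowered minkowski (swapTensor R) = fun κ lam μ ν => lowered minkowski R lam κ μ ν := by
  ext κ lam μ ν
  rw [lowered_minkowski, lowered_minkowski]
  change minkowski κ κ * (minkowski κ κ * (minkowski lam lam * R.1 lam κ μ ν)) = _
  rw [← mul_assoc, minkowski_diag_mul_self, one_mul]

theorem loweredStar_swapTensor (R : CurvatureTensor) :
    loweredStar minkowski (swapTensor R) = fun κ lam μ ν => loweredStar minkowski R lam κ μ ν := by
  ext κ lam μ ν
  simp only [loweredStar, lowered_swapTensor]

theorem swapTensor_swapTensor (R : CurvatureTensor) : swapTensor (swapTensor R) = R := by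
  apply lowered_minkowski_injective
  rw [lowered_swapTensor, lowered_swapTensor]

theorem frameChange_swapTensor {L : Matrix (Fin 4) (Fin 4) ℝ} (hL : IsLorentz L)
    (R : CurvatureTensor) : frameChange L (swapTensor R) = swapTensor (frameChange L R) := by
  apply lowered_minkowski_injective
  rw [lowered_swapTensor, IsOrthonormalFrame.lowered_eq hL, IsOrthonormalFrame.lowered_eq hL,
    lowered_swapTensor, pullTensor_swap]

/-- The maps live on the whole space of curvature tensors and need to be mutually inverse and
equivariant only on the two pieces, which avoids constructing maps between subspaces. -/
theorem PiecesIsomorphic.of_maps {i j : PieceLabel} (Φ Ψ : CurvatureTensor →ₗ[ℝ] CurvatureTensor)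
    (h1 : ∀ R, InPiece minkowski i R → InPiece minkowski j (Φ R))
    (h2 : ∀ R, InPiece minkowski j R → InPiece minkowski i (Ψ R))
    (h3 : ∀ R, InPiece minkowski i R → Ψ (Φ R) = R)
    (h4 : ∀ R, InPiece minkowski j R → Φ (Ψ R) = R)
    (h5 : ∀ L, IsLorentz L → ∀ R, InPiece minkowski i R →
      Φ (frameChange L R) = frameChange L (Φ R)) : PiecesIsomorphic i j := by
  refine ⟨LinearEquiv.ofLinearMap (Φ.restrict h1) (Ψ.restrict h2) ?_ ?_, ?_⟩
  · ext1 R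
    exact Subtype.ext (h4 R.1 R.2)
  · ext1 R
    exact Subtype.ext (h3 R.1 R.2)
  · intro L hL R R' h
    change Φ R'.1 = frameChange L (Φ R.1)
    rw [h, h5 L hL _ R.2]

theorem rankTwoTensor_swap (g : Matrix (Fin 4) (Fin 4) ℝ) (hg : gᵀ = g) (a b c : ℝ)
    (A : Matrix (Fin 4) (Fin 4) ℝ) :
    (fun κ lam μ ν => rankTwoTensor g a b c A lam κ μ ν) = rankTwoTensor g b a c A := by
  ext κ lam μ ν
  simp only [rankTwoTensor]
  rw [← hg, Matrix.transpose_apply g lam κ, hg]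
  ring

/-- Exchanging the first two indices is an equivariant involution. On the tensors built from a
matrix it interchanges the coefficients `a` and `b`, which matches the first two six-dimensional
pieces and both pairs of nine-dimensional ones. -/
theorem piecesIsomorphic_of_swap {i j : PieceLabel}
    (h1 : ∀ R, InPiece minkowski i R → InPiece minkowski j (swapTensor R))
    (h2 : ∀ R, InPiece minkowski j R → InPiece minkowski i (swapTensor R)) :
    PiecesIsomorphic i j :=
  PiecesIsomorphic.of_maps swapTensor swapTensor h1 h2 (fun R _ => swapTensor_swapTensor R)
    (fun R _ => swapTensor_swapTensor R) fun _ hL R _ => (frameChange_swapTensor hL R).symm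

theorem inPiece_six_swapTensor {l l' : Fin 3} (h0 : coeffSix l 0 = coeffSix l' 1)
    (h1 : coeffSix l 1 = coeffSix l' 0) (h2 : coeffSix l 2 = coeffSix l' 2) {R : CurvatureTensor}
    (hR : InPiece minkowski (.six l) R) : InPiece minkowski (.six l') (swapTensor R) := by
  obtain ⟨A, hA, h⟩ := hR
  refine ⟨A, hA, ?_⟩
  rw [lowered_swapTensor, h, rankTwoTensor_swap _ minkowski_transpose, h0, h1, h2]

theorem inPiece_nine_swapTensor {l l' : Fin 2} (h0 : coeffNine l 0 = coeffNine l' 1)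
    (h1 : coeffNine l 1 = coeffNine l' 0) {R : CurvatureTensor}
    (hR : InPiece minkowski (.nine l) R) : InPiece minkowski (.nine l') (swapTensor R) := by
  obtain ⟨A, hA, h⟩ := hR
  refine ⟨A, hA, ?_⟩
  rw [lowered_swapTensor, h, rankTwoTensor_swap _ minkowski_transpose, h0, h1]

theorem inPiece_nineStar_swapTensor {l l' : Fin 2} (h0 : coeffNine l 0 = coeffNine l' 1)
    (h1 : coeffNine l 1 = coeffNine l' 0) {R : CurvatureTensor}
    (hR : InPiece minkowski (.nineStar l) R) :
    InPiece minkowski (.nineStar l') (swapTensor R) := by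
  obtain ⟨A, hA, h⟩ := hR
  refine ⟨A, hA, ?_⟩
  rw [loweredStar_swapTensor, h, rankTwoTensor_swap _ minkowski_transpose, h0, h1]

theorem piecesIsomorphic_six_zero_one : PiecesIsomorphic (.six 0) (.six 1) :=
  piecesIsomorphic_of_swap (fun _ => inPiece_six_swapTensor (by simp [coeffSix]) (by simp [coeffSix])
    (by simp [coeffSix]))
    (fun _ => inPiece_six_swapTensor (by simp [coeffSix]) (by simp [coeffSix])
    (by simp [coeffSix]))

theorem piecesIsomorphic_nine (l : Fin 2) : PiecesIsomorphic (.nine l) (.nine (1 - l)) := by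
  fin_cases l
  exacts [piecesIsomorphic_of_swap (fun _ => inPiece_nine_swapTensor (by simp [coeffNine]) (by simp [coeffNine]))
    (fun _ => inPiece_nine_swapTensor (by simp [coeffNine]) (by simp [coeffNine])),
    piecesIsomorphic_of_swap (fun _ => inPiece_nine_swapTensor (by simp [coeffNine]) (by simp [coeffNine]))
    (fun _ => inPiece_nine_swapTensor (by simp [coeffNine]) (by simp [coeffNine]))]

theorem piecesIsomorphic_nineStar (l : Fin 2) :
    PiecesIsomorphic (.nineStar l) (.nineStar (1 - l)) := by
  fin_cases l
  exacts [piecesIsomorphic_of_swap (fun _ => inPiece_nineStar_swapTensor (by simp [coeffNine]) (by simp [coeffNine]))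
    (fun _ => inPiece_nineStar_swapTensor (by simp [coeffNine]) (by simp [coeffNine])),
    piecesIsomorphic_of_swap (fun _ => inPiece_nineStar_swapTensor (by simp [coeffNine]) (by simp [coeffNine]))
    (fun _ => inPiece_nineStar_swapTensor (by simp [coeffNine]) (by simp [coeffNine]))]

theorem piecesIsomorphic_six_one_zero : PiecesIsomorphic (.six 1) (.six 0) :=
  piecesIsomorphic_of_swap (fun _ => inPiece_six_swapTensor (by simp [coeffSix]) (by simp [coeffSix])
    (by simp [coeffSix]))
    (fun _ => inPiece_six_swapTensor (by simp [coeffSix]) (by simp [coeffSix])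
    (by simp [coeffSix]))

/-- The curvature tensor with lowered components `rankTwoTensor minkowski a b c` of the antisymmetric
part of a matrix. -/
noncomputable def rankTwoCurv (a b c : ℝ) : Matrix (Fin 4) (Fin 4) ℝ →ₗ[ℝ] CurvatureTensor where
  toFun A := ⟨fun κ lam μ ν => minkowski κ κ * rankTwoTensor minkowski a b c
    ((1 / 2 : ℝ) • (A - Aᵀ)) κ lam μ ν, by
    intro κ lam μ ν
    simp [rankTwoTensor]
    ring⟩
  map_add' A B := by
    ext
    simp [rankTwoTensor]
    ring
  map_smul' s A := by
    ext
    simp [rankTwoTensor]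
    ring

theorem lowered_rankTwoCurv (a b c : ℝ) (A : Matrix (Fin 4) (Fin 4) ℝ) (hA : Aᵀ = -A) :
    lowered minkowski (rankTwoCurv a b c A) = rankTwoTensor minkowski a b c A := by
  have h : (1 / 2 : ℝ) • (A - Aᵀ) = A := by
    rw [hA, sub_neg_eq_add, ← two_smul ℝ, smul_smul]
    norm_num
  ext κ lam μ ν
  rw [lowered_minkowski]
  change minkowski κ κ * (minkowski κ κ * rankTwoTensor minkowski a b c
    ((1 / 2 : ℝ) • (A - Aᵀ)) κ lam μ ν) = _
  rw [h, ← mul_assoc, minkowski_diag_mul_self, one_mul]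

/-- The trace over the first two indices. -/
def homothetic : CurvatureTensor →ₗ[ℝ] Matrix (Fin 4) (Fin 4) ℝ where
  toFun R := Matrix.of fun μ ν => ∑ κ, R.1 κ κ μ ν
  map_add' R Q := by
    ext
    simp [Finset.sum_add_distrib]
  map_smul' s R := by
    ext
    simp [Finset.mul_sum]

/-- The trace over the first and the third indices. -/
def ricci : CurvatureTensor →ₗ[ℝ] Matrix (Fin 4) (Fin 4) ℝ where
  toFun R := Matrix.of fun lam ν => ∑ κ, R.1 κ lam κ ν
  map_add' R Q := by
    ext
    simp [Finset.sum_add_distrib]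
  map_smul' s R := by
    ext
    simp [Finset.mul_sum]

theorem homothetic_of_lowered {R : CurvatureTensor} {a b c : ℝ} {A : Matrix (Fin 4) (Fin 4) ℝ}
    (hA : Aᵀ = -A) (h : lowered minkowski R = rankTwoTensor minkowski a b c A) :
    homothetic R = (2 * a + 2 * b + 4 * c) • A := by
  have hA' : ∀ i j, A j i = -A i j := fun i j => congrFun (congrFun hA i) j
  ext μ ν
  change ∑ κ, R.1 κ κ μ ν = _
  simp only [apply_eq_minkowski_mul_lowered, h]
  simp only [Fin.sum_univ_four, rankTwoTensor, minkowski_eq_of]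
  have h00 := self_eq_neg.1 (hA' 0 0)
  have h11 := self_eq_neg.1 (hA' 1 1)
  have h22 := self_eq_neg.1 (hA' 2 2)
  have h33 := self_eq_neg.1 (hA' 3 3)
  have h10 := hA' 0 1
  have h20 := hA' 0 2
  have h30 := hA' 0 3
  have h21 := hA' 1 2
  have h31 := hA' 1 3
  have h32 := hA' 2 3
  fin_cases μ <;> fin_cases ν <;>
    simp [h00, h11, h22, h33, h10, h20, h30, h21, h31, h32] <;> ring

theorem ricci_of_lowered {R : CurvatureTensor} {a b c : ℝ} {A : Matrix (Fin 4) (Fin 4) ℝ}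
    (hA : Aᵀ = -A) (h : lowered minkowski R = rankTwoTensor minkowski a b c A) :
    ricci R = (3 * a + b + c) • A := by
  have hA' : ∀ i j, A j i = -A i j := fun i j => congrFun (congrFun hA i) j
  ext μ ν
  change ∑ κ, R.1 κ μ κ ν = _
  simp only [apply_eq_minkowski_mul_lowered, h]
  simp only [Fin.sum_univ_four, rankTwoTensor, minkowski_eq_of]
  have h00 := self_eq_neg.1 (hA' 0 0)
  have h11 := self_eq_neg.1 (hA' 1 1)
  have h22 := self_eq_neg.1 (hA' 2 2)
  have h33 := self_eq_neg.1 (hA' 3 3)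
  have h10 := hA' 0 1
  have h20 := hA' 0 2
  have h30 := hA' 0 3
  have h21 := hA' 1 2
  have h31 := hA' 1 3
  have h32 := hA' 2 3
  fin_cases μ <;> fin_cases ν <;>
    simp [h00, h11, h22, h33, h10, h20, h30, h21, h31, h32] <;> ring

theorem frameChange_rankTwoCurv {L : Matrix (Fin 4) (Fin 4) ℝ} (hL : IsLorentz L) (a b c : ℝ)
    (A : Matrix (Fin 4) (Fin 4) ℝ) (hA : Aᵀ = -A) :
    frameChange L (rankTwoCurv a b c A) = rankTwoCurv a b c (Lᵀ * A * L) := by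
  apply lowered_minkowski_injective
  rw [IsOrthonormalFrame.lowered_eq hL, lowered_rankTwoCurv _ _ _ _ hA, pullTensor_rankTwoTensor,
    hL, lowered_rankTwoCurv]
  simp only [Matrix.transpose_mul, Matrix.transpose_transpose, hA, Matrix.neg_mul, Matrix.mul_neg,
    Matrix.mul_assoc]

/-- The matrix `A` is read off by a trace and inserted with the other coefficients. The
normalisation makes the traces exact: `2a + 2b + 4c = 1` for the trace over the first two indices on
`.six 2`, and `3a + b + c = 1` for the Ricci trace on `.six 0`. -/
theorem piecesIsomorphic_six_two_zero : PiecesIsomorphic (.six 2) (.six 0) := by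
  have k2 : coeffSix 2 0 = -1/12 ∧ coeffSix 2 1 = -1/12 ∧ coeffSix 2 2 = 1/3 := by
    simp [coeffSix]
  have k0 : coeffSix 0 0 = 5/12 ∧ coeffSix 0 1 = -1/12 ∧ coeffSix 0 2 = -1/6 := by
    simp [coeffSix]
  have t2 : ∀ {R A}, Aᵀ = -A → lowered minkowski R = rankTwoTensor minkowski (coeffSix 2 0)
      (coeffSix 2 1) (coeffSix 2 2) A → homothetic R = A := by
    intro R A hA h
    rw [homothetic_of_lowered hA h, k2.1, k2.2.1, k2.2.2]
    norm_num
  have t0 : ∀ {R A}, Aᵀ = -A → lowered minkowski R = rankTwoTensor minkowski (coeffSix 0 0)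
      (coeffSix 0 1) (coeffSix 0 2) A → ricci R = A := by
    intro R A hA h
    rw [ricci_of_lowered hA h, k0.1, k0.2.1, k0.2.2]
    norm_num
  have e : ∀ {l R A}, Aᵀ = -A → lowered minkowski R = rankTwoTensor minkowski (coeffSix l 0)
      (coeffSix l 1) (coeffSix l 2) A → R = rankTwoCurv (coeffSix l 0) (coeffSix l 1)
      (coeffSix l 2) A := fun hA h =>
    lowered_minkowski_injective (by rw [h, lowered_rankTwoCurv _ _ _ _ hA])
  have m : ∀ l A, Aᵀ = -A → InPiece minkowski (.six l) (rankTwoCurv (coeffSix l 0) (coeffSix l 1)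
      (coeffSix l 2) A) := fun l A hA => ⟨A, hA, lowered_rankTwoCurv _ _ _ _ hA⟩
  refine PiecesIsomorphic.of_maps
    (rankTwoCurv (coeffSix 0 0) (coeffSix 0 1) (coeffSix 0 2) ∘ₗ homothetic)
    (rankTwoCurv (coeffSix 2 0) (coeffSix 2 1) (coeffSix 2 2) ∘ₗ ricci) ?_ ?_ ?_ ?_ ?_
  · rintro R ⟨A, hA, h⟩
    rw [LinearMap.comp_apply, t2 hA h]
    exact m 0 A hA
  · rintro R ⟨A, hA, h⟩
    rw [LinearMap.comp_apply, t0 hA h]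
    exact m 2 A hA
  · rintro R ⟨A, hA, h⟩
    rw [LinearMap.comp_apply, LinearMap.comp_apply, t2 hA h,
      t0 hA (lowered_rankTwoCurv _ _ _ _ hA), ← e hA h]
  · rintro R ⟨A, hA, h⟩
    rw [LinearMap.comp_apply, LinearMap.comp_apply, t0 hA h,
      t2 hA (lowered_rankTwoCurv _ _ _ _ hA), ← e hA h]
  · rintro L hL R ⟨A, hA, h⟩
    have hA' : (Lᵀ * A * L)ᵀ = -(Lᵀ * A * L) := by
      simp only [Matrix.transpose_mul, Matrix.transpose_transpose, hA, Matrix.neg_mul,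
        Matrix.mul_neg, Matrix.mul_assoc]
    rw [LinearMap.comp_apply, LinearMap.comp_apply, t2 hA h, frameChange_rankTwoCurv hL _ _ _ _ hA,
      e hA h, frameChange_rankTwoCurv hL _ _ _ _ hA, t2 hA' (lowered_rankTwoCurv _ _ _ _ hA')]

/-- Every piece of dimension 6 or 9 has an isomorphic partner. No converse is needed: the field
equations are derived from the type of the curvature, not from simplicity. -/
theorem PieceLabel.IsSimple.cases {i : PieceLabel} (h : i.IsSimple) :
    i = .scalar ∨ i = .pseudoscalar ∨ i = .weyl ∨ i = .thirty := by
  cases i with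
  | scalar => simp
  | pseudoscalar => simp
  | weyl => simp
  | thirty => simp
  | six l =>
    exfalso
    fin_cases l
    · exact h (.six 1) (by decide) piecesIsomorphic_six_zero_one
    · exact h (.six 0) (by decide) piecesIsomorphic_six_one_zero
    · exact h (.six 0) (by decide) piecesIsomorphic_six_two_zero
  | nine l =>
    refine (h (.nine (1 - l)) ?_ (piecesIsomorphic_nine l)).elim
    fin_cases l <;> decide
  | nineStar l =>
    refine (h (.nineStar (1 - l)) ?_ (piecesIsomorphic_nineStar l)).elim
    fin_cases l <;> decide

end Pieces

/-! ### Transfer of the algebra to an arbitrary Lorentzian metric. -/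

section Coupling

theorem IsPurely.inPiece {g : Matrix (Fin 4) (Fin 4) ℝ} {i : PieceLabel} {R : CurvatureTensor}
    (h : IsPurely g i R) : InPiece g i R := by
  obtain ⟨r, ⟨hr, hsum⟩, hz⟩ := h
  rw [hsum, Finset.sum_eq_single i (fun j _ hj => hz j hj) (by simp)]
  exact hr i

namespace IsOrthonormalFrame

variable {g P : Matrix (Fin 4) (Fin 4) ℝ} {R : CurvatureTensor}

theorem inPiece_scalar (h : IsOrthonormalFrame g P) (hR : InPiece g .scalar R) :
    InPiece minkowski .scalar (frameChange P R) := by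
  obtain ⟨s, hs⟩ := hR
  exact ⟨s, by rw [h.lowered_eq, hs, pullTensor_scalarTensor, h]⟩

theorem inPiece_pseudoscalar (h : IsOrthonormalFrame g P) (hR : InPiece g .pseudoscalar R) :
    InPiece minkowski .pseudoscalar (frameChange P R) := by
  obtain ⟨s, hs⟩ := hR
  exact ⟨P.det⁻¹ * |P.det| * s,
    by rw [h.loweredStar_eq, hs, pullTensor_scalarTensor, h, scalarTensor_smul]⟩

theorem inPiece_weyl (h : IsOrthonormalFrame g P) (hR : InPiece g .weyl R) :
    InPiece minkowski .weyl (frameChange P R) := by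
  obtain ⟨⟨h1, h2, -⟩, h4⟩ := hR
  have hP : P * minkowski⁻¹ * Pᵀ = g⁻¹ := by rw [minkowski_inv, h.mul_minkowski_mul]
  have ha : ∀ κ lam μ ν, lowered minkowski (frameChange P R) κ lam μ ν
      = -lowered minkowski (frameChange P R) lam κ μ ν := by
    have h5 : (fun κ lam μ ν => lowered g R lam κ μ ν) = (-1 : ℝ) • lowered g R := by
      ext κ lam μ ν
      simp only [Pi.smul_apply, smul_eq_mul, h4 κ lam]
      ring
    have h6 := pullTensor_swap P (lowered g R)
    rw [h5, pullTensor_smul, ← h.lowered_eq] at h6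
    intro κ lam μ ν
    have := congrFun (congrFun (congrFun (congrFun h6 κ) lam) μ) ν
    simp only [Pi.smul_apply, smul_eq_mul] at this
    linarith
  refine ⟨⟨?_, ?_, fun μ ν => ?_⟩, ha⟩
  · rw [h.lowered_eq]
    exact h1.pullTensor hP
  · rw [h.loweredStar_eq]
    exact (h2.pullTensor hP).smul _
  -- Each term of the trace over the first two indices is a diagonal entry of a tensor skew in that
  -- pair.
  · refine Finset.sum_eq_zero fun κ _ => ?_
    rw [apply_eq_minkowski_mul_lowered, self_eq_neg.1 (ha κ κ μ ν), mul_zero]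

end IsOrthonormalFrame

/-- On the three simple pieces which occur for a metric compatible connection, every invariant
quadratic form has the polar form of a multiple of the Yang–Mills form. -/
theorem exists_polar_eq_of_isPurely {q : QuadraticForm ℝ CurvatureTensor}
    (hq : IsLorentzInvariant q) {i : PieceLabel}
    (hi : i = .scalar ∨ i = .pseudoscalar ∨ i = .weyl) :
    ∃ c : ℝ, ∀ g P R, IsOrthonormalFrame g P → IsPurely g i R → IsDoubleDual g R ∧
      ∀ Q, QuadraticMap.polar q (frameChange P R) Q
        = c * ymPairing minkowski (frameChange P R) Q := by
  rcases hi with rfl | rfl | rfl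
  · obtain ⟨c, hc⟩ := exists_polar_eq_of_scalar hq
    refine ⟨c, fun g P R h hR => ?_⟩
    have h1 := h.inPiece_scalar hR.inPiece
    refine ⟨h.isDoubleDual ?_, hc _ h1⟩
    obtain ⟨s, hs⟩ := inPiece_scalar_eq h1
    rw [hs]
    exact isDoubleDual_doubleDualTensor _ _
  · obtain ⟨c, hc⟩ := exists_polar_eq_of_pseudoscalar hq
    refine ⟨c, fun g P R h hR => ?_⟩
    have h1 := h.inPiece_pseudoscalar hR.inPiece
    refine ⟨h.isDoubleDual ?_, hc _ h1⟩
    obtain ⟨s, hs⟩ := inPiece_pseudoscalar_eq h1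
    rw [hs]
    exact isDoubleDual_doubleDualTensor _ _
  · obtain ⟨c, hc⟩ := exists_polar_eq_of_weyl hq
    refine ⟨c, fun g P R h hR => ?_⟩
    have h1 := h.inPiece_weyl hR.inPiece
    refine ⟨h.isDoubleDual ?_, hc _ h1⟩
    obtain ⟨A, B, -, -, -, -, hs⟩ := inPiece_weyl_eq h1
    rw [hs]
    exact isDoubleDual_doubleDualTensor _ _

end Coupling

/-! ### A smooth local choice of orthonormal frames. -/

section MatrixCalculus

open Topology

variable {E : Type*} [NormedAddCommGroup E] [NormedSpace ℝ E] {n : WithTop ℕ∞} {x : E}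
  {ι : Type*} [Fintype ι] {G H : E → Matrix ι ι ℝ}

theorem contDiffAt_matrix_mul (hG : ∀ i j, ContDiffAt ℝ n (fun y => G y i j) x)
    (hH : ∀ i j, ContDiffAt ℝ n (fun y => H y i j) x) (i j : ι) :
    ContDiffAt ℝ n (fun y => (G y * H y) i j) x := by
  simp only [Matrix.mul_apply]
  exact ContDiffAt.sum fun k _ => (hG i k).mul (hH k j)

theorem contDiffAt_matrix_det [DecidableEq ι] (hG : ∀ i j, ContDiffAt ℝ n (fun y => G y i j) x) :
    ContDiffAt ℝ n (fun y => (G y).det) x := by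
  simp only [Matrix.det_apply']
  exact ContDiffAt.sum fun σ _ => contDiffAt_const.mul (contDiffAt_prod fun i _ => hG _ _)

theorem contDiffAt_matrix_inv [DecidableEq ι] (hG : ∀ i j, ContDiffAt ℝ n (fun y => G y i j) x)
    (hx : (G x).det ≠ 0) (i j : ι) : ContDiffAt ℝ n (fun y => (G y)⁻¹ i j) x := by
  simp only [Matrix.inv_def, Ring.inverse_eq_inv', Matrix.smul_apply, smul_eq_mul,
    Matrix.adjugate_apply]
  refine ((contDiffAt_matrix_det hG).inv hx).mul (contDiffAt_matrix_det fun a b => ?_)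
  by_cases h : a = j
  · subst h
    simp only [Matrix.updateRow_self]
    exact contDiffAt_const
  · simp only [Matrix.updateRow_ne h]
    exact hG a b

/-- The equation `X + (X η X) / 2 = Y` for a symmetric `X`. -/
noncomputable def frameEquation (X : Fin 4 → Fin 4 → ℝ) : Fin 4 → Fin 4 → ℝ :=
  fun i j => X i j + (1 / 2) * ∑ k, X i k * (minkowski k k * X k j)

theorem contDiff_frameEquation : ContDiff ℝ ∞ frameEquation := by
  unfold frameEquation
  fun_prop

theorem hasFDerivAt_frameEquation :
    HasFDerivAt frameEquation
      (ContinuousLinearEquiv.refl ℝ (Fin 4 → Fin 4 → ℝ) : _ →L[ℝ] _) 0 := by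
  have hc : ∀ i j, HasFDerivAt (fun X : Fin 4 → Fin 4 → ℝ => X i j)
      ((ContinuousLinearMap.proj (R := ℝ) (φ := fun _ : Fin 4 => ℝ) j).comp
        (ContinuousLinearMap.proj (R := ℝ) (φ := fun _ : Fin 4 => Fin 4 → ℝ) i)) 0 := by
    intro i j
    exact ContinuousLinearMap.hasFDerivAt
      ((ContinuousLinearMap.proj (R := ℝ) (φ := fun _ : Fin 4 => ℝ) j).comp
      (ContinuousLinearMap.proj (R := ℝ) (φ := fun _ : Fin 4 => Fin 4 → ℝ) i))
  rw [hasFDerivAt_pi']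
  intro i
  rw [hasFDerivAt_pi']
  intro j
  have h := (hc i j).add ((HasFDerivAt.fun_sum (u := Finset.univ) fun k _ =>
    (hc i k).mul ((hc k j).const_mul (minkowski k k))).const_mul (1 / 2))
  convert h using 1
  · ext X
    simp [frameEquation]
  · simp only [Pi.zero_apply, mul_zero, zero_smul, add_zero, Finset.sum_const_zero, smul_zero]
    rfl

theorem frameEquation_transpose (X : Fin 4 → Fin 4 → ℝ) :
    frameEquation (fun i j => X j i) = fun i j => frameEquation X j i := by
  ext i j
  simp only [frameEquation]
  congr 2
  refine Finset.sum_congr rfl fun k _ => ?_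
  ring

/-- With `S = 1 + η X` and `X` symmetric, `Sᵀ η S = η + 2X + X η X`. So `m = Sᵀ η S` reduces to `X +
(X η X)/2 = (m - η)/2`, whose left side has identity derivative at 0. The inverse function theorem
gives `X` smoothly in `m`, and `S⁻¹` is the frame. -/
theorem exists_frame_near_minkowski : ∃ F : (Fin 4 → Fin 4 → ℝ) → Matrix (Fin 4) (Fin 4) ℝ,
    F (fun i j => minkowski i j) = 1 ∧
    (∀ i j, ContDiffAt ℝ ∞ (fun m => F m i j) (fun i j => minkowski i j)) ∧
    ∀ᶠ m in 𝓝 (fun i j => minkowski i j), (Matrix.of m)ᵀ = Matrix.of m →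
      IsOrthonormalFrame (Matrix.of m) (F m) := by
  obtain ⟨m₀, hm₀⟩ : ∃ m₀ : Fin 4 → Fin 4 → ℝ, m₀ = fun i j => minkowski i j := ⟨_, rfl⟩
  rw [← hm₀]
  have hf : ContDiffAt ℝ ∞ frameEquation 0 := contDiff_frameEquation.contDiffAt
  have hn : (∞ : WithTop ℕ∞) ≠ 0 := by simp
  set e := hf.toOpenPartialHomeomorph frameEquation hasFDerivAt_frameEquation hn with he
  have he0 : (0 : Fin 4 → Fin 4 → ℝ) ∈ e.source :=
    hf.mem_toOpenPartialHomeomorph_source hasFDerivAt_frameEquation hn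
  have hΦ0 : frameEquation 0 = 0 := by
    ext i j
    simp [frameEquation]
  have hs0 : e.symm 0 = 0 := by
    have := e.left_inv he0
    rwa [show e 0 = 0 from hΦ0] at this
  have ht0 : (0 : Fin 4 → Fin 4 → ℝ) ∈ e.target := by
    have := e.map_source he0
    rwa [show e 0 = 0 from hΦ0] at this
  have hsm : ContDiffAt ℝ ∞ e.symm 0 := by
    have := hf.to_localInverse hasFDerivAt_frameEquation hn
    rwa [hΦ0] at this
  let Y : (Fin 4 → Fin 4 → ℝ) → (Fin 4 → Fin 4 → ℝ) := fun m i j => (m i j - minkowski i j) / 2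
  have hY : ContDiff ℝ ∞ Y := by
    unfold Y
    fun_prop
  have hY0 : Y m₀ = 0 := by
    ext i j
    simp [Y, hm₀]
  have hX : ContDiffAt ℝ ∞ (fun m => e.symm (Y m)) m₀ :=
    ContDiffAt.comp m₀ (by rw [hY0]; exact hsm) hY.contDiffAt
  let S : (Fin 4 → Fin 4 → ℝ) → Matrix (Fin 4) (Fin 4) ℝ := fun m =>
    1 + minkowski * Matrix.of (e.symm (Y m))
  have hS0 : S m₀ = 1 := by
    simp only [S, hY0, hs0]
    ext i j
    simp [Matrix.mul_apply]
  have hSc : ∀ i j, ContDiffAt ℝ ∞ (fun m => S m i j) m₀ := by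
    intro i j
    refine ContDiffAt.add contDiffAt_const (contDiffAt_matrix_mul (G := fun _ => minkowski) (fun _ _ => contDiffAt_const)
      (fun a b => ?_) i j)
    exact contDiffAt_pi.1 (contDiffAt_pi.1 hX a) b
  refine ⟨fun m => (S m)⁻¹, by change (S m₀)⁻¹ = 1; rw [hS0, inv_one], fun i j => contDiffAt_matrix_inv hSc
    (by rw [hS0]; simp) i j, ?_⟩
  have e1 : ∀ᶠ m in 𝓝 m₀, (S m).det ≠ 0 :=
    (contDiffAt_matrix_det hSc).continuousAt.eventually_ne (by rw [hS0]; simp)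
  have e2 : ∀ᶠ m in 𝓝 m₀, Y m ∈ e.target :=
    hY.continuous.continuousAt.eventually_mem (by rw [hY0]; exact e.open_target.mem_nhds ht0)
  have htr : Continuous fun X : Fin 4 → Fin 4 → ℝ => fun i j => X j i := by fun_prop
  have e3 : ∀ᶠ m in 𝓝 m₀,
      (fun i j => e.symm (Y m) j i) ∈ e.source := by
    refine (htr.continuousAt.comp hX.continuousAt).eventually_mem (e.open_source.mem_nhds ?_)
    simp only [Function.comp_apply, hY0, hs0]
    exact he0
  filter_upwards [e1, e2, e3] with m h1 h2 h3 hm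
  set X := e.symm (Y m) with hXdef
  have hΦ : frameEquation X = Y m := e.right_inv h2
  have hYs : (fun i j => Y m j i) = Y m := by
    ext i j
    have a1 : m j i = m i j := congrFun (congrFun hm i) j
    have a2 : minkowski j i = minkowski i j := congrFun (congrFun minkowski_transpose i) j
    simp only [Y, a1, a2]
  -- The transpose of `X` solves the same equation because the right side is symmetric, and it lies
  -- in the region of injectivity.
  have hXs : (fun i j => X j i) = X := by
    apply e.injOn h3 (e.map_target h2)
    change frameEquation _ = frameEquation _
    rw [frameEquation_transpose, ← hXdef, hΦ, hYs]
  have hXt : (Matrix.of X)ᵀ = Matrix.of X := hXs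
  have hm' : Matrix.of m = (S m)ᵀ * minkowski * S m := by
    have h4 : Matrix.of m = minkowski + (2 : ℝ) • Matrix.of X
        + Matrix.of X * minkowski * Matrix.of X := by
      ext i j
      have := congrFun (congrFun hΦ i) j
      have h5 : (Matrix.of X * minkowski * Matrix.of X) i j
          = ∑ k, X i k * (minkowski k k * X k j) := by
        rw [minkowski, Matrix.mul_apply]
        simp only [Matrix.mul_diagonal, Matrix.diagonal_apply_eq, Matrix.of_apply, mul_assoc]
      rw [Matrix.add_apply, Matrix.add_apply, h5]
      simp only [frameEquation, Y] at this
      simp only [Matrix.of_apply, Matrix.smul_apply, smul_eq_mul]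
      linarith
    simp only [S, ← hXdef]
    rw [h4, Matrix.transpose_add, Matrix.transpose_mul, hXt, minkowski_transpose,
      Matrix.transpose_one, Matrix.add_mul, Matrix.one_mul, Matrix.mul_assoc _ minkowski minkowski,
      minkowski_mul_self, Matrix.mul_one, Matrix.mul_add, Matrix.mul_one, Matrix.add_mul,
      ← Matrix.mul_assoc minkowski minkowski, minkowski_mul_self, Matrix.one_mul, two_smul]
    simp only [Matrix.mul_assoc]
    abel
  have hu : IsUnit (S m).det := isUnit_iff_ne_zero.2 h1
  unfold IsOrthonormalFrame
  rw [hm', ← Matrix.mul_assoc, ← Matrix.mul_assoc, ← Matrix.transpose_mul,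
    Matrix.mul_nonsing_inv _ hu, Matrix.transpose_one, Matrix.one_mul, Matrix.mul_assoc,
    Matrix.mul_nonsing_inv _ hu, Matrix.mul_one]

/-- For `m` near `g` the matrix `Pᵀ m P` is near the Minkowski metric, so the frame found there is
transported by the fixed `P`. Such frames replace the arbitrary choice made in `quadAt` when
derivatives are taken. -/
theorem IsOrthonormalFrame.exists_smooth {g P : Matrix (Fin 4) (Fin 4) ℝ}
    (h : IsOrthonormalFrame g P) : ∃ F : (Fin 4 → Fin 4 → ℝ) → Matrix (Fin 4) (Fin 4) ℝ,
    F (fun i j => g i j) = P ∧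
    (∀ i j, ContDiffAt ℝ ∞ (fun m => F m i j) (fun i j => g i j)) ∧
    ∀ᶠ m in 𝓝 (fun i j => g i j), (Matrix.of m)ᵀ = Matrix.of m →
      IsOrthonormalFrame (Matrix.of m) (F m) := by
  obtain ⟨F, hF1, hFs, hFo⟩ := exists_frame_near_minkowski
  obtain ⟨g₀, hg₀⟩ : ∃ g₀ : Fin 4 → Fin 4 → ℝ, g₀ = fun i j => g i j := ⟨_, rfl⟩
  rw [← hg₀]
  let T : (Fin 4 → Fin 4 → ℝ) → (Fin 4 → Fin 4 → ℝ) := fun m => Pᵀ * Matrix.of m * P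
  have hT : ContDiff ℝ ∞ T := by
    have : T = fun m i j => ∑ μ, P μ i * ∑ ν, P ν j * m μ ν := by
      ext m i j
      exact (sum_mul_sum_mul P (Matrix.of m) i j).symm
    rw [this]
    fun_prop
  have hTg : T g₀ = fun i j => minkowski i j := by
    rw [hg₀]
    exact h
  refine ⟨fun m => P * F (T m), by simp only [hTg, hF1, Matrix.mul_one], fun i j => ?_, ?_⟩
  · refine contDiffAt_matrix_mul (G := fun _ => P) (fun _ _ => contDiffAt_const) (fun a b => ?_) i j
    have := hFs a b
    rw [← hTg] at this
    exact this.comp (f := T) _ hT.contDiffAt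
  · rw [← hTg] at hFo
    have := (hT.continuous.continuousAt (x := g₀)).eventually hFo
    filter_upwards [this] with m hm hsym
    have h1 := hm (by
      change (Pᵀ * Matrix.of m * P)ᵀ = Pᵀ * Matrix.of m * P
      rw [Matrix.transpose_mul, Matrix.transpose_mul, hsym, Matrix.transpose_transpose,
        Matrix.mul_assoc])
    unfold IsOrthonormalFrame at h1 ⊢
    rw [← h1]
    change _ = (F (T m))ᵀ * (Pᵀ * Matrix.of m * P) * F (T m)
    simp only [Matrix.transpose_mul, Matrix.mul_assoc]

end MatrixCalculus

/-! ### First-order comparison of the density of `q` with the Yang–Mills density. -/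

section FormCalculus

open Topology

variable {E : Type*} [NormedAddCommGroup E] [NormedSpace ℝ E] {n : WithTop ℕ∞} {x : E}

theorem contDiffAt_curvatureTensor {R : E → CurvatureTensor}
    (hR : ∀ κ lam μ ν, ContDiffAt ℝ n (fun y => (R y).1 κ lam μ ν) x) : ContDiffAt ℝ n R x := by
  have h : R = fun y => ∑ κ, ∑ lam, ∑ μ, ∑ ν, (minkowski κ κ * (R y).1 κ lam μ ν / 2) •
      decomposable (Pi.single κ 1) (Pi.single lam 1) (Pi.single μ 1) (Pi.single ν 1) :=
    funext fun y => eq_sum_decomposable (R y)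
  rw [h]
  refine ContDiffAt.sum fun κ _ => ContDiffAt.sum fun lam _ => ContDiffAt.sum fun μ _ =>
    ContDiffAt.sum fun ν _ => ?_
  exact ((contDiffAt_const.mul (hR κ lam μ ν)).div_const 2).smul contDiffAt_const

/-- The polar form as a continuous bilinear map. -/
noncomputable def polarCLM (q : QuadraticForm ℝ CurvatureTensor) :
    CurvatureTensor →L[ℝ] CurvatureTensor →L[ℝ] ℝ :=
  q.polarBilin.toContinuousBilinearMap

theorem polarCLM_apply (q : QuadraticForm ℝ CurvatureTensor) (R Q : CurvatureTensor) :
    polarCLM q R Q = QuadraticMap.polar q R Q := rfl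

theorem quadraticForm_eq_half_polarCLM (q : QuadraticForm ℝ CurvatureTensor)
    (R : CurvatureTensor) :
    q R = 1 / 2 * polarCLM q R R := by
  rw [polarCLM_apply, QuadraticMap.polar_self]
  simp

theorem contDiffAt_linear_curvatureTensor (f : CurvatureTensor →ₗ[ℝ] ℝ)
    {R : E → CurvatureTensor} (hR : ContDiffAt ℝ n R x) : ContDiffAt ℝ n (fun y => f (R y)) x :=
  ContDiffAt.comp (g := fun R' => f R') x
    (ContinuousLinearMap.contDiff (LinearMap.toContinuousLinearMap f)).contDiffAt hR

theorem contDiffAt_quadraticForm (q : QuadraticForm ℝ CurvatureTensor) {R : E → CurvatureTensor}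
    (hR : ContDiffAt ℝ n R x) : ContDiffAt ℝ n (fun y => q (R y)) x := by
  have h : (fun y => q (R y)) = fun y => 1 / 2 * ∑ κ, ∑ lam, ∑ μ, ∑ ν,
      (minkowski κ κ * (R y).1 κ lam μ ν / 2) * q.polarBilin (decomposable (Pi.single κ 1)
        (Pi.single lam 1) (Pi.single μ 1) (Pi.single ν 1)) (R y) := by
    ext y
    rw [quadraticForm_eq_half_polarCLM]
    congr 1
    change q.polarBilin (R y) (R y) = _
    have hlin : ∀ (f : CurvatureTensor →ₗ[ℝ] ℝ) (R' : CurvatureTensor), f R' = ∑ κ, ∑ lam, ∑ μ,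
        ∑ ν, (minkowski κ κ * R'.1 κ lam μ ν / 2) * f (decomposable (Pi.single κ 1)
          (Pi.single lam 1) (Pi.single μ 1) (Pi.single ν 1)) := by
      intro f R'
      conv_lhs => rw [eq_sum_decomposable R']
      simp only [map_sum, map_smul, smul_eq_mul]
    exact hlin (q.polarBilin.flip (R y)) (R y)
  rw [h]
  have hc : ∀ κ lam μ ν, ContDiffAt ℝ n (fun y => (R y).1 κ lam μ ν) x := fun κ lam μ ν =>
    contDiffAt_linear_curvatureTensor (LinearMap.proj ν ∘ₗ LinearMap.proj μ ∘ₗ LinearMap.proj lam ∘ₗ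
      LinearMap.proj κ ∘ₗ CurvatureTensor.subtype) hR
  refine contDiffAt_const.mul (ContDiffAt.sum fun κ _ => ContDiffAt.sum fun lam _ =>
    ContDiffAt.sum fun μ _ => ContDiffAt.sum fun ν _ => ?_)
  exact ((contDiffAt_const.mul (hc κ lam μ ν)).div_const 2).mul
    (contDiffAt_linear_curvatureTensor _ hR)

/-- The derivative of `q ∘ R` at `x` is the polar form of `R x` with the derivative of `R`. -/
theorem hasFDerivAt_quadraticForm_of_polar_eq_zero {q : QuadraticForm ℝ CurvatureTensor}
    {R : E → CurvatureTensor} (hR : DifferentiableAt ℝ R x)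
    (h : ∀ Q, QuadraticMap.polar q (R x) Q = 0) :
    HasFDerivAt (fun y => q (R y)) (0 : E →L[ℝ] ℝ) x := by
  simp only [quadraticForm_eq_half_polarCLM]
  have h1 := ((polarCLM q).hasFDerivAt_of_bilinear hR.hasFDerivAt hR.hasFDerivAt).const_mul (1 / 2)
  refine h1.congr_fderiv ?_
  ext v
  have h2 : polarCLM q (R x) (fderiv ℝ R x v) = 0 := h _
  have h3 : polarCLM q (fderiv ℝ R x v) (R x) = 0 :=
    (QuadraticMap.polar_comm _ _ _).trans (h (fderiv ℝ R x v))
  simp [h2, h3]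

theorem contDiffAt_frameChange {P : E → Matrix (Fin 4) (Fin 4) ℝ} {R : E → CurvatureTensor}
    (hP : ∀ i j, ContDiffAt ℝ n (fun y => P y i j) x) (hx : (P x).det ≠ 0)
    (hR : ∀ κ lam μ ν, ContDiffAt ℝ n (fun y => (R y).1 κ lam μ ν) x) :
    ContDiffAt ℝ n (fun y => frameChange (P y) (R y)) x := by
  refine contDiffAt_curvatureTensor fun a b c d => ?_
  change ContDiffAt ℝ n (fun y => ∑ κ, (P y)⁻¹ a κ * ∑ lam, P y lam b * ∑ μ, P y μ c *
    ∑ ν, P y ν d * (R y).1 κ lam μ ν) x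
  exact ContDiffAt.sum fun κ _ => (contDiffAt_matrix_inv hP hx a κ).mul <|
    ContDiffAt.sum fun lam _ => (hP lam b).mul <| ContDiffAt.sum fun μ _ => (hP μ c).mul <|
    ContDiffAt.sum fun ν _ => (hP ν d).mul (hR κ lam μ ν)

theorem contDiffAt_sqrt_abs_det {G : E → Matrix (Fin 4) (Fin 4) ℝ}
    (hG : ∀ i j, ContDiffAt ℝ n (fun y => G y i j) x) (hx : (G x).det ≠ 0) :
    ContDiffAt ℝ n (fun y => √|(G y).det|) x := by
  -- Writing `|d| = √(d * d)` leaves only square roots of nonzero quantities, which are smooth for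
  -- either sign of the determinant.
  simp only [← Real.sqrt_mul_self_eq_abs]
  have h := contDiffAt_matrix_det hG
  have h1 := mul_self_pos.2 hx
  exact ((h.mul h).sqrt h1.ne').sqrt (Real.sqrt_pos.2 h1).ne'

/-- The Yang–Mills density. -/
noncomputable def ymDensity (g : Matrix (Fin 4) (Fin 4) ℝ) (R : CurvatureTensor) : ℝ :=
  ymPairing g R R * √|g.det|

theorem contDiffAt_ymDensity {G : E → Matrix (Fin 4) (Fin 4) ℝ} {R : E → CurvatureTensor}
    (hG : ∀ i j, ContDiffAt ℝ n (fun y => G y i j) x) (hx : (G x).det ≠ 0)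
    (hR : ∀ κ lam μ ν, ContDiffAt ℝ n (fun y => (R y).1 κ lam μ ν) x) :
    ContDiffAt ℝ n (fun y => ymDensity (G y) (R y)) x := by
  refine ContDiffAt.mul ?_ (contDiffAt_sqrt_abs_det hG hx)
  simp only [ymPairing, ymStress, Matrix.of_apply, Matrix.trace, Matrix.diag_apply,
    Matrix.mul_apply]
  have hi := contDiffAt_matrix_inv hG hx
  refine ContDiffAt.sum fun μ _ => ContDiffAt.sum fun μ' _ => (hi μ μ').mul <|
    ContDiffAt.sum fun ν _ => ContDiffAt.sum fun ν' _ => (hi ν ν').mul <|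
    ContDiffAt.sum fun κ _ => ContDiffAt.sum fun lam _ => ?_
  exact (hR κ lam μ ν).mul (hR lam κ μ' ν')

/-- If, at a point, the polar form of `q` is that of `c / 2` times the Yang–Mills form, then the
density of `q` has there the same derivative as the Yang–Mills density. -/
theorem density_regularity {q : QuadraticForm ℝ CurvatureTensor} (hq : IsLorentzInvariant q)
    {c : ℝ} {G : E → Matrix (Fin 4) (Fin 4) ℝ} {R : E → CurvatureTensor}
    {P : Matrix (Fin 4) (Fin 4) ℝ} (hn : 1 ≤ n) (hn' : n ≤ ∞)
    (hG : ∀ i j, ContDiffAt ℝ n (fun y => G y i j) x) (hGs : ∀ᶠ y in 𝓝 x, (G y)ᵀ = G y)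
    (hR : ∀ κ lam μ ν, ContDiffAt ℝ n (fun y => (R y).1 κ lam μ ν) x)
    (hP : IsOrthonormalFrame (G x) P)
    (hc : ∀ Q, QuadraticMap.polar q (frameChange P (R x)) Q
      = c * ymPairing minkowski (frameChange P (R x)) Q) :
    ContDiffAt ℝ n (fun y => quadAt q (G y) (R y) * √|(G y).det|) x ∧
    fderiv ℝ (fun y => quadAt q (G y) (R y) * √|(G y).det|) x
      = (c / 2) • fderiv ℝ (fun y => ymDensity (G y) (R y)) x := by
  obtain ⟨F, hF0, hFs, hFo⟩ := hP.exists_smooth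
  have hGx : (G x).det ≠ 0 := hP.isUnit_det_metric.ne_zero
  have hGc : ContDiffAt ℝ n (fun y => (fun i j => G y i j : Fin 4 → Fin 4 → ℝ)) x :=
    contDiffAt_pi.2 fun i => contDiffAt_pi.2 fun j => hG i j
  have hPs : ∀ i j, ContDiffAt ℝ n (fun y => F (fun i j => G y i j) i j) x := fun i j =>
    ContDiffAt.comp (f := fun y => (fun i j => G y i j : Fin 4 → Fin 4 → ℝ)) x
      ((hFs i j).of_le hn') hGc
  have hPo : ∀ᶠ y in 𝓝 x, IsOrthonormalFrame (G y) (F fun i j => G y i j) := by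
    filter_upwards [hGc.continuousAt.eventually hFo, hGs] with y h1 h2
    exact h1 h2
  have hPx : (F fun i j => G x i j).det ≠ 0 := by
    rw [hF0]
    exact hP.isUnit_det.ne_zero
  set R' : E → CurvatureTensor := fun y => frameChange (F fun i j => G y i j) (R y) with hR'
  have hRs : ContDiffAt ℝ n R' x := contDiffAt_frameChange hPs hPx hR
  have hden := contDiffAt_ymDensity hG hGx hR
  have hsq := contDiffAt_sqrt_abs_det hG hGx
  set q' : QuadraticForm ℝ CurvatureTensor := q + (-(c / 2)) • ymForm with hq'
  -- Invariance allows the smooth frame in place of the chosen one. The remainder `q'` vanishes at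
  -- `R' x` and its composition with `R'` has zero derivative at `x`, so it contributes nothing to
  -- first order.
  have hsplit : (fun y => quadAt q (G y) (R y) * √|(G y).det|) =ᶠ[𝓝 x]
      fun y => q' (R' y) * √|(G y).det| + c / 2 * ymDensity (G y) (R y) := by
    filter_upwards [hPo] with y hy
    rw [quadAt_eq hq hy, ymDensity, ← ymPairing_frameChange hy]
    change q (R' y) * _ = (q (R' y) + (-(c / 2)) * ymPairing minkowski (R' y) (R' y)) * _ + _
    ring
  have hpol : ∀ Q, QuadraticMap.polar q' (R' x) Q = 0 := by
    intro Q
    have h1 : QuadraticMap.polar q' (R' x) Q = QuadraticMap.polar q (R' x) Q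
        + (-(c / 2)) * QuadraticMap.polar ymForm (R' x) Q := by
      simp only [QuadraticMap.polar, hq', add_apply, smul_apply, smul_eq_mul]
      ring
    have h2 : R' x = frameChange P (R x) := by rw [hR', ← hF0]
    rw [h1, polar_ymForm, h2, hc]
    ring
  have hqx : q' (R' x) = 0 := by
    have := hpol (R' x)
    rw [QuadraticMap.polar_self] at this
    simpa using this
  have h1 : HasFDerivAt (fun y => q' (R' y)) (0 : E →L[ℝ] ℝ) x :=
    hasFDerivAt_quadraticForm_of_polar_eq_zero
      (hRs.differentiableAt (by rintro rfl; simp at hn)) hpol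
  have hn0 : n ≠ 0 := by rintro rfl; simp at hn
  refine ⟨(((contDiffAt_quadraticForm q' hRs).mul hsq).add
    (contDiffAt_const.mul hden)).congr_of_eventuallyEq hsplit, ?_⟩
  rw [hsplit.fderiv_eq]
  have h2 := (h1.mul (hsq.differentiableAt hn0).hasFDerivAt).add
    ((hden.differentiableAt hn0).hasFDerivAt.const_mul (c / 2))
  refine h2.fderiv.trans ?_
  rw [hqx]
  simp

end FormCalculus

/-! ### Differentiation under the integral over a compact set. -/

section ParametricIntegral

open Topology Set

/-- Being continuously differentiable near a point is an open condition, so by the tube lemma it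
holds on a closed interval times `K`. Compactness of that product bounds the `t`-derivative
uniformly. -/
theorem hasDerivAt_setIntegral_of_contDiffAt {V : Type*} [NormedAddCommGroup V] [NormedSpace ℝ V]
    [MeasurableSpace V] [BorelSpace V] {m : Measure V} [IsFiniteMeasureOnCompacts m]
    {F : ℝ × V → ℝ} {K : Set V} (hK : IsCompact K) (hF : ∀ y ∈ K, ContDiffAt ℝ 1 F (0, y)) :
    HasDerivAt (fun t : ℝ => ∫ y in K, F (t, y) ∂m) (∫ y in K, fderiv ℝ F (0, y) (1, 0) ∂m) 0 := by
  set U : Set (ℝ × V) := {p | ContDiffAt ℝ 1 F p} with hU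
  have hUo : IsOpen U := isOpen_iff_mem_nhds.2 fun p hp => ContDiffAt.eventually hp (by simp)
  obtain ⟨u, v, huo, -, h0u, hKv, huv⟩ := generalized_tube_lemma (isCompact_singleton (x := (0 : ℝ)))
    hK hUo (by
      rintro ⟨t, y⟩ ⟨ht, hy⟩
      obtain rfl : t = 0 := ht
      exact hF y hy)
  obtain ⟨ε, hε, hεu⟩ := Metric.isOpen_iff.1 huo 0 (h0u rfl)
  have hmem : ∀ t ∈ Metric.closedBall (0 : ℝ) (ε / 2), ∀ y ∈ K, ContDiffAt ℝ 1 F (t, y) := by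
    intro t ht y hy
    exact huv ⟨hεu (Metric.closedBall_subset_ball (by linarith) ht), hKv hy⟩
  have hs : Metric.closedBall (0 : ℝ) (ε / 2) ∈ 𝓝 0 := Metric.closedBall_mem_nhds _ (by linarith)
  have hcF : ∀ t ∈ Metric.closedBall (0 : ℝ) (ε / 2), ContinuousOn (fun y => F (t, y)) K := by
    intro t ht y hy
    exact ((hmem t ht y hy).continuousAt.comp
      (f := fun y => (t, y)) (by fun_prop)).continuousWithinAt
  have hcF' : ContinuousOn (fun p => fderiv ℝ F p (1, 0))
      (Metric.closedBall (0 : ℝ) (ε / 2) ×ˢ K) := by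
    rintro ⟨t, y⟩ ⟨ht, hy⟩
    exact (((hmem t ht y hy).continuousAt_fderiv one_ne_zero).clm_apply
      continuousAt_const).continuousWithinAt
  obtain ⟨C, hC⟩ := ((isCompact_closedBall (0 : ℝ) (ε / 2)).prod hK).exists_bound_of_continuousOn
    hcF'
  have h0 : (0 : ℝ) ∈ Metric.closedBall (0 : ℝ) (ε / 2) := mem_of_mem_nhds hs
  have hKm := hK.measurableSet
  refine (hasDerivAt_integral_of_dominated_loc_of_deriv_le (μ := m.restrict K)
    (F := fun t y => F (t, y)) (F' := fun t y => fderiv ℝ F (t, y) (1, 0)) (bound := fun _ => C) hs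
    ?_ ?_ ?_ ?_ ?_ ?_).2
  · filter_upwards [hs] with t ht
    exact (hcF t ht).aestronglyMeasurable_of_isCompact hK hKm
  · exact (hcF 0 h0).integrableOn_compact hK
  · refine ContinuousOn.aestronglyMeasurable_of_isCompact (f := fun y => fderiv ℝ F (0, y) (1, 0))
      ?_ hK hKm
    exact hcF'.comp (f := fun y => ((0 : ℝ), y)) (by fun_prop) fun y hy => ⟨h0, hy⟩
  · filter_upwards [ae_restrict_mem hKm] with y hy t ht
    exact hC (t, y) ⟨ht, hy⟩
  · exact (continuousOn_const.integrableOn_compact hK)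
  · filter_upwards [ae_restrict_mem hKm] with y hy t ht
    have h1 := ((hmem t ht y hy).differentiableAt one_ne_zero).hasFDerivAt
    have h2 : HasDerivAt (fun t : ℝ => (t, y)) ((1 : ℝ), (0 : V)) t :=
      (hasDerivAt_id t).prodMk (hasDerivAt_const t y)
    exact h1.comp_hasDerivAt t h2

end ParametricIntegral

/-! ### Curves of matrices; stationarity of the Yang–Mills density in the metric. -/

section MatrixDerivative

open Topology

variable {ι : Type*} {t₀ : ℝ}

/-- The entrywise derivative of a curve of matrices. -/
def HasMatrixDerivAt (A : ℝ → Matrix ι ι ℝ) (A' : Matrix ι ι ℝ) (t₀ : ℝ) : Prop :=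
  ∀ i j, HasDerivAt (fun t => A t i j) (A' i j) t₀

namespace HasMatrixDerivAt

variable {A B : ℝ → Matrix ι ι ℝ} {A' B' : Matrix ι ι ℝ}

theorem const (A : Matrix ι ι ℝ) : HasMatrixDerivAt (fun _ => A) 0 t₀ :=
  fun _ _ => hasDerivAt_const _ _

theorem unique (hA : HasMatrixDerivAt A A' t₀) (hA' : HasMatrixDerivAt A B' t₀) : A' = B' := by
  ext i j
  exact (hA i j).unique (hA' i j)

theorem congr_of_eventuallyEq (hA : HasMatrixDerivAt A A' t₀) (h : ∀ᶠ t in 𝓝 t₀, B t = A t) :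
    HasMatrixDerivAt B A' t₀ := fun i j =>
  (hA i j).congr_of_eventuallyEq (h.mono fun t ht => by simp only [ht])

variable [Fintype ι]

theorem mul (hA : HasMatrixDerivAt A A' t₀) (hB : HasMatrixDerivAt B B' t₀) :
    HasMatrixDerivAt (fun t => A t * B t) (A' * B t₀ + A t₀ * B') t₀ := by
  intro i j
  simp only [Matrix.mul_apply, Matrix.add_apply, ← Finset.sum_add_distrib]
  exact HasDerivAt.fun_sum fun k _ => (hA i k).mul (hB k j)

theorem trace (hA : HasMatrixDerivAt A A' t₀) :
    HasDerivAt (fun t => (A t).trace) A'.trace t₀ := by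
  simp only [Matrix.trace, Matrix.diag_apply]
  exact HasDerivAt.fun_sum fun i _ => hA i i

theorem curve (hA : HasMatrixDerivAt A A' t₀) :
    HasDerivAt (fun t => (fun i j => A t i j : ι → ι → ℝ)) (fun i j => A' i j) t₀ :=
  hasDerivAt_pi.2 fun i => hasDerivAt_pi.2 fun j => hA i j

variable [DecidableEq ι]

/-- The derivative depends only on the tangent direction at the identity, so it may be computed
along the line `1 + r A'`, where the determinant has an explicit linear term in `r`. -/
theorem det_of_eq_one (hA : HasMatrixDerivAt A A' t₀) (h1 : A t₀ = 1) :
    HasDerivAt (fun t => (A t).det) A'.trace t₀ := by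
  have hd : DifferentiableAt ℝ (fun m : ι → ι → ℝ => (Matrix.of m).det)
      (fun i j => (1 : Matrix ι ι ℝ) i j) :=
    (contDiffAt_matrix_det (n := 1) (G := fun m : ι → ι → ℝ => Matrix.of m) fun i j => by
      simp only [Matrix.of_apply]
      fun_prop).differentiableAt one_ne_zero
  obtain ⟨L, hL⟩ := hd
  have hcomp : ∀ {B : ℝ → Matrix ι ι ℝ} {t : ℝ}, HasMatrixDerivAt B A' t → B t = 1 →
      HasDerivAt (fun t => (B t).det) (L fun i j => A' i j) t := by
    intro B t hB hB1
    have h2 : HasFDerivAt (fun m : ι → ι → ℝ => (Matrix.of m).det) L (fun i j => B t i j) := by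
      rw [hB1]
      exact hL
    exact h2.comp_hasDerivAt t hB.curve
  have hlin : HasMatrixDerivAt (fun r : ℝ => 1 + r • A') A' 0 := by
    intro i j
    simpa using ((hasDerivAt_id (0 : ℝ)).mul_const (A' i j)).const_add ((1 : Matrix ι ι ℝ) i j)
  have h3 := hcomp hlin (by simp)
  obtain ⟨p, hp⟩ : ∃ p : Polynomial ℝ, ∀ r : ℝ,
      (1 + r • A').det = 1 + A'.trace * r + p.eval r * r ^ 2 :=
    ⟨_, fun r => Matrix.det_one_add_smul r A'⟩
  simp only [hp] at h3
  have h4 : HasDerivAt (fun r : ℝ => 1 + A'.trace * r + p.eval r * r ^ 2) A'.trace 0 := by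
    refine ((((hasDerivAt_id (0 : ℝ)).const_mul A'.trace).const_add 1).add
      ((p.hasDerivAt 0).mul (hasDerivAt_pow 2 (0 : ℝ)))).congr_deriv ?_
    simp
  rw [h4.unique h3]
  exact hcomp hA h1

/-- Jacobi's formula. -/
theorem det (hA : HasMatrixDerivAt A A' t₀) (hu : IsUnit (A t₀).det) :
    HasDerivAt (fun t => (A t).det) ((A t₀).det * ((A t₀)⁻¹ * A').trace) t₀ := by
  have h1 := ((const (A t₀)⁻¹).mul hA).det_of_eq_one (Matrix.nonsing_inv_mul _ hu)
  refine ((h1.const_mul (A t₀).det).congr_of_eventuallyEq (.of_forall fun t => ?_)).congr_deriv ?_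
  · simp only [Matrix.det_mul, Matrix.det_nonsing_inv, Ring.inverse_eq_inv']
    rw [mul_inv_cancel_left₀ hu.ne_zero]
  · rw [Matrix.zero_mul, zero_add]

theorem sqrt_abs_det (hA : HasMatrixDerivAt A A' t₀) (hu : IsUnit (A t₀).det) :
    HasDerivAt (fun t => √|(A t).det|) (1 / 2 * ((A t₀)⁻¹ * A').trace * √|(A t₀).det|) t₀ := by
  have h0 := hu.ne_zero
  have hs : √|(A t₀).det| ≠ 0 := (Real.sqrt_pos.2 (abs_pos.2 h0)).ne'
  have h3 : HasDerivAt (fun t => |(A t).det|) _ t₀ :=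
    HasDerivAt.comp (h₂ := fun x : ℝ => |x|) t₀ (hasDerivAt_abs h0) (hA.det hu)
  have h1 := h3.sqrt (abs_ne_zero.2 h0)
  refine h1.congr_deriv ?_
  have h2 : √|(A t₀).det| * √|(A t₀).det| = SignType.sign (A t₀).det * (A t₀).det := by
    rw [Real.mul_self_sqrt (abs_nonneg _), sign_mul_self]
  field_simp
  rw [pow_two, h2]
  ring

/-- Differentiability comes from smoothness of matrix inversion; the value comes from
differentiating `A⁻¹ A = 1`, valid near `t₀`. -/
theorem inv (hA : HasMatrixDerivAt A A' t₀) (hu : IsUnit (A t₀).det) :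
    HasMatrixDerivAt (fun t => (A t)⁻¹) (-((A t₀)⁻¹ * A' * (A t₀)⁻¹)) t₀ := by
  have hd : ∀ i j, DifferentiableAt ℝ (fun m : ι → ι → ℝ => (Matrix.of m)⁻¹ i j)
      (fun i j => A t₀ i j) := fun i j =>
    (contDiffAt_matrix_inv (n := 1) (G := fun m : ι → ι → ℝ => Matrix.of m) (fun i j => by
      simp only [Matrix.of_apply]
      fun_prop) hu.ne_zero i j).differentiableAt one_ne_zero
  have hN : HasMatrixDerivAt (fun t => (A t)⁻¹)
      (Matrix.of fun i j => deriv (fun t => (A t)⁻¹ i j) t₀) t₀ := fun i j =>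
    ((hd i j).comp (f := fun t => (fun i j => A t i j : ι → ι → ℝ)) t₀
      hA.curve.differentiableAt).hasDerivAt
  have hev : ∀ᶠ t in 𝓝 t₀, (A t).det ≠ 0 :=
    (hA.det hu).continuousAt.eventually_ne hu.ne_zero
  have h1 := (hN.mul hA).unique ((const 1).congr_of_eventuallyEq (hev.mono fun t ht =>
    Matrix.nonsing_inv_mul _ (isUnit_iff_ne_zero.2 ht)))
  have h2 := congrArg (· * (A t₀)⁻¹) h1
  simp only [Matrix.add_mul, Matrix.mul_assoc, Matrix.mul_nonsing_inv _ hu, Matrix.mul_one,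
    Matrix.zero_mul] at h2
  rwa [eq_neg_of_add_eq_zero_left h2, ← Matrix.mul_assoc] at hN

end HasMatrixDerivAt

/-- A Yang–Mills field with pure trace stress tensor is stationary with respect to variations of the
metric. -/
theorem hasDerivAt_ymDensity_metric {G : ℝ → Matrix (Fin 4) (Fin 4) ℝ}
    {G' : Matrix (Fin 4) (Fin 4) ℝ} {R : CurvatureTensor} (hG : HasMatrixDerivAt G G' t₀)
    (hu : IsUnit (G t₀).det) (hs : (G t₀)ᵀ = G t₀)
    (hR : ymStress (G t₀) R R = (1 / 4 * ymPairing (G t₀) R R) • G t₀) :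
    HasDerivAt (fun t => ymDensity (G t) R) 0 t₀ := by
  have hN := hG.inv hu
  set N' := -((G t₀)⁻¹ * G' * (G t₀)⁻¹) with hN'
  -- The two inverse metrics play the same role, by relabelling and antisymmetry of both curvature
  -- factors, hence the factor 2.
  have hy : HasDerivAt (fun t => ymPairing (G t) R R)
      (2 * ∑ μ, ∑ μ', N' μ μ' * ymStress (G t₀) R R μ μ') t₀ := by
    simp only [ymPairing, ymStress, Matrix.of_apply]
    refine (HasDerivAt.fun_sum fun μ _ => HasDerivAt.fun_sum fun μ' _ => (hN μ μ').mul
      (HasDerivAt.fun_sum fun ν _ => HasDerivAt.fun_sum fun ν' _ =>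
        (hN ν ν').mul_const _)).congr_deriv ?_
    simp only [Finset.sum_add_distrib, two_mul]
    congr 1
    simp only [Finset.mul_sum]
    have h1 : ∀ f : Fin 4 → Fin 4 → Fin 4 → Fin 4 → ℝ,
        ∑ a, ∑ b, ∑ c, ∑ d, f a b c d = ∑ c, ∑ d, ∑ a, ∑ b, f a b c d := by
      intro f
      rw [Finset.sum_comm_cycle]
      refine Finset.sum_congr rfl fun c _ => ?_
      rw [Finset.sum_comm_cycle]
    rw [h1]
    refine Finset.sum_congr rfl fun a _ => Finset.sum_congr rfl fun b _ =>
      Finset.sum_congr rfl fun c _ => Finset.sum_congr rfl fun d _ => ?_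
    rw [curvMat_antisymm R c a, curvMat_antisymm R d b, neg_mul_neg]
    ring
  have hsum : ∑ μ, ∑ μ', N' μ μ' * ymStress (G t₀) R R μ μ'
      = -(1 / 4) * ymPairing (G t₀) R R * ((G t₀)⁻¹ * G').trace := by
    have h1 : ∑ μ, ∑ μ', N' μ μ' * ymStress (G t₀) R R μ μ'
        = (N' * (ymStress (G t₀) R R)ᵀ).trace := by
      simp only [Matrix.trace, Matrix.diag_apply, Matrix.mul_apply, Matrix.transpose_apply]
    rw [h1, hR, Matrix.transpose_smul, hs, hN', Matrix.mul_smul, Matrix.neg_mul, Matrix.mul_assoc,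
      Matrix.nonsing_inv_mul _ hu, Matrix.mul_one, Matrix.trace_smul, Matrix.trace_neg, smul_eq_mul]
    ring
  -- The inverse metrics contribute `-2 · 1/4` and the volume element `+1/2` times the same trace;
  -- they cancel because the dimension is four.
  refine (hy.mul (hG.sqrt_abs_det hu)).congr_deriv ?_
  rw [hsum]
  ring

end MatrixDerivative

/-! ### Stationarity of the action in the metric. -/

section MetricVariation

open Topology

theorem contDiffAt_partialD {f : CoordSpace → ℝ} {y : CoordSpace} (hf : ContDiffAt ℝ ∞ f y)
    (μ : Fin 4) : ContDiffAt ℝ ∞ (partialD μ f) y :=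
  (hf.fderiv_right (m := ∞) le_rfl).clm_apply contDiffAt_const

theorem contDiffAt_curvature {Γ : CoordSpace → Fin 4 → Fin 4 → Fin 4 → ℝ} {y : CoordSpace}
    (hΓ : ∀ lam μ ν, ContDiffAt ℝ ∞ (fun z => Γ z lam μ ν) y) (κ lam μ ν : Fin 4) :
    ContDiffAt ℝ ∞ (fun z => (curvature Γ z).1 κ lam μ ν) y :=
  (((contDiffAt_partialD (hΓ κ ν lam) μ).sub (contDiffAt_partialD (hΓ κ μ lam) ν)).add
    (ContDiffAt.sum fun η _ => (hΓ κ μ η).mul (hΓ η ν lam))).sub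
    (ContDiffAt.sum fun η _ => (hΓ κ ν η).mul (hΓ η μ lam))

theorem fderiv_apply_one_zero {V : Type*} [NormedAddCommGroup V] [NormedSpace ℝ V] {F : ℝ × V → ℝ}
    {y : V} {d t : ℝ} (hF : DifferentiableAt ℝ F (t, y))
    (hd : HasDerivAt (fun t => F (t, y)) d t) : fderiv ℝ F (t, y) (1, 0) = d :=
  (hF.hasFDerivAt.comp_hasDerivAt t
    ((hasDerivAt_id t).prodMk (hasDerivAt_const t y))).unique hd

/-- The derivative of the action along a family of metrics and curvatures is the multiple of the
derivative of the Yang–Mills action. -/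
theorem hasDerivAt_setIntegral_quadAt {q : QuadraticForm ℝ CurvatureTensor}
    (hq : IsLorentzInvariant q) {c : ℝ} {G : ℝ × CoordSpace → Matrix (Fin 4) (Fin 4) ℝ}
    {R : ℝ × CoordSpace → CurvatureTensor} {K U : Set CoordSpace} {d : CoordSpace → ℝ}
    (hK : IsCompact K) (hKU : K ⊆ U)
    (hG : ∀ y ∈ U, ∀ i j, ContDiffAt ℝ ∞ (fun p => G p i j) (0, y))
    (hGs : ∀ p, (G p)ᵀ = G p)
    (hR : ∀ y ∈ U, ∀ κ lam μ ν, ContDiffAt ℝ ∞ (fun p => (R p).1 κ lam μ ν) (0, y))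
    (hP : ∀ y ∈ U, ∃ P, IsOrthonormalFrame (G (0, y)) P ∧
      ∀ Q, QuadraticMap.polar q (frameChange P (R (0, y))) Q
        = c * ymPairing minkowski (frameChange P (R (0, y))) Q)
    (hd : ∀ y ∈ U, HasDerivAt (fun t => ymDensity (G (t, y)) (R (t, y))) (d y) 0) :
    HasDerivAt (fun t : ℝ => ∫ y in K, quadAt q (G (t, y)) (R (t, y)) * √|(G (t, y)).det|)
      (c / 2 * ∫ y in K, d y) 0 := by
  choose! P hP1 hP2 using hP
  have hreg := fun y (hy : y ∈ U) => density_regularity hq (n := ∞) (by simp) le_rfl (hG y hy)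
    (.of_forall hGs) (hR y hy) (hP1 y hy) (hP2 y hy)
  have h1 := hasDerivAt_setIntegral_of_contDiffAt (m := volume) hK
    (F := fun p : ℝ × CoordSpace => quadAt q (G p) (R p) * √|(G p).det|)
    fun y hy => (hreg y (hKU hy)).1.of_le (by simp)
  refine h1.congr_deriv ?_
  rw [← integral_const_mul]
  refine setIntegral_congr_fun hK.measurableSet fun y hy => ?_
  simp only [(hreg y (hKU hy)).2, smul_apply, smul_eq_mul]
  rw [fderiv_apply_one_zero _ (hd y (hKU hy))]
  exact (contDiffAt_ymDensity (hG y (hKU hy)) (hP1 y (hKU hy)).isUnit_det_metric.ne_zero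
    (hR y (hKU hy))).differentiableAt (by simp)

theorem contDiffAt_snd_of_contDiffAt {f : CoordSpace → ℝ} {t : ℝ} {y : CoordSpace}
    (hf : ContDiffAt ℝ ∞ f y) : ContDiffAt ℝ ∞ (fun p : ℝ × CoordSpace => f p.2) (t, y) :=
  ContDiffAt.comp (f := Prod.snd) (t, y) hf contDiffAt_snd

theorem hasDerivAt_action_metric {q : QuadraticForm ℝ CurvatureTensor}
    (hq : IsLorentzInvariant q) {i : PieceLabel}
    (hi : i = .scalar ∨ i = .pseudoscalar ∨ i = .weyl) {K U : Set CoordSpace}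
    {g h : CoordSpace → Matrix (Fin 4) (Fin 4) ℝ} {Γ : CoordSpace → Fin 4 → Fin 4 → Fin 4 → ℝ}
    (hK : IsCompact K) (hU : IsOpen U) (hKU : K ⊆ U)
    (hg : ∀ μ ν, ContDiffOn ℝ ∞ (fun y => g y μ ν) U) (hgs : ∀ y, (g y)ᵀ = g y)
    (hgP : ∀ y ∈ U, ∃ P, IsOrthonormalFrame (g y) P)
    (hΓ : ∀ lam μ ν, ContDiffOn ℝ ∞ (fun y => Γ y lam μ ν) U)
    (hpure : ∀ y ∈ U, IsPurely (g y) i (curvature Γ y))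
    (hh : ∀ μ ν, ContDiff ℝ ∞ fun y => h y μ ν) (hhs : ∀ y, (h y)ᵀ = h y) :
    HasDerivAt (fun t : ℝ => action q K (fun y => g y + t • h y) Γ) 0 0 := by
  obtain ⟨c, hc⟩ := exists_polar_eq_of_isPurely hq hi
  have hUn : ∀ y ∈ U, U ∈ 𝓝 y := fun y hy => hU.mem_nhds hy
  -- The connection is fixed, so the Yang–Mills density is stationary at each point separately and
  -- no integration by parts occurs.
  have key := hasDerivAt_setIntegral_quadAt hq (c := c) (K := K) (U := U) (d := 0)
    (G := fun p => g p.2 + p.1 • h p.2) (R := fun p => curvature Γ p.2) hK hKU ?_ ?_ ?_ ?_ ?_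
  · simpa [action] using key
  · intro y hy i j
    exact (contDiffAt_snd_of_contDiffAt ((hg i j).contDiffAt (hUn y hy))).add
      (contDiffAt_fst.mul (contDiffAt_snd_of_contDiffAt (hh i j).contDiffAt))
  · intro p
    simp [hgs, hhs]
  · intro y hy κ lam μ ν
    exact contDiffAt_snd_of_contDiffAt (f := fun y => (curvature Γ y).1 κ lam μ ν)
      (contDiffAt_curvature (fun lam μ ν => (hΓ lam μ ν).contDiffAt (hUn y hy)) κ lam μ ν)
  · intro y hy
    obtain ⟨P, hP⟩ := hgP y hy
    refine ⟨P, ?_, (hc _ P _ hP (hpure y hy)).2⟩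
    simpa using hP
  · intro y hy
    obtain ⟨P, hP⟩ := hgP y hy
    have hdd := (hc _ P _ hP (hpure y hy)).1
    have h0 : g y + (0 : ℝ) • h y = g y := by simp
    have hmat : HasMatrixDerivAt (fun t : ℝ => g y + t • h y) (h y) 0 := fun a b => by
      simpa using ((hasDerivAt_id (0 : ℝ)).mul_const (h y a b)).const_add (g y a b)
    refine hasDerivAt_ymDensity_metric (R := curvature Γ y) hmat ?_ ?_ ?_
    · rw [h0]
      exact hP.isUnit_det_metric
    · rw [h0, hgs]
    · rw [h0]
      exact hdd.stress

end MetricVariation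

/-! ### Covariant derivatives of endomorphism fields, the Bianchi identity and skewness of the
curvature. -/

section CovariantDerivative

open Topology

namespace HasMatrixDerivAt

variable {ι : Type*} {t₀ : ℝ} {A B : ℝ → Matrix ι ι ℝ} {A' B' : Matrix ι ι ℝ}

theorem add (hA : HasMatrixDerivAt A A' t₀) (hB : HasMatrixDerivAt B B' t₀) :
    HasMatrixDerivAt (fun t => A t + B t) (A' + B') t₀ := fun i j => (hA i j).add (hB i j)

theorem sub (hA : HasMatrixDerivAt A A' t₀) (hB : HasMatrixDerivAt B B' t₀) :
    HasMatrixDerivAt (fun t => A t - B t) (A' - B') t₀ := fun i j => (hA i j).sub (hB i j)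

theorem transpose (hA : HasMatrixDerivAt A A' t₀) :
    HasMatrixDerivAt (fun t => (A t)ᵀ) A'ᵀ t₀ := fun i j => hA j i

end HasMatrixDerivAt

/-- The line through `y` in the direction of the `μ`-th coordinate. -/
noncomputable def coordLine (y : CoordSpace) (μ : Fin 4) (s : ℝ) : CoordSpace :=
  y + s • EuclideanSpace.single μ 1

theorem coordLine_zero (y : CoordSpace) (μ : Fin 4) : coordLine y μ 0 = y := by
  simp [coordLine]

theorem tendsto_coordLine (y : CoordSpace) (μ : Fin 4) :
    Filter.Tendsto (coordLine y μ) (𝓝 0) (𝓝 y) := by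
  have h : Continuous (coordLine y μ) := by
    unfold coordLine
    fun_prop
  simpa [coordLine_zero] using h.tendsto 0

theorem hasDerivAt_coordLine {f : CoordSpace → ℝ} {y : CoordSpace} (hf : DifferentiableAt ℝ f y)
    (μ : Fin 4) : HasDerivAt (fun s => f (coordLine y μ s)) (partialD μ f y) 0 :=
  hf.hasFDerivAt.hasLineDerivAt _

theorem partialD_comm {f : CoordSpace → ℝ} {y : CoordSpace} (hf : ContDiffAt ℝ ∞ f y)
    (μ ν : Fin 4) : partialD μ (partialD ν f) y = partialD ν (partialD μ f) y := by
  have hd : DifferentiableAt ℝ (fderiv ℝ f) y :=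
    (hf.fderiv_right (m := ∞) le_rfl).differentiableAt (by simp)
  have h : ∀ α β, partialD α (partialD β f) y
      = fderiv ℝ (fderiv ℝ f) y (EuclideanSpace.single α 1) (EuclideanSpace.single β 1) := by
    intro α β
    change fderiv ℝ (fun z => fderiv ℝ f z (EuclideanSpace.single β 1)) y _ = _
    rw [fderiv_clm_apply hd (differentiableAt_const _)]
    simp
  rw [h, h]
  exact (hf.isSymmSndFDerivAt (by simpa using ENat.LEInfty.out)).eq _ _

/-- Smoothness of the entries of a matrix valued function. -/
def SmoothMatrixAt (X : CoordSpace → Matrix (Fin 4) (Fin 4) ℝ) (y : CoordSpace) : Prop :=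
  ∀ i j, ContDiffAt ℝ ∞ (fun z => X z i j) y

/-- The partial derivative of a matrix valued function. -/
noncomputable def partialMat (μ : Fin 4) (X : CoordSpace → Matrix (Fin 4) (Fin 4) ℝ)
    (y : CoordSpace) : Matrix (Fin 4) (Fin 4) ℝ :=
  Matrix.of fun i j => partialD μ (fun z => X z i j) y

variable {X Z : CoordSpace → Matrix (Fin 4) (Fin 4) ℝ} {y : CoordSpace}
  {Γ : CoordSpace → Fin 4 → Fin 4 → Fin 4 → ℝ}

theorem SmoothMatrixAt.hasMatrixDerivAt (hX : SmoothMatrixAt X y) (μ : Fin 4) :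
    HasMatrixDerivAt (fun s => X (coordLine y μ s)) (partialMat μ X y) 0 := fun i j =>
  hasDerivAt_coordLine ((hX i j).differentiableAt (by simp)) μ

theorem SmoothMatrixAt.partialMat (hX : SmoothMatrixAt X y) (μ : Fin 4) :
    SmoothMatrixAt (partialMat μ X) y := fun i j => contDiffAt_partialD (hX i j) μ

theorem SmoothMatrixAt.partialMat_comm (hX : SmoothMatrixAt X y) (μ ν : Fin 4) :
    _root_.partialMat μ (_root_.partialMat ν X) y
      = _root_.partialMat ν (_root_.partialMat μ X) y := by
  ext i j
  exact partialD_comm (hX i j) μ ν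

/-- The matrices `(Γ_μ)^κ_lam` of connection coefficients. -/
def connMat (Γ : CoordSpace → Fin 4 → Fin 4 → Fin 4 → ℝ) (μ : Fin 4) (y : CoordSpace) :
    Matrix (Fin 4) (Fin 4) ℝ :=
  Matrix.of fun κ lam => Γ y κ μ lam

theorem curvMat_curvature (Γ : CoordSpace → Fin 4 → Fin 4 → Fin 4 → ℝ) (y : CoordSpace)
    (μ ν : Fin 4) :
    curvMat (curvature Γ y) μ ν = partialMat μ (connMat Γ ν) y - partialMat ν (connMat Γ μ) y
      + connMat Γ μ y * connMat Γ ν y - connMat Γ ν y * connMat Γ μ y := by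
  ext κ lam
  simp [curvMat, curvature, partialMat, connMat, Matrix.mul_apply]

/-- The covariant derivative of a field of endomorphisms. -/
noncomputable def covDeriv (Γ : CoordSpace → Fin 4 → Fin 4 → Fin 4 → ℝ) (μ : Fin 4)
    (X : CoordSpace → Matrix (Fin 4) (Fin 4) ℝ) (y : CoordSpace) : Matrix (Fin 4) (Fin 4) ℝ :=
  partialMat μ X y + connMat Γ μ y * X y - X y * connMat Γ μ y

theorem HasMatrixDerivAt.partialMat_eq {X' : Matrix (Fin 4) (Fin 4) ℝ} {μ : Fin 4}
    (h : HasMatrixDerivAt (fun s => X (coordLine y μ s)) X' 0) (hX : SmoothMatrixAt X y) :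
    partialMat μ X y = X' :=
  (hX.hasMatrixDerivAt μ).unique h

theorem smoothMatrixAt_curvMat (hΓ : ∀ μ, SmoothMatrixAt (connMat Γ μ) y) (α β : Fin 4) :
    SmoothMatrixAt (fun z => curvMat (curvature Γ z) α β) y := fun κ lam =>
  contDiffAt_curvature (fun κ μ lam => hΓ μ κ lam) κ lam α β

theorem partialMat_curvMat (hΓ : ∀ μ, SmoothMatrixAt (connMat Γ μ) y) (μ α β : Fin 4) :
    partialMat μ (fun z => curvMat (curvature Γ z) α β) y
      = partialMat μ (partialMat α (connMat Γ β)) y - partialMat μ (partialMat β (connMat Γ α)) y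
        + (partialMat μ (connMat Γ α) y * connMat Γ β y
          + connMat Γ α y * partialMat μ (connMat Γ β) y)
        - (partialMat μ (connMat Γ β) y * connMat Γ α y
          + connMat Γ β y * partialMat μ (connMat Γ α) y) := by
  have hd := fun ν => (hΓ ν).hasMatrixDerivAt μ
  have h := (((((hΓ β).partialMat α).hasMatrixDerivAt μ).sub
    (((hΓ α).partialMat β).hasMatrixDerivAt μ)).add ((hd α).mul (hd β))).sub ((hd β).mul (hd α))
  simp only [← curvMat_curvature, coordLine_zero] at h
  exact h.partialMat_eq (X := fun z => curvMat (curvature Γ z) α β) (smoothMatrixAt_curvMat hΓ α β)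

/-- The second Bianchi identity. -/
theorem bianchi (hΓ : ∀ μ, SmoothMatrixAt (connMat Γ μ) y) (μ α β : Fin 4) :
    covDeriv Γ μ (fun z => curvMat (curvature Γ z) α β) y
      + covDeriv Γ α (fun z => curvMat (curvature Γ z) β μ) y
      + covDeriv Γ β (fun z => curvMat (curvature Γ z) μ α) y = 0 := by
  simp only [covDeriv, partialMat_curvMat hΓ]
  simp only [curvMat_curvature]
  -- After mixed partial derivatives are identified, only noncommutative algebra remains. Torsion
  -- does not enter, because `covDeriv` acts on the endomorphism indices alone.
  rw [(hΓ μ).partialMat_comm β α, (hΓ α).partialMat_comm μ β, (hΓ β).partialMat_comm μ α]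
  noncomm_ring

/-- The metric `g` is compatible with the connection `Γ` on `U`. -/
def IsCompatibleOn (g : CoordSpace → Matrix (Fin 4) (Fin 4) ℝ)
    (Γ : CoordSpace → Fin 4 → Fin 4 → Fin 4 → ℝ) (U : Set CoordSpace) : Prop :=
  ∀ y ∈ U, ∀ μ, partialMat μ g y = (connMat Γ μ y)ᵀ * g y + g y * connMat Γ μ y

variable {g : CoordSpace → Matrix (Fin 4) (Fin 4) ℝ} {U : Set CoordSpace}

/-- The curvature of a metric compatible connection is skew with respect to the metric. -/
theorem IsCompatibleOn.curvMat_skew (hc : IsCompatibleOn g Γ U) (hU : IsOpen U) (hy : y ∈ U)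
    (hg : SmoothMatrixAt g y) (hΓ : ∀ μ, SmoothMatrixAt (connMat Γ μ) y) (α β : Fin 4) :
    g y * curvMat (curvature Γ y) α β = -((curvMat (curvature Γ y) α β)ᵀ * g y) := by
  have h2 : ∀ α β, partialMat α (partialMat β g) y
      = (partialMat α (connMat Γ β) y)ᵀ * g y + (connMat Γ β y)ᵀ *
          ((connMat Γ α y)ᵀ * g y + g y * connMat Γ α y)
        + (((connMat Γ α y)ᵀ * g y + g y * connMat Γ α y) * connMat Γ β y
        + g y * partialMat α (connMat Γ β) y) := by
    intro α β
    have hd := (hΓ β).hasMatrixDerivAt α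
    have hgd := hg.hasMatrixDerivAt α
    have h := (hd.transpose.mul hgd).add (hgd.mul hd)
    simp only [coordLine_zero, hc y hy α] at h
    have hev : ∀ᶠ s in 𝓝 (0 : ℝ), partialMat β g (coordLine y α s)
        = (connMat Γ β (coordLine y α s))ᵀ * g (coordLine y α s)
          + g (coordLine y α s) * connMat Γ β (coordLine y α s) :=
      ((tendsto_coordLine y α).eventually (hU.mem_nhds hy)).mono fun s hs => hc _ hs β
    exact (h.congr_of_eventuallyEq hev).partialMat_eq (hg.partialMat β)
  -- Differentiating `∇g = 0` once more expresses second partial derivatives of `g` through the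
  -- connection; their symmetry is precisely the skewness of the curvature.
  have h3 := hg.partialMat_comm α β
  rw [h2, h2] at h3
  rw [← sub_eq_zero] at h3
  rw [curvMat_curvature, eq_neg_iff_add_eq_zero, ← h3]
  simp only [Matrix.transpose_add, Matrix.transpose_sub, Matrix.transpose_mul]
  noncomm_ring

end CovariantDerivative

/-! ### The Euler pairing and its product rule. -/

section EulerPairing

open Topology

theorem epsPair_add_left (U U' V : Matrix (Fin 4) (Fin 4) ℝ) :
    epsPair (U + U') V = epsPair U V + epsPair U' V := by
  simp only [epsPair, ← epsDualLin_apply, map_add, Matrix.transpose_add, Matrix.add_mul,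
    Matrix.trace_add]

theorem epsPair_add_right (U V V' : Matrix (Fin 4) (Fin 4) ℝ) :
    epsPair U (V + V') = epsPair U V + epsPair U V' := by
  simp only [epsPair, Matrix.mul_add, Matrix.trace_add]

theorem epsPair_neg_right (U V : Matrix (Fin 4) (Fin 4) ℝ) : epsPair U (-V) = -epsPair U V := by
  simp only [epsPair, Matrix.mul_neg, Matrix.trace_neg]

theorem epsPair_zero_right (U : Matrix (Fin 4) (Fin 4) ℝ) : epsPair U 0 = 0 := by
  simp only [epsPair, Matrix.mul_zero, Matrix.trace_zero]

theorem epsPair_sub_left (U U' V : Matrix (Fin 4) (Fin 4) ℝ) :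
    epsPair (U - U') V = epsPair U V - epsPair U' V := by
  rw [sub_eq_add_neg, epsPair_add_left, epsPair_neg_left, sub_eq_add_neg]

theorem epsPair_sub_right (U V V' : Matrix (Fin 4) (Fin 4) ℝ) :
    epsPair U (V - V') = epsPair U V - epsPair U V' := by
  rw [sub_eq_add_neg, epsPair_add_right, epsPair_neg_right, sub_eq_add_neg]

/-- The infinitesimal form of `epsPair_mul_mul`. -/
theorem epsPair_derivation (A U V : Matrix (Fin 4) (Fin 4) ℝ) :
    epsPair (A * U + U * Aᵀ) V + epsPair U (A * V + V * Aᵀ) = A.trace * epsPair U V := by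
  simp only [epsPair, epsDual_eq, Matrix.trace, Matrix.diag_apply, Fin.sum_univ_four,
    Matrix.mul_apply, Matrix.add_apply, Matrix.transpose_apply, Matrix.of_apply,
    Matrix.cons_val', Matrix.cons_val_zero, Matrix.cons_val_one, Matrix.cons_val,
    Matrix.cons_val_fin_one]
  ring

theorem HasMatrixDerivAt.epsPair {A B : ℝ → Matrix (Fin 4) (Fin 4) ℝ}
    {A' B' : Matrix (Fin 4) (Fin 4) ℝ} {t₀ : ℝ} (hA : HasMatrixDerivAt A A' t₀)
    (hB : HasMatrixDerivAt B B' t₀) :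
    HasDerivAt (fun t => _root_.epsPair (A t) (B t))
      (_root_.epsPair A' (B t₀) + _root_.epsPair (A t₀) B') t₀ := by
  have h : HasMatrixDerivAt (fun t => (epsDual (A t))ᵀ) (epsDual A')ᵀ t₀ := fun i j => by
    simp only [Matrix.transpose_apply, epsDual, Matrix.of_apply]
    exact HasDerivAt.fun_sum fun α _ => HasDerivAt.fun_sum fun β _ => (hA α β).mul_const _
  refine (h.mul hB).trace.congr_deriv ?_
  rw [Matrix.trace_add]
  rfl

/-- The density `√|det g| ε_{κλρσ} X^{κλ} Z^{ρσ}`. -/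
noncomputable def eulerPair (g X Z : Matrix (Fin 4) (Fin 4) ℝ) : ℝ :=
  √|g.det| * epsPair (X * g⁻¹) (Z * g⁻¹)

variable {X Z g : CoordSpace → Matrix (Fin 4) (Fin 4) ℝ} {U : Set CoordSpace} {y : CoordSpace}
  {Γ : CoordSpace → Fin 4 → Fin 4 → Fin 4 → ℝ}

/-- Metric compatibility makes `g⁻¹` and `√|det g| ε` parallel. In components, the trace of the
connection matrix arising from the volume factor cancels the one supplied by `epsPair_derivation`.
-/
theorem IsCompatibleOn.hasDerivAt_eulerPair (hc : IsCompatibleOn g Γ U) (hy : y ∈ U)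
    (hu : IsUnit (g y).det) (hg : SmoothMatrixAt g y) (hX : SmoothMatrixAt X y)
    (hZ : SmoothMatrixAt Z y) (μ : Fin 4) :
    HasDerivAt (fun s => eulerPair (g (coordLine y μ s)) (X (coordLine y μ s))
        (Z (coordLine y μ s)))
      (eulerPair (g y) (covDeriv Γ μ X y) (Z y) + eulerPair (g y) (X y) (covDeriv Γ μ Z y)) 0 := by
  have hgd := hg.hasMatrixDerivAt μ
  have hu' : IsUnit (g (coordLine y μ 0)).det := by rwa [coordLine_zero]
  have hi := hgd.inv hu'
  have hs := hgd.sqrt_abs_det hu'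
  have h := hs.mul (((hX.hasMatrixDerivAt μ).mul hi).epsPair ((hZ.hasMatrixDerivAt μ).mul hi))
  refine h.congr_deriv ?_
  simp only [coordLine_zero, hc y hy μ, eulerPair]
  have hinv : (g y)⁻¹ * ((connMat Γ μ y)ᵀ * g y + g y * connMat Γ μ y) * (g y)⁻¹
      = (g y)⁻¹ * (connMat Γ μ y)ᵀ + connMat Γ μ y * (g y)⁻¹ := by
    rw [Matrix.mul_add, Matrix.add_mul, ← Matrix.mul_assoc, ← Matrix.mul_assoc,
      Matrix.nonsing_inv_mul _ hu, Matrix.one_mul, Matrix.mul_assoc _ (g y),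
      Matrix.mul_nonsing_inv _ hu, Matrix.mul_one]
  have htr : ((g y)⁻¹ * ((connMat Γ μ y)ᵀ * g y + g y * connMat Γ μ y)).trace
      = 2 * (connMat Γ μ y).trace := by
    rw [Matrix.mul_add, Matrix.nonsing_inv_mul_cancel_left _ _ hu, Matrix.trace_add,
      Matrix.trace_mul_comm, Matrix.mul_assoc, Matrix.mul_nonsing_inv _ hu, Matrix.mul_one,
      Matrix.trace_transpose]
    ring
  have hprod : ∀ Y : CoordSpace → Matrix (Fin 4) (Fin 4) ℝ,
      partialMat μ Y y * (g y)⁻¹ + Y y * -((g y)⁻¹ * (connMat Γ μ y)ᵀ + connMat Γ μ y * (g y)⁻¹)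
        = covDeriv Γ μ Y y * (g y)⁻¹ - (connMat Γ μ y * (Y y * (g y)⁻¹)
          + Y y * (g y)⁻¹ * (connMat Γ μ y)ᵀ) := by
    intro Y
    simp only [covDeriv]
    noncomm_ring
  rw [hinv, htr, hprod, hprod, epsPair_sub_left, epsPair_sub_right]
  have hder := epsPair_derivation (connMat Γ μ y) (X y * (g y)⁻¹) (Z y * (g y)⁻¹)
  linear_combination (√|(g y).det|) * (-hder)

theorem contDiffAt_epsPair {E : Type*} [NormedAddCommGroup E] [NormedSpace ℝ E] {n : WithTop ℕ∞}
    {x : E} {A B : E → Matrix (Fin 4) (Fin 4) ℝ}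
    (hA : ∀ i j, ContDiffAt ℝ n (fun y => A y i j) x)
    (hB : ∀ i j, ContDiffAt ℝ n (fun y => B y i j) x) :
    ContDiffAt ℝ n (fun y => epsPair (A y) (B y)) x := by
  simp only [epsPair, epsDual, Matrix.trace, Matrix.diag_apply, Matrix.mul_apply,
    Matrix.transpose_apply, Matrix.of_apply]
  exact ContDiffAt.sum fun i _ => ContDiffAt.sum fun j _ =>
    (ContDiffAt.sum fun α _ => ContDiffAt.sum fun β _ => (hA α β).mul contDiffAt_const).mul (hB _ _)

theorem contDiffAt_eulerPair (hu : (g y).det ≠ 0) (hg : SmoothMatrixAt g y)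
    (hX : SmoothMatrixAt X y) (hZ : SmoothMatrixAt Z y) :
    ContDiffAt ℝ ∞ (fun z => eulerPair (g z) (X z) (Z z)) y :=
  (contDiffAt_sqrt_abs_det hg hu).mul (contDiffAt_epsPair
    (contDiffAt_matrix_mul hX (contDiffAt_matrix_inv hg hu))
    (contDiffAt_matrix_mul hZ (contDiffAt_matrix_inv hg hu)))

end EulerPairing

/-! ### The Yang–Mills variation in the connection as a divergence. -/

section ConnectionVariation

open Topology

variable {g : CoordSpace → Matrix (Fin 4) (Fin 4) ℝ} {U K : Set CoordSpace} {y : CoordSpace}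
  {Γ γ : CoordSpace → Fin 4 → Fin 4 → Fin 4 → ℝ}

/-- The part of `curvature (Γ + t γ)` which is linear in `t`. -/
noncomputable def linearVariation (Γ γ : CoordSpace → Fin 4 → Fin 4 → Fin 4 → ℝ) (y : CoordSpace) :
    CurvatureTensor :=
  ⟨fun κ lam μ ν => (covDeriv Γ μ (connMat γ ν) y - covDeriv Γ ν (connMat γ μ) y) κ lam, by
    intro κ lam μ ν
    simp⟩

/-- The part of `curvature (Γ + t γ)` which is quadratic in `t`. -/
noncomputable def quadraticVariation (γ : CoordSpace → Fin 4 → Fin 4 → Fin 4 → ℝ)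
    (y : CoordSpace) : CurvatureTensor :=
  ⟨fun κ lam μ ν => (connMat γ μ y * connMat γ ν y - connMat γ ν y * connMat γ μ y) κ lam, by
    intro κ lam μ ν
    simp⟩

theorem curvMat_linearVariation (Γ γ : CoordSpace → Fin 4 → Fin 4 → Fin 4 → ℝ) (y : CoordSpace)
    (μ ν : Fin 4) : curvMat (linearVariation Γ γ y) μ ν
      = covDeriv Γ μ (connMat γ ν) y - covDeriv Γ ν (connMat γ μ) y := rfl

theorem curvMat_quadraticVariation (γ : CoordSpace → Fin 4 → Fin 4 → Fin 4 → ℝ) (y : CoordSpace)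
    (μ ν : Fin 4) : curvMat (quadraticVariation γ y) μ ν
      = connMat γ μ y * connMat γ ν y - connMat γ ν y * connMat γ μ y := rfl

theorem connMat_add_smul (t : ℝ) (μ : Fin 4) (y : CoordSpace) :
    connMat (fun z => Γ z + t • γ z) μ y = connMat Γ μ y + t • connMat γ μ y := rfl

theorem partialMat_connMat_add_smul (hΓ : ∀ μ, SmoothMatrixAt (connMat Γ μ) y)
    (hγ : ∀ μ, SmoothMatrixAt (connMat γ μ) y) (t : ℝ) (μ ν : Fin 4) :
    partialMat μ (connMat (fun z => Γ z + t • γ z) ν) y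
      = partialMat μ (connMat Γ ν) y + t • partialMat μ (connMat γ ν) y := by
  ext i j
  have h1 := ((hΓ ν i j).differentiableAt (by simp)).hasFDerivAt
  have h2 := ((hγ ν i j).differentiableAt (by simp)).hasFDerivAt
  exact congrArg (fun L => L (EuclideanSpace.single μ 1)) (h1.add (h2.const_mul t)).fderiv

theorem curvature_add_smul (hΓ : ∀ μ, SmoothMatrixAt (connMat Γ μ) y)
    (hγ : ∀ μ, SmoothMatrixAt (connMat γ μ) y) (t : ℝ) :
    curvature (fun z => Γ z + t • γ z) y
      = curvature Γ y + t • linearVariation Γ γ y + t ^ 2 • quadraticVariation γ y := by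
  refine curvMat_ext fun μ ν => ?_
  simp only [curvMat_add, curvMat_smul, curvMat_curvature, curvMat_linearVariation,
    curvMat_quadraticVariation, partialMat_connMat_add_smul hΓ hγ, connMat_add_smul, covDeriv,
    Matrix.add_mul, Matrix.mul_add, Matrix.smul_mul, Matrix.mul_smul, smul_sub, smul_add, smul_smul,
    pow_two]
  abel

theorem smoothMatrixAt_covDeriv (hΓ : ∀ μ, SmoothMatrixAt (connMat Γ μ) y)
    {X : CoordSpace → Matrix (Fin 4) (Fin 4) ℝ} (hX : SmoothMatrixAt X y) (μ : Fin 4) :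
    SmoothMatrixAt (covDeriv Γ μ X) y := fun i j =>
  ((hX.partialMat μ i j).add (contDiffAt_matrix_mul (hΓ μ) hX i j)).sub
    (contDiffAt_matrix_mul hX (hΓ μ) i j)

theorem hasDerivAt_ymDensity_curvature {G : Matrix (Fin 4) (Fin 4) ℝ} (hG : (G⁻¹)ᵀ = G⁻¹)
    (R W V : CurvatureTensor) :
    HasDerivAt (fun t : ℝ => ymDensity G (R + t • W + t ^ 2 • V))
      (2 * ymPairing G R W * √|G.det|) 0 := by
  have hr : ∀ A B C, ymPairing G A (B + C) = ymPairing G A B + ymPairing G A C := fun A B C => by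
    rw [ymPairing_comm hG, ymPairing_add_left, ymPairing_comm hG B, ymPairing_comm hG C]
  have hs : ∀ s A B, ymPairing G A (s • B) = s * ymPairing G A B := fun s A B => by
    rw [ymPairing_comm hG, ymPairing_smul_left, ymPairing_comm hG B]
  have h : (fun t : ℝ => ymDensity G (R + t • W + t ^ 2 • V)) = fun t =>
      (ymPairing G R R + t * (2 * ymPairing G R W) + t ^ 2 * (ymPairing G W W
        + 2 * ymPairing G R V + t * (2 * ymPairing G W V) + t ^ 2 * ymPairing G V V))
        * √|G.det| := by
    ext t
    simp only [ymDensity, ymPairing_add_left, ymPairing_smul_left, hr, hs]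
    rw [ymPairing_comm hG W R, ymPairing_comm hG V R, ymPairing_comm hG V W]
    ring
  rw [h]
  refine HasDerivAt.mul_const ?_ _
  have h1 := hasDerivAt_id (0 : ℝ)
  have h2 := hasDerivAt_pow 2 (0 : ℝ)
  refine (((h1.mul_const (2 * ymPairing G R W)).const_add (ymPairing G R R)).add
    (h2.mul (((h1.mul_const (2 * ymPairing G W V)).const_add
      (ymPairing G W W + 2 * ymPairing G R V)).add (h2.mul_const (ymPairing G V V))))).congr_deriv ?_
  simp

/-- The duality identity is applied with `Z` equal to each component of `W`. It trades both
contractions of form indices for the constant symbol, so that the metric survives only inside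
`epsPair`. -/
theorem IsDoubleDual.ymPairing_eq {G : Matrix (Fin 4) (Fin 4) ℝ} {R : CurvatureTensor}
    (hR : IsDoubleDual G R) (hG : (G⁻¹)ᵀ = G⁻¹) (W : CurvatureTensor) :
    ymPairing G R W = -1 / 4 * ∑ μ, ∑ ν, ∑ α, ∑ β, leviCivitaSymbol α β μ ν *
      epsPair (curvMat R α β * G⁻¹) (curvMat W μ ν * G⁻¹) := by
  have hs : ∀ i j, G⁻¹ i j = G⁻¹ j i := fun i j => congrFun (congrFun hG j) i
  have h1 : ymPairing G R W = ∑ μ', ∑ ν', (G⁻¹ * (Matrix.of fun μ ν =>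
      (curvMat R μ ν * curvMat W μ' ν').trace) * G⁻¹) μ' ν' := by
    simp only [ymPairing, ymStress, Matrix.of_apply, Matrix.mul_apply, Finset.mul_sum,
      Finset.sum_mul]
    rw [Finset.sum_comm]
    refine Finset.sum_congr rfl fun a _ => ?_
    rw [Finset.sum_comm_cycle]
    refine Finset.sum_congr rfl fun b _ => ?_
    rw [Finset.sum_comm]
    refine Finset.sum_congr rfl fun c _ => Finset.sum_congr rfl fun d _ => ?_
    rw [hs d a]
    ring
  rw [h1, Finset.mul_sum]
  refine Finset.sum_congr rfl fun μ _ => ?_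
  rw [Finset.mul_sum]
  refine Finset.sum_congr rfl fun ν _ => ?_
  rw [hR.dual, Matrix.smul_apply, smul_eq_mul]
  congr 1
  simp only [epsDual, Matrix.of_apply]
  exact Finset.sum_congr rfl fun _ _ => Finset.sum_congr rfl fun _ _ => mul_comm _ _

theorem sum_eq_zero_of_cyclic {ι : Type*} [Fintype ι] {f : ι → ι → ι → ℝ}
    (h : ∀ a b c, f a b c + f b c a + f c a b = 0) : ∑ a, ∑ b, ∑ c, f a b c = 0 := by
  have h1 : ∑ a, ∑ b, ∑ c, f b c a = ∑ a, ∑ b, ∑ c, f a b c := by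
    rw [← Finset.sum_comm_cycle]
  have h2 : ∑ a, ∑ b, ∑ c, f c a b = ∑ a, ∑ b, ∑ c, f a b c := by
    rw [Finset.sum_comm_cycle]
  have h3 : ∑ a, ∑ b, ∑ c, (f a b c + f b c a + f c a b) = 0 := by simp [h]
  simp only [Finset.sum_add_distrib] at h3
  linarith

theorem eulerPair_add_left (G X X' Z : Matrix (Fin 4) (Fin 4) ℝ) :
    eulerPair G (X + X') Z = eulerPair G X Z + eulerPair G X' Z := by
  simp only [eulerPair, Matrix.add_mul, epsPair_add_left, mul_add]

theorem eulerPair_sub_right (G X Z Z' : Matrix (Fin 4) (Fin 4) ℝ) :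
    eulerPair G X (Z - Z') = eulerPair G X Z - eulerPair G X Z' := by
  simp only [eulerPair, Matrix.sub_mul, epsPair_sub_right, mul_sub]

theorem eulerPair_zero_left (G Z : Matrix (Fin 4) (Fin 4) ℝ) : eulerPair G 0 Z = 0 := by
  simp only [eulerPair, Matrix.zero_mul, epsPair_zero_left, mul_zero]

theorem eulerPair_zero_right (G X : Matrix (Fin 4) (Fin 4) ℝ) : eulerPair G X 0 = 0 := by
  simp only [eulerPair, Matrix.zero_mul, epsPair_zero_right, mul_zero]

/-- The vector density whose divergence is the variation of the Yang–Mills density. -/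
noncomputable def eulerCurrent (g : CoordSpace → Matrix (Fin 4) (Fin 4) ℝ)
    (Γ γ : CoordSpace → Fin 4 → Fin 4 → Fin 4 → ℝ) (μ : Fin 4) (y : CoordSpace) : ℝ :=
  ∑ ν, ∑ α, ∑ β, leviCivitaSymbol α β μ ν *
    eulerPair (g y) (curvMat (curvature Γ y) α β) (connMat γ ν y)

theorem contDiffAt_eulerCurrent (hu : (g y).det ≠ 0) (hg : SmoothMatrixAt g y)
    (hΓ : ∀ μ, SmoothMatrixAt (connMat Γ μ) y) (hγ : ∀ μ, SmoothMatrixAt (connMat γ μ) y)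
    (μ : Fin 4) : ContDiffAt ℝ ∞ (eulerCurrent g Γ γ μ) y :=
  ContDiffAt.sum fun ν _ => ContDiffAt.sum fun α _ => ContDiffAt.sum fun β _ =>
    contDiffAt_const.mul (contDiffAt_eulerPair hu hg (smoothMatrixAt_curvMat hΓ α β) (hγ ν))

/-- By the product rule the divergence has two groups of terms. Those differentiating the curvature
carry a symbol invariant under cyclic permutations of `μ, α, β`, so they cancel by the Bianchi
identity. -/
theorem IsCompatibleOn.sum_partialD_eulerCurrent (hc : IsCompatibleOn g Γ U) (hy : y ∈ U)
    (hu : IsUnit (g y).det) (hg : SmoothMatrixAt g y) (hΓ : ∀ μ, SmoothMatrixAt (connMat Γ μ) y)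
    (hγ : ∀ μ, SmoothMatrixAt (connMat γ μ) y) :
    ∑ μ, partialD μ (eulerCurrent g Γ γ μ) y = ∑ μ, ∑ ν, ∑ α, ∑ β, leviCivitaSymbol α β μ ν *
      eulerPair (g y) (curvMat (curvature Γ y) α β) (covDeriv Γ μ (connMat γ ν) y) := by
  have hR := smoothMatrixAt_curvMat hΓ
  have h1 : ∀ μ, partialD μ (eulerCurrent g Γ γ μ) y
      = ∑ ν, ∑ α, ∑ β, leviCivitaSymbol α β μ ν *
        (eulerPair (g y) (covDeriv Γ μ (fun z => curvMat (curvature Γ z) α β) y) (connMat γ ν y)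
          + eulerPair (g y) (curvMat (curvature Γ y) α β) (covDeriv Γ μ (connMat γ ν) y)) := by
    intro μ
    exact (hasDerivAt_coordLine ((contDiffAt_eulerCurrent hu.ne_zero hg hΓ hγ μ).differentiableAt
      (by simp)) μ).unique (HasDerivAt.fun_sum fun ν _ => HasDerivAt.fun_sum fun α _ =>
        HasDerivAt.fun_sum fun β _ =>
          (hc.hasDerivAt_eulerPair hy hu hg (hR α β) (hγ ν) μ).const_mul _)
  simp only [h1, mul_add, Finset.sum_add_distrib]
  rw [add_eq_right, Finset.sum_comm]
  refine Finset.sum_eq_zero fun ν _ => sum_eq_zero_of_cyclic fun μ α β => ?_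
  have hε1 : leviCivitaSymbol β μ α ν = leviCivitaSymbol α β μ ν := by
    simp only [leviCivitaSymbol_eq]
    ring
  have hε2 : leviCivitaSymbol μ α β ν = leviCivitaSymbol α β μ ν := by
    simp only [leviCivitaSymbol_eq]
    ring
  rw [hε1, hε2, ← mul_add, ← mul_add, ← eulerPair_add_left, ← eulerPair_add_left, bianchi hΓ,
    eulerPair_zero_left, mul_zero]

/-- The variation of the curvature is antisymmetrised in `μ, ν`, and against the symbol its two
terms contribute equally. Together with the factor 2 on the left and the `-1/4` of
`IsDoubleDual.ymPairing_eq` this gives `-1`. -/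
theorem IsCompatibleOn.ymPairing_linearVariation (hc : IsCompatibleOn g Γ U) (hy : y ∈ U)
    (hu : IsUnit (g y).det) (hgs : ((g y)⁻¹)ᵀ = (g y)⁻¹) (hg : SmoothMatrixAt g y)
    (hΓ : ∀ μ, SmoothMatrixAt (connMat Γ μ) y) (hγ : ∀ μ, SmoothMatrixAt (connMat γ μ) y)
    (hR : IsDoubleDual (g y) (curvature Γ y)) :
    2 * ymPairing (g y) (curvature Γ y) (linearVariation Γ γ y) * √|(g y).det|
      = -∑ μ, partialD μ (eulerCurrent g Γ γ μ) y := by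
  rw [hc.sum_partialD_eulerCurrent hy hu hg hΓ hγ, hR.ymPairing_eq hgs]
  set f : Fin 4 → Fin 4 → Fin 4 → Fin 4 → ℝ := fun μ ν α β => leviCivitaSymbol α β μ ν *
    eulerPair (g y) (curvMat (curvature Γ y) α β) (covDeriv Γ μ (connMat γ ν) y) with hf
  have h1 : (∑ μ, ∑ ν, ∑ α, ∑ β, leviCivitaSymbol α β μ ν *
      epsPair (curvMat (curvature Γ y) α β * (g y)⁻¹)
        (curvMat (linearVariation Γ γ y) μ ν * (g y)⁻¹)) * √|(g y).det|
      = ∑ μ, ∑ ν, ∑ α, ∑ β, (f μ ν α β + f ν μ α β) := by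
    simp only [Finset.sum_mul]
    refine Finset.sum_congr rfl fun μ _ => Finset.sum_congr rfl fun ν _ =>
      Finset.sum_congr rfl fun α _ => Finset.sum_congr rfl fun β _ => ?_
    have hε : leviCivitaSymbol α β ν μ = -leviCivitaSymbol α β μ ν := by
      simp only [leviCivitaSymbol_eq]
      ring
    simp only [hf, hε, curvMat_linearVariation]
    have h2 := eulerPair_sub_right (g y) (curvMat (curvature Γ y) α β)
      (covDeriv Γ μ (connMat γ ν) y) (covDeriv Γ ν (connMat γ μ) y)
    rw [neg_mul, ← sub_eq_add_neg, ← mul_sub, ← h2, eulerPair]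
    ring
  have h2 : ∑ μ, ∑ ν, ∑ α, ∑ β, f ν μ α β = ∑ μ, ∑ ν, ∑ α, ∑ β, f μ ν α β := Finset.sum_comm
  simp only [Finset.sum_add_distrib, h2] at h1
  linear_combination (-1 / 2) * h1

/-- The integral of the derivative of a compactly supported function vanishes. -/
theorem integral_fderiv_apply_eq_zero {V : Type*} [NormedAddCommGroup V] [NormedSpace ℝ V]
    [FiniteDimensional ℝ V] [MeasurableSpace V] [BorelSpace V] {m : Measure V}
    [m.IsAddHaarMeasure] {f : V → ℝ} (hf : ContDiff ℝ 1 f) (hc : HasCompactSupport f) (v : V) :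
    ∫ x, fderiv ℝ f x v ∂m = 0 := by
  have hi : Integrable (fun x => fderiv ℝ f x v) m :=
    Continuous.integrable_of_hasCompactSupport (by fun_prop) (hc.fderiv_apply ℝ v)
  -- Integration by parts against the constant function 1.
  have h := integral_mul_fderiv_eq_neg_fderiv_mul_of_integrable (μ := m) (f := fun _ : V => (1 : ℝ))
    (g := f) (v := v) (by simp) (by simpa using hi)
    (by simpa using hf.continuous.integrable_of_hasCompactSupport hc)
    (fun _ _ => differentiableAt_const _) (fun x _ => hf.differentiable (by simp) x)
  simpa using h

/-- The integral of the divergence of a vector field supported in a compact set vanishes. -/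
theorem setIntegral_partialD_eq_zero {f : CoordSpace → ℝ} (hK : IsCompact K)
    (hf : ∀ y ∈ K, ContDiffAt ℝ ∞ f y) (h0 : ∀ y ∉ K, f y = 0) (μ : Fin 4) :
    ∫ y in K, partialD μ f y = 0 := by
  -- The complement of `K` is open, so `f` vanishes near each of its points. This makes `f` smooth
  -- everywhere although smoothness is assumed only at points of `K`.
  have hev : ∀ y ∉ K, f =ᶠ[𝓝 y] 0 := fun y hy => by
    filter_upwards [hK.isClosed.isOpen_compl.mem_nhds hy] with z hz
    exact h0 z hz
  have hcd : ContDiff ℝ ∞ f := contDiff_iff_contDiffAt.2 fun y => by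
    by_cases hy : y ∈ K
    · exact hf y hy
    · exact contDiffAt_const.congr_of_eventuallyEq (hev y hy)
  have h1 := integral_fderiv_apply_eq_zero (m := volume) (hcd.of_le (by simp))
    (HasCompactSupport.intro hK h0) (EuclideanSpace.single μ 1)
  rw [← h1]
  refine setIntegral_eq_integral_of_forall_compl_eq_zero fun y hy => ?_
  rw [partialD, (hev y hy).fderiv_eq]
  simp

end ConnectionVariation

/-! ### Smoothness and signature of the components in a chart. -/

section Charts
open Topology Bundle
variable {M : Type*} [TopologicalSpace M] [ChartedSpace CoordSpace M]

theorem mdifferentiable_of_mem_maximalAtlas {e : OpenPartialHomeomorph M CoordSpace}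
    (he : e ∈ IsManifold.maximalAtlas 𝓘(ℝ, CoordSpace) ∞ M) :
    e.MDifferentiable 𝓘(ℝ, CoordSpace) 𝓘(ℝ, CoordSpace) :=
  ⟨(contMDiffOn_of_mem_maximalAtlas he).mdifferentiableOn (by simp),
    (contMDiffOn_symm_of_mem_maximalAtlas he).mdifferentiableOn (by simp)⟩

variable [IsManifold 𝓘(ℝ, CoordSpace) ∞ M]

theorem contMDiffAt_coordField {e : OpenPartialHomeomorph M CoordSpace}
    (he : e ∈ IsManifold.maximalAtlas 𝓘(ℝ, CoordSpace) ∞ M) (μ : Fin 4) {x : M}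
    (hx : x ∈ e.source) :
    ContMDiffAt 𝓘(ℝ, CoordSpace) (𝓘(ℝ, CoordSpace).prod 𝓘(ℝ, CoordSpace)) ∞
      (fun x => TotalSpace.mk' CoordSpace (E := fun x : M => TangentSpace 𝓘(ℝ, CoordSpace) x) x
        (coordField e μ x)) x := by
  refine ContMDiffAt.mpullback_vectorField_preimage (n := ∞) ?_
    ((contMDiffOn_of_mem_maximalAtlas he).contMDiffAt (e.open_source.mem_nhds hx)) ?_ (by simp)
  · exact contMDiffAt_vectorSpace_iff_contDiffAt.2 contDiffAt_const
  · exact ⟨(mdifferentiable_of_mem_maximalAtlas he).mfderiv hx, rfl⟩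

theorem exists_orthonormalFrame (S : Spacetime M) {e : OpenPartialHomeomorph M CoordSpace}
    (he : e ∈ IsManifold.maximalAtlas 𝓘(ℝ, CoordSpace) ∞ M) {y : CoordSpace} (hy : y ∈ e.target) :
    ∃ P, IsOrthonormalFrame (S.metricComp e y) P := by
  have hx := e.map_target hy
  obtain ⟨b, hb⟩ := S.metric_lorentzian (e.symm y)
  let D : TangentSpace 𝓘(ℝ, CoordSpace) (e.symm y) ≃L[ℝ] CoordSpace :=
    (mdifferentiable_of_mem_maximalAtlas he).mfderiv hx
  have hc : ∀ μ, coordField e μ (e.symm y) = D.symm (EuclideanSpace.single μ 1) := by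
    intro μ
    change (mfderiv 𝓘(ℝ, CoordSpace) 𝓘(ℝ, CoordSpace) e (e.symm y)).inverse _ = _
    have : mfderiv 𝓘(ℝ, CoordSpace) 𝓘(ℝ, CoordSpace) e (e.symm y)
      = (mdifferentiable_of_mem_maximalAtlas he).mfderiv hx := rfl
    rw [this, ContinuousLinearMap.inverse_equiv]
    rfl
  have hbi : ∀ i, b i = ∑ μ, D (b i) μ • coordField e μ (e.symm y) := by
    intro i
    apply D.injective
    simp only [hc]
    rw [map_sum]
    simp only [map_smul, ContinuousLinearEquiv.apply_symm_apply]
    have := (EuclideanSpace.basisFun (Fin 4) ℝ).sum_repr (D (b i))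
    simp only [EuclideanSpace.basisFun_repr, EuclideanSpace.basisFun_apply] at this
    exact this.symm
  -- The columns of the frame are the chart components of a basis orthonormal for the metric at the
  -- point.
  refine ⟨Matrix.of fun μ i => D (b i) μ, ?_⟩
  ext i j
  rw [← hb i j]
  conv_rhs => rw [hbi i, hbi j]
  simp only [map_sum, map_smul, sum_apply, smul_apply,
    Matrix.mul_apply, Matrix.transpose_apply, Matrix.of_apply, Spacetime.metricComp, smul_eq_mul,
    Finset.sum_mul, Finset.mul_sum]
  refine Finset.sum_congr rfl fun μ _ => Finset.sum_congr rfl fun ν _ => ?_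
  ring

theorem Spacetime.metricComp_symm (S : Spacetime M) (e : OpenPartialHomeomorph M CoordSpace)
    (y : CoordSpace) : (S.metricComp e y)ᵀ = S.metricComp e y := by
  ext μ ν
  exact S.metric_symm _ _ _

theorem Spacetime.contDiffOn_metricComp (S : Spacetime M) {e : OpenPartialHomeomorph M CoordSpace}
    (he : e ∈ IsManifold.maximalAtlas 𝓘(ℝ, CoordSpace) ∞ M) (μ ν : Fin 4) :
    ContDiffOn ℝ ∞ (fun y => S.metricComp e y μ ν) e.target := by
  intro y hy
  have hx := e.map_target hy
  have h1 := ContMDiffAt.clm_bundle_apply₂ (b := fun x : M => x)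
    (F₃ := ℝ) (E₃ := fun _ : M => ℝ)
    (S.metric_smooth (e.symm y)) (contMDiffAt_coordField he μ hx) (contMDiffAt_coordField he ν hx)
  rw [contMDiffAt_section] at h1
  have h2 := h1.comp y ((contMDiffOn_symm_of_mem_maximalAtlas he).contMDiffAt
    (e.open_target.mem_nhds hy))
  exact (contMDiffAt_iff_contDiffAt.1 h2).contDiffWithinAt

/-- The smoothness of the connection is applied to globally smooth fields, while coordinate fields
are controlled only on the chart domain. They are multiplied by a bump function equal to 1 near the
point; by locality the connection does not see the change there. -/
theorem Spacetime.contDiffOn_connComp [T2Space M] (S : Spacetime M)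
    {e : OpenPartialHomeomorph M CoordSpace}
    (he : e ∈ IsManifold.maximalAtlas 𝓘(ℝ, CoordSpace) ∞ M) (lam μ ν : Fin 4) :
    ContDiffOn ℝ ∞ (fun y => S.connComp e y lam μ ν) e.target := by
  intro y hy
  have hx := e.map_target hy
  obtain ⟨ψ, -, hψ⟩ := (SmoothBumpFunction.nhds_basis_tsupport (I := 𝓘(ℝ, CoordSpace))
    (e.symm y)).mem_iff.1 (e.open_source.mem_nhds hx)
  have hσ := ContMDiffOn.smul_section_of_tsupport (ψ := ψ) (ψ.contMDiff.contMDiffOn) e.open_source hψ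
    (fun x hx => (contMDiffAt_coordField he ν hx).contMDiffWithinAt)
  have h1 := S.connection_smooth.contMDiff.contMDiff (σ := (⇑ψ) • coordField e ν) hσ.contMDiffOn
  rw [contMDiffOn_univ] at h1
  have h2 := ContMDiffAt.clm_bundle_apply (b := fun x : M => x) (h1 (e.symm y))
    (contMDiffAt_coordField he μ hx)
  have hsm : ContMDiffAt 𝓘(ℝ, CoordSpace) 𝓘(ℝ, CoordSpace) ∞ e.symm y :=
    (contMDiffOn_symm_of_mem_maximalAtlas he).contMDiffAt (e.open_target.mem_nhds hy)
  have h3 := h2.mpullback_vectorField_preimage (f := e.symm) (n := ∞) hsm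
    ⟨(mdifferentiable_of_mem_maximalAtlas he).symm.mfderiv hy, rfl⟩ (by simp)
  have h4 := contMDiffAt_vectorSpace_iff_contDiffAt.1 h3
  have h5 : ContDiffAt ℝ ∞ _ y := ((EuclideanSpace.proj (𝕜 := ℝ) lam).contDiff.contDiffAt).comp y h4
  refine (h5.congr_of_eventuallyEq ?_).contDiffWithinAt
  have hev : ∀ᶠ x in 𝓝 (e.symm y), ψ x = 1 := ψ.eventuallyEq_one
  have hev2 := hsm.continuousAt.eventually (hev.eventually_nhds)
  filter_upwards [hev2, e.open_target.mem_nhds hy] with z hz hzt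
  have hzx := e.map_target hzt
  have hcov : S.connection (coordField e ν) (e.symm z)
      = S.connection ((⇑ψ) • coordField e ν) (e.symm z) := by
    refine IsCovariantDerivativeOn.congr_of_eventuallyEq (s := Set.univ) (F := CoordSpace)
      S.connection.isCovariantDerivativeOnUniv ?_ ?_ Filter.univ_mem ?_
    · exact (contMDiffAt_coordField he ν hzx).mdifferentiableAt (by simp)
    · exact (hσ (e.symm z)).mdifferentiableAt (by simp)
    · filter_upwards [hz] with x hx
      simp [hx]
  have hinv : mfderiv 𝓘(ℝ, CoordSpace) 𝓘(ℝ, CoordSpace) e (e.symm z)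
      = (mfderiv 𝓘(ℝ, CoordSpace) 𝓘(ℝ, CoordSpace) e.symm z).inverse := by
    have h6 : mfderiv 𝓘(ℝ, CoordSpace) 𝓘(ℝ, CoordSpace) e.symm z
      = (mdifferentiable_of_mem_maximalAtlas he).symm.mfderiv hzt := rfl
    rw [h6, ContinuousLinearMap.inverse_equiv]
    rfl
  simp only [Spacetime.connComp]
  rw [hcov, hinv]
  rfl
end Charts

/-! ### Stationarity of the action in the connection. -/

section ConnectionAction

open Topology

/-- The derivative is `c/2` times the integral of minus the divergence of `eulerCurrent`. This
current is linear in `γ`, hence vanishes off `K`, and the integral is zero. -/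
theorem hasDerivAt_action_connection {q : QuadraticForm ℝ CurvatureTensor}
    (hq : IsLorentzInvariant q) {i : PieceLabel}
    (hi : i = .scalar ∨ i = .pseudoscalar ∨ i = .weyl) {K U : Set CoordSpace}
    {g : CoordSpace → Matrix (Fin 4) (Fin 4) ℝ} {Γ γ : CoordSpace → Fin 4 → Fin 4 → Fin 4 → ℝ}
    (hK : IsCompact K) (hU : IsOpen U) (hKU : K ⊆ U)
    (hg : ∀ μ ν, ContDiffOn ℝ ∞ (fun y => g y μ ν) U) (hgs : ∀ y, (g y)ᵀ = g y)
    (hgP : ∀ y ∈ U, ∃ P, IsOrthonormalFrame (g y) P)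
    (hΓ : ∀ lam μ ν, ContDiffOn ℝ ∞ (fun y => Γ y lam μ ν) U) (hc : IsCompatibleOn g Γ U)
    (hpure : ∀ y ∈ U, IsPurely (g y) i (curvature Γ y))
    (hγ : ∀ lam μ ν, ContDiff ℝ ∞ fun y => γ y lam μ ν) (hγ0 : ∀ y ∉ K, γ y = 0) :
    HasDerivAt (fun t : ℝ => action q K g (fun y => Γ y + t • γ y)) 0 0 := by
  obtain ⟨c, hcq⟩ := exists_polar_eq_of_isPurely hq hi
  have hUn : ∀ y ∈ U, U ∈ 𝓝 y := fun y hy => hU.mem_nhds hy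
  have hgm : ∀ y ∈ U, SmoothMatrixAt g y := fun y hy i j => (hg i j).contDiffAt (hUn y hy)
  have hΓm : ∀ y ∈ U, ∀ μ, SmoothMatrixAt (connMat Γ μ) y := fun y hy μ κ lam =>
    (hΓ κ μ lam).contDiffAt (hUn y hy)
  have hγm : ∀ y, ∀ μ, SmoothMatrixAt (connMat γ μ) y := fun y μ κ lam => (hγ κ μ lam).contDiffAt
  have hcurv : ∀ y ∈ U, ∀ t : ℝ, curvature (fun z => Γ z + t • γ z) y = curvature Γ y
      + t • linearVariation Γ γ y + t ^ 2 • quadraticVariation γ y := fun y hy t =>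
    curvature_add_smul (hΓm y hy) (hγm y) t
  have hcurv0 : ∀ y, curvature (fun z => Γ z + (0 : ℝ) • γ z) y = curvature Γ y := by simp
  have key := hasDerivAt_setIntegral_quadAt hq (c := c) (K := K) (U := U)
    (d := fun y => -∑ μ, partialD μ (eulerCurrent g Γ γ μ) y)
    (G := fun p => g p.2) (R := fun p => curvature (fun z => Γ z + p.1 • γ z) p.2) hK hKU
    ?_ ?_ ?_ ?_ ?_
  · have hsm : ∀ μ, ∀ y ∈ K, ContDiffAt ℝ ∞ (eulerCurrent g Γ γ μ) y := fun μ y hy => by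
      obtain ⟨P, hP⟩ := hgP y (hKU hy)
      exact contDiffAt_eulerCurrent hP.isUnit_det_metric.ne_zero (hgm y (hKU hy)) (hΓm y (hKU hy))
        (hγm y) μ
    have hint : ∫ y in K, -∑ μ, partialD μ (eulerCurrent g Γ γ μ) y = 0 := by
      rw [integral_neg, integral_finsetSum]
      · refine neg_eq_zero.2 (Finset.sum_eq_zero fun μ _ => ?_)
        refine setIntegral_partialD_eq_zero hK (hsm μ) (fun y hy => ?_) μ
        have h0 : ∀ ν, connMat γ ν y = 0 := fun ν => by
          ext κ lam
          simp [connMat, hγ0 y hy]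
        simp [eulerCurrent, h0, eulerPair_zero_right]
      · intro μ _
        refine ContinuousOn.integrableOn_compact hK fun y hy => ?_
        exact (contDiffAt_partialD (hsm μ y hy) μ).continuousAt.continuousWithinAt
    rw [hint, mul_zero] at key
    exact key
  · intro y hy i j
    exact contDiffAt_snd_of_contDiffAt (hgm y hy i j)
  · exact fun p => hgs _
  · intro y hy κ lam μ ν
    -- Near points of `U` the varied curvature is a polynomial in `t` with smooth coefficients,
    -- which gives joint smoothness in `t` and position.
    have hev : (fun p : ℝ × CoordSpace => (curvature (fun z => Γ z + p.1 • γ z) p.2).1 κ lam μ ν)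
        =ᶠ[𝓝 ((0 : ℝ), y)] fun p => curvMat (curvature Γ p.2) μ ν κ lam
          + p.1 * (covDeriv Γ μ (connMat γ ν) p.2 κ lam - covDeriv Γ ν (connMat γ μ) p.2 κ lam)
          + p.1 ^ 2 * ((connMat γ μ p.2 * connMat γ ν p.2) κ lam
            - (connMat γ ν p.2 * connMat γ μ p.2) κ lam) := by
      filter_upwards [continuousAt_snd.preimage_mem_nhds (x := ((0 : ℝ), y)) (hUn y hy)] with p hp
      rw [hcurv p.2 hp]
      rfl
    refine ContDiffAt.congr_of_eventuallyEq ?_ hev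
    have hsnd : ∀ {X : CoordSpace → Matrix (Fin 4) (Fin 4) ℝ}, SmoothMatrixAt X y →
        ContDiffAt ℝ ∞ (fun p : ℝ × CoordSpace => X p.2 κ lam) (0, y) := fun hX =>
      contDiffAt_snd_of_contDiffAt (hX κ lam)
    have hD := fun α β => hsnd (smoothMatrixAt_covDeriv (hΓm y hy) (hγm y β) α)
    have hM := fun α β => hsnd (X := fun z => connMat γ α z * connMat γ β z)
      (contDiffAt_matrix_mul (hγm y α) (hγm y β))
    exact ((hsnd (smoothMatrixAt_curvMat (hΓm y hy) μ ν)).add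
      (contDiffAt_fst.mul ((hD μ ν).sub (hD ν μ)))).add
      ((contDiffAt_fst.pow 2).mul ((hM μ ν).sub (hM ν μ)))
  · intro y hy
    obtain ⟨P, hP⟩ := hgP y hy
    refine ⟨P, hP, ?_⟩
    simp only [hcurv0]
    exact (hcq _ P _ hP (hpure y hy)).2
  · intro y hy
    obtain ⟨P, hP⟩ := hgP y hy
    have hdd := (hcq _ P _ hP (hpure y hy)).1
    simp only [hcurv y hy]
    rw [← hc.ymPairing_linearVariation hy hP.isUnit_det_metric hP.inv_symm (hgm y hy) (hΓm y hy)
      (hγm y) hdd]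
    exact hasDerivAt_ymDensity_curvature hP.inv_symm _ _ _

end ConnectionAction

/-! ### Pseudoinstantons and the field equations. -/

section Pseudoinstantons

variable {M : Type*} [TopologicalSpace M] [ChartedSpace CoordSpace M]
  [IsManifold 𝓘(ℝ, CoordSpace) ∞ M] {S : Spacetime M} {e : OpenPartialHomeomorph M CoordSpace}

theorem Spacetime.IsMetricCompatible.isCompatibleOn (hS : S.IsMetricCompatible)
    (he : e ∈ IsManifold.maximalAtlas 𝓘(ℝ, CoordSpace) ∞ M) :
    IsCompatibleOn (S.metricComp e) (S.connComp e) e.target := by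
  intro y hy lam
  ext μ ν
  have h := hS e he y hy lam μ ν
  simp only [partialMat, Matrix.of_apply, Matrix.add_apply, Matrix.mul_apply, connMat,
    Matrix.transpose_apply]
  simp only [mul_comm (S.metricComp e y μ _)]
  linarith

theorem fieldEquations_of_hasCurvatureOfType [T2Space M] {q : QuadraticForm ℝ CurvatureTensor}
    (hq : IsLorentzInvariant q) {i : PieceLabel}
    (hi : i = .scalar ∨ i = .pseudoscalar ∨ i = .weyl) (hS : S.IsMetricCompatible)
    (hR : S.HasCurvatureOfType i) : S.MetricFieldEquation q ∧ S.ConnectionFieldEquation q := by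
  constructor
  · intro e he K hK hKU h hh hhs _
    exact hasDerivAt_action_metric hq hi hK e.open_target hKU (S.contDiffOn_metricComp he)
      (S.metricComp_symm e) (fun y hy => exists_orthonormalFrame S he hy) (S.contDiffOn_connComp he)
      (hR e he) hh hhs
  · intro e he K hK hKU γ hγ hγ0
    exact hasDerivAt_action_connection hq hi hK e.open_target hKU (S.contDiffOn_metricComp he)
      (S.metricComp_symm e) (fun y hy => exists_orthonormalFrame S he hy) (S.contDiffOn_connComp he)
      (hS.isCompatibleOn he) (hR e he) hγ hγ0

/-- The 30-dimensional piece of curvature vanishes for a metric compatible connection. -/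
theorem Spacetime.IsMetricCompatible.curvature_eq_zero_of_thirty [T2Space M]
    (hS : S.IsMetricCompatible) (hR : S.HasCurvatureOfType .thirty)
    (he : e ∈ IsManifold.maximalAtlas 𝓘(ℝ, CoordSpace) ∞ M) {y : CoordSpace} (hy : y ∈ e.target) :
    curvature (S.connComp e) y = 0 := by
  have hn := e.open_target.mem_nhds hy
  obtain ⟨P, hP⟩ := exists_orthonormalFrame S he hy
  have hu := hP.isUnit_det_metric
  refine curvMat_ext fun α β => ?_
  have h1 := (hS.isCompatibleOn he).curvMat_skew e.open_target hy
    (fun i j => (S.contDiffOn_metricComp he i j).contDiffAt hn)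
    (fun μ κ lam => (S.contDiffOn_connComp he κ μ lam).contDiffAt hn) α β
  -- Compatibility makes the lowered curvature skew in its first pair, while the piece makes it
  -- symmetric; both together force zero.
  have h2 : (S.metricComp e y * curvMat (curvature (S.connComp e) y) α β)ᵀ
      = S.metricComp e y * curvMat (curvature (S.connComp e) y) α β := by
    ext κ lam
    exact (hR e he y hy).inPiece.2 lam κ α β
  rw [Matrix.transpose_mul, S.metricComp_symm e y] at h2
  rw [h2] at h1
  have h3 : S.metricComp e y * curvMat (curvature (S.connComp e) y) α β = 0 := by
    ext κ lam
    exact self_eq_neg.1 (congrFun (congrFun h1 κ) lam)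
  have h4 := congrArg ((S.metricComp e y)⁻¹ * ·) h3
  simp only [Matrix.nonsing_inv_mul_cancel_left _ _ hu, Matrix.mul_zero] at h4
  exact h4

theorem isPurely_zero (g : Matrix (Fin 4) (Fin 4) ℝ) (i : PieceLabel) : IsPurely g i 0 :=
  ⟨fun _ => 0, ⟨fun _ => Submodule.zero_mem _, by simp⟩, fun _ _ => rfl⟩

theorem Spacetime.IsPseudoinstanton.fieldEquations [T2Space M]
    {q : QuadraticForm ℝ CurvatureTensor} (hq : IsLorentzInvariant q) (hS : S.IsPseudoinstanton) :
    S.MetricFieldEquation q ∧ S.ConnectionFieldEquation q := by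
  obtain ⟨hc, i, hi, hR⟩ := hS
  rcases hi.cases with h | h | h | rfl
  · exact fieldEquations_of_hasCurvatureOfType hq (.inl h) hc hR
  · exact fieldEquations_of_hasCurvatureOfType hq (.inr (.inl h)) hc hR
  · exact fieldEquations_of_hasCurvatureOfType hq (.inr (.inr h)) hc hR
  -- The curvature vanishes in this case, and zero curvature counts as scalar type.
  · refine fieldEquations_of_hasCurvatureOfType (i := .scalar) hq (.inl rfl) hc fun e he y hy => ?_
    rw [hc.curvature_eq_zero_of_thirty hR he hy]
    exact isPurely_zero _ _

end Pseudoinstantons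

theorem mainTheorem3 {M : Type*} [TopologicalSpace M] [T2Space M] [SecondCountableTopology M]
    [ConnectedSpace M] [ChartedSpace CoordSpace M] [IsManifold 𝓘(ℝ, CoordSpace) ∞ M]
    (S : Spacetime M) (q : QuadraticForm ℝ CurvatureTensor) (hq : IsLorentzInvariant q) :
    (S.IsPseudoinstanton → S.MetricFieldEquation q ∧ S.ConnectionFieldEquation q) ∧
    (S.IsScalarPseudoinstanton → S.MetricFieldEquation q ∧ S.ConnectionFieldEquation q) ∧
    (S.IsPseudoscalarPseudoinstanton → S.MetricFieldEquation q ∧ S.ConnectionFieldEquation q) ∧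
    (S.IsWeylPseudoinstanton → S.MetricFieldEquation q ∧ S.ConnectionFieldEquation q) := by
  refine ⟨fun h => h.fieldEquations hq, fun h => ?_, fun h => ?_, fun h => ?_⟩
  · exact fieldEquations_of_hasCurvatureOfType hq (.inl rfl) h.1 h.2
  · exact fieldEquations_of_hasCurvatureOfType hq (.inr (.inl rfl)) h.1 h.2
  · exact fieldEquations_of_hasCurvatureOfType hq (.inr (.inr rfl)) h.1 h.2
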